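/- Let $g\ge 12$ be an integer. Let $C=C_1\cup C_2$ be a binary curve of genus $g$ over $\mathbb C$: two copies of $\mathbb P^1$ meeting transversally at $g+1$ nodes $P_1,\dots,P_{g+1}$, where $P_i$ is obtained by gluing a point $p_i\in C_1$ to a point $q_i\in C_2$ (the $p_i$ pairwise distinct, the $q_i$ pairwise distinct). For signs $h=(h_1,\dots,h_{g+1})\in\{\pm1\}^{g+1}$ let $A=A_h\in\mathrm{Pic}^0(C)\cong(\mathbb C^*)^{g+1}/\mathbb C^*$ be the $2$-torsion line bundle obtained from the trivial bundles on $C_1$ and $C_2$ by gluing the fibre over $p_i$ to the fibre over $q_i$ by multiplication with $h_i$. Assume that the numbers of $i$ with $h_i=1$ and with $h_i=-1$ differ by at most one; that is, up to renumbering the nodes and replacing $h$ by $-h$, one has $h_i=1$ for $i\le\lfloor g/2\rfloor$ and for $i=g+1$, and $h_i=-1$ for $\lfloor g/2\rfloor<i\le g$. In particular $A$ is nontrivial; for general $C$ the linear system $|\omega_C\otimes A|$ embeds $C$ in $\mathbb P^{g-2}$ as a Prym-canonical binary curve. Let $$\mu_A:\Lambda^2H^0(C,\omega_C\otimes A)\longrightarrow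 H^0(C,\Omega^1_C\otimes\omega_C^{\otimes 2})$$ be the first Gaussian map. It is given locally by $\mu_A(\sigma_1\wedge\sigma_2)=(f_1\,df_2-f_2\,df_1)\,\xi^2\otimes l^2$, where $\sigma_j=f_j\,\xi\otimes l$ with local generators $\xi$ of the dualizing sheaf $\omega_C$ and $l$ of $A$; here $\Omega^1_C$ is the sheaf of Kähler differentials (which has torsion at the nodes) and $A^{\otimes2}\cong\mathcal O_C$ is used. Then, for every such $h$, the map $\mu_A$ is surjective for the general binary curve $C$ of genus $g$, i.e. for all $(p_1,\dots,p_{g+1},q_1,\dots,q_{g+1})$, with respect to affine coordinates on $C_1$ and $C_2$, in a nonempty Zariski open subset of the parameter space. -/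

import Mathlib

noncomputable section

open scoped Polynomial

namespace PrymGauss

/-! ### Rational functions on the projective line -/

/-- The rational function `f` on `ℙ¹` is regular at the finite point `c`. -/
def IsRegularAt (c : ℂ) (f : RatFunc ℂ) : Prop := f.denom.eval c ≠ 0

/-- The value of a rational function at a finite point (meaningful where it is regular). -/
def value (c : ℂ) (f : RatFunc ℂ) : ℂ := f.eval (RingHom.id ℂ) c

/-- The rational function `f` vanishes to order at least `n` at the point `∞` of `ℙ¹`
(this holds for `f = 0`, since `degree 0 = ⊥`). -/
def VanishesAtInfty (n : ℕ) (f : RatFunc ℂ) : Prop := f.num.degree + n ≤ f.denom.degree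

theorem isRegularAt_of_eq {c : ℂ} {f : RatFunc ℂ} (p q : ℂ[X]) (hq : q.eval c ≠ 0)
    (h : f = algebraMap _ _ p / algebraMap _ _ q) : IsRegularAt c f := by
  have hq0 : q ≠ 0 := by rintro rfl; simp at hq
  obtain ⟨r, hr⟩ := (RatFunc.denom_dvd hq0).2 ⟨p, h⟩
  intro h0
  apply hq
  rw [hr, Polynomial.eval_mul, h0, zero_mul]

theorem isRegularAt_algebraMap (c : ℂ) (p : ℂ[X]) :
    IsRegularAt c (algebraMap ℂ[X] (RatFunc ℂ) p) :=
  isRegularAt_of_eq p 1 (by simp) (by simp)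

theorem IsRegularAt.add {c : ℂ} {f g : RatFunc ℂ} (hf : IsRegularAt c f) (hg : IsRegularAt c g) :
    IsRegularAt c (f + g) := by
  intro h0
  obtain ⟨r, hr⟩ := RatFunc.denom_add_dvd f g
  have := congrArg (Polynomial.eval c) hr
  rw [Polynomial.eval_mul, Polynomial.eval_mul, h0, zero_mul] at this
  exact (mul_ne_zero hf hg) this

theorem IsRegularAt.mul {c : ℂ} {f g : RatFunc ℂ} (hf : IsRegularAt c f) (hg : IsRegularAt c g) :
    IsRegularAt c (f * g) := by
  intro h0
  obtain ⟨r, hr⟩ := RatFunc.denom_mul_dvd f g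
  have := congrArg (Polynomial.eval c) hr
  rw [Polynomial.eval_mul, Polynomial.eval_mul, h0, zero_mul] at this
  exact (mul_ne_zero hf hg) this

theorem isRegularAt_const (c z : ℂ) : IsRegularAt c (algebraMap ℂ (RatFunc ℂ) z) := by
  rw [RatFunc.algebraMap_eq_C]
  simp [IsRegularAt]

theorem IsRegularAt.smul {c : ℂ} {f : RatFunc ℂ} (z : ℂ) (hf : IsRegularAt c f) :
    IsRegularAt c (z • f) := by
  rw [Algebra.smul_def]
  exact (isRegularAt_const c z).mul hf

theorem IsRegularAt.sub {c : ℂ} {f g : RatFunc ℂ} (hf : IsRegularAt c f) (hg : IsRegularAt c g) :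
    IsRegularAt c (f - g) := by
  have := hf.add (hg.smul (-1))
  simpa [sub_eq_add_neg] using this

theorem value_add {c : ℂ} {f g : RatFunc ℂ} (hf : IsRegularAt c f) (hg : IsRegularAt c g) :
    value c (f + g) = value c f + value c g :=
  RatFunc.eval_add (RingHom.id ℂ) (a := c) hf hg

theorem value_mul {c : ℂ} {f g : RatFunc ℂ} (hf : IsRegularAt c f) (hg : IsRegularAt c g) :
    value c (f * g) = value c f * value c g :=
  RatFunc.eval_mul (RingHom.id ℂ) (a := c) hf hg

theorem value_const (c z : ℂ) : value c (algebraMap ℂ (RatFunc ℂ) z) = z := by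
  rw [RatFunc.algebraMap_eq_C]
  simp [value]

theorem vanishesAtInfty_iff {n : ℕ} {f : RatFunc ℂ} {p q : ℂ[X]} (hq : q ≠ 0)
    (h : f = algebraMap _ _ p / algebraMap _ _ q) :
    VanishesAtInfty n f ↔ p.degree + n ≤ q.degree := by
  have hd := f.denom_ne_zero
  have key : f.num * q = p * f.denom := (RatFunc.num_mul_eq_mul_denom_iff hq).2 h
  have e := congrArg Polynomial.degree key
  rw [Polynomial.degree_mul, Polynomial.degree_mul] at e
  unfold VanishesAtInfty
  rw [Polynomial.degree_eq_natDegree hq, Polynomial.degree_eq_natDegree hd] at *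
  by_cases hp : p = 0
  · have hn : f.num = 0 := by
      have : f.num * q = 0 := by rw [key, hp, zero_mul]
      exact (mul_eq_zero.1 this).resolve_right hq
    simp [hp, hn]
  · have hn : f.num ≠ 0 := by
      intro hn
      rw [hn, zero_mul] at key
      exact (mul_ne_zero hp hd) key.symm
    rw [Polynomial.degree_eq_natDegree hp, Polynomial.degree_eq_natDegree hn] at *
    norm_cast at *
    omega

theorem VanishesAtInfty.add {n : ℕ} {f g : RatFunc ℂ} (hf : VanishesAtInfty n f)
    (hg : VanishesAtInfty n g) : VanishesAtInfty n (f + g) := by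
  have hdf := f.denom_ne_zero
  have hdg := g.denom_ne_zero
  have e : f + g = algebraMap _ _ (f.num * g.denom + f.denom * g.num) /
      algebraMap _ _ (f.denom * g.denom) := by
    rw [map_mul, map_add, map_mul, map_mul, ← div_add_div, RatFunc.num_div_denom,
      RatFunc.num_div_denom]
    · exact RatFunc.algebraMap_ne_zero hdf
    · exact RatFunc.algebraMap_ne_zero hdg
  rw [vanishesAtInfty_iff (mul_ne_zero hdf hdg) e]
  have h1 : (f.num * g.denom).degree + n ≤ (f.denom * g.denom).degree := by
    rw [Polynomial.degree_mul, Polynomial.degree_mul, add_right_comm]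
    exact add_le_add hf le_rfl
  have h2 : (f.denom * g.num).degree + n ≤ (f.denom * g.denom).degree := by
    rw [Polynomial.degree_mul, Polynomial.degree_mul, add_assoc]
    exact add_le_add le_rfl hg
  rcases le_total (f.num * g.denom).degree (f.denom * g.num).degree with h | h
  · exact (add_le_add ((Polynomial.degree_add_le _ _).trans (max_le h le_rfl)) le_rfl).trans h2
  · exact (add_le_add ((Polynomial.degree_add_le _ _).trans (max_le le_rfl h)) le_rfl).trans h1

theorem vanishesAtInfty_zero (n : ℕ) : VanishesAtInfty n 0 := by simp [VanishesAtInfty]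

theorem VanishesAtInfty.smul {n : ℕ} {f : RatFunc ℂ} (z : ℂ) (hf : VanishesAtInfty n f) :
    VanishesAtInfty n (z • f) := by
  have e : z • f = algebraMap _ _ (Polynomial.C z * f.num) / algebraMap _ _ f.denom := by
    rw [map_mul, RatFunc.algebraMap_C, mul_div_assoc, RatFunc.num_div_denom,
      RatFunc.smul_eq_C_mul]
  rw [vanishesAtInfty_iff f.denom_ne_zero e]
  refine le_trans (add_le_add ?_ le_rfl) hf
  rw [← Polynomial.smul_eq_C_mul]
  exact Polynomial.degree_smul_le _ _

/-! ### Differentiation of rational functions -/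

/-- The derivative `df/dt` by the quotient rule. -/
def ratDeriv (f : RatFunc ℂ) : RatFunc ℂ :=
  algebraMap ℂ[X] (RatFunc ℂ)
      (Polynomial.derivative f.num * f.denom - f.num * Polynomial.derivative f.denom) /
    algebraMap ℂ[X] (RatFunc ℂ) (f.denom ^ 2)

theorem quotient_rule_aux {R : Type*} [CommRing R] {N N' D D' p p' q q' : R} (h : N * q = p * D)
    (h' : N' * q + N * q' = p' * D + p * D') :
    (N' * D - N * D') * q ^ 2 = (p' * q - p * q') * D ^ 2 := by
  linear_combination (D * q) * h' - (D * q' + D' * q) * h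

theorem ratDeriv_eq {f : RatFunc ℂ} {p q : ℂ[X]} (hq : q ≠ 0)
    (h : f = algebraMap _ _ p / algebraMap _ _ q) :
    ratDeriv f = algebraMap ℂ[X] (RatFunc ℂ)
      (Polynomial.derivative p * q - p * Polynomial.derivative q) /
        algebraMap ℂ[X] (RatFunc ℂ) (q ^ 2) := by
  have hd := f.denom_ne_zero
  have key : f.num * q = p * f.denom := (RatFunc.num_mul_eq_mul_denom_iff hq).2 h
  have key' := congrArg Polynomial.derivative key
  rw [Polynomial.derivative_mul, Polynomial.derivative_mul] at key'
  unfold ratDeriv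
  rw [div_eq_div_iff (RatFunc.algebraMap_ne_zero (pow_ne_zero 2 hd))
    (RatFunc.algebraMap_ne_zero (pow_ne_zero 2 hq)), ← map_mul, ← map_mul]
  exact congrArg _ (quotient_rule_aux key key')

theorem ratDeriv_add (f g : RatFunc ℂ) : ratDeriv (f + g) = ratDeriv f + ratDeriv g := by
  have hdf := RatFunc.algebraMap_ne_zero f.denom_ne_zero
  have hdg := RatFunc.algebraMap_ne_zero g.denom_ne_zero
  have e : f + g = algebraMap _ _ (f.num * g.denom + f.denom * g.num) /
      algebraMap _ _ (f.denom * g.denom) := by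
    rw [map_mul, map_add, map_mul, map_mul, ← div_add_div _ _ hdf hdg, RatFunc.num_div_denom,
      RatFunc.num_div_denom]
  rw [ratDeriv_eq (mul_ne_zero f.denom_ne_zero g.denom_ne_zero) e, ratDeriv, ratDeriv]
  simp only [Polynomial.derivative_mul, map_add, map_mul, map_sub, map_pow]
  field_simp
  ring

theorem ratDeriv_mul (f g : RatFunc ℂ) :
    ratDeriv (f * g) = f * ratDeriv g + g * ratDeriv f := by
  have hdf := RatFunc.algebraMap_ne_zero f.denom_ne_zero
  have hdg := RatFunc.algebraMap_ne_zero g.denom_ne_zero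
  have e : f * g = algebraMap _ _ (f.num * g.num) / algebraMap _ _ (f.denom * g.denom) := by
    rw [map_mul, map_mul, ← div_mul_div_comm, RatFunc.num_div_denom, RatFunc.num_div_denom]
  rw [ratDeriv_eq (mul_ne_zero f.denom_ne_zero g.denom_ne_zero) e]
  have ef : f * algebraMap ℂ[X] (RatFunc ℂ) f.denom = algebraMap ℂ[X] (RatFunc ℂ) f.num :=
    (eq_div_iff hdf).1 (RatFunc.num_div_denom f).symm
  have eg : g * algebraMap ℂ[X] (RatFunc ℂ) g.denom = algebraMap ℂ[X] (RatFunc ℂ) g.num :=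
    (eq_div_iff hdg).1 (RatFunc.num_div_denom g).symm
  rw [ratDeriv, ratDeriv]
  simp only [Polynomial.derivative_mul, map_add, map_mul, map_sub, map_pow, ← ef, ← eg]
  field_simp
  ring

theorem ratDeriv_const (z : ℂ) : ratDeriv (algebraMap ℂ (RatFunc ℂ) z) = 0 := by
  rw [RatFunc.algebraMap_eq_C]
  simp [ratDeriv]

/-- Differentiation with respect to the coordinate, as a `ℂ`-derivation of the function field. -/
def derivRat : Derivation ℂ (RatFunc ℂ) (RatFunc ℂ) :=
  Derivation.mk'
    { toFun := ratDeriv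
      map_add' := ratDeriv_add
      map_smul' := fun z f => by
        rw [Algebra.smul_def, ratDeriv_mul, ratDeriv_const, mul_zero, add_zero, RingHom.id_apply,
          Algebra.smul_def] }
    (fun f g => by simp [ratDeriv_mul])

theorem IsRegularAt.ratDeriv {c : ℂ} {f : RatFunc ℂ} (hf : IsRegularAt c f) :
    IsRegularAt c (ratDeriv f) :=
  isRegularAt_of_eq _ (f.denom ^ 2) (by rw [Polynomial.eval_pow]; exact pow_ne_zero 2 hf) rfl

theorem degree_wronskian_le {P R : ℂ[X]} {n : ℕ} (hP : P.degree + 2 ≤ n) (hR : R.degree + 2 ≤ n) :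
    (Polynomial.wronskian P R).degree + 6 ≤ n + n := by
  have main : ∀ {P R : ℂ[X]}, P.degree + 2 ≤ n → R.degree + 3 ≤ n →
      (Polynomial.wronskian P R).degree + 6 ≤ n + n := by
    intro P R hP hR
    by_cases hP0 : P = 0
    · simp [hP0]
    by_cases hR0 : R = 0
    · simp [hR0]
    by_cases hW : Polynomial.wronskian P R = 0
    · simp [hW]
    have := Polynomial.degree_wronskian_lt_add hP0 hR0
    rw [Polynomial.degree_eq_natDegree hP0, Polynomial.degree_eq_natDegree hR0] at *
    rw [Polynomial.degree_eq_natDegree hW] at *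
    norm_cast at *
    omega
  by_cases hPn : P.degree + 3 ≤ n
  · have := main hR hPn
    rwa [← Polynomial.wronskian_neg_eq, Polynomial.degree_neg] at this
  · have hP0 : P ≠ 0 := by rintro rfl; simp at hPn
    obtain ⟨a, ha⟩ : ∃ a : ℂ, (R - Polynomial.C a * P).degree + 3 ≤ n := by
      have hl : P.coeff P.natDegree ≠ 0 := by simpa using hP0
      refine ⟨R.coeff P.natDegree / P.coeff P.natDegree, ?_⟩
      rw [Polynomial.degree_eq_natDegree hP0] at hP hPn
      norm_cast at hP hPn
      have hlt : (R - Polynomial.C (R.coeff P.natDegree / P.coeff P.natDegree) * P).degree <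
          (P.natDegree : ℕ) := by
        rw [Polynomial.degree_lt_iff_coeff_zero]
        intro m hm
        rw [Polynomial.coeff_sub, Polynomial.coeff_C_mul]
        rcases hm.eq_or_lt with rfl | hm
        · field_simp
          ring
        · rw [Polynomial.coeff_eq_zero_of_natDegree_lt hm, mul_zero, sub_zero]
          by_cases hR0 : R = 0
          · simp [hR0]
          apply Polynomial.coeff_eq_zero_of_natDegree_lt
          rw [Polynomial.degree_eq_natDegree hR0] at hR
          norm_cast at hR
          omega
      by_cases h0 : R - Polynomial.C (R.coeff P.natDegree / P.coeff P.natDegree) * P = 0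
      · rw [h0]
        simp
      · rw [Polynomial.degree_eq_natDegree h0] at hlt ⊢
        norm_cast at *
        omega
    have := main hP ha
    have e : Polynomial.wronskian P (R - Polynomial.C a * P) = Polynomial.wronskian P R := by
      simp only [Polynomial.wronskian, Polynomial.derivative_sub, Polynomial.derivative_mul,
        Polynomial.derivative_C]
      ring
    rwa [e] at this

/-- If `f dt` and `g dt` are regular at `∞`, so is the cubic differential `(f g' - g f') (dt)³`. -/
theorem VanishesAtInfty.wronskian {f g : RatFunc ℂ} (hf : VanishesAtInfty 2 f)
    (hg : VanishesAtInfty 2 g) : VanishesAtInfty 6 (f * ratDeriv g - g * ratDeriv f) := by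
  have hf0 := RatFunc.algebraMap_ne_zero f.denom_ne_zero
  have hg0 := RatFunc.algebraMap_ne_zero g.denom_ne_zero
  have hQ : f.denom * g.denom ≠ 0 := mul_ne_zero f.denom_ne_zero g.denom_ne_zero
  have ef : f = algebraMap _ _ (f.num * g.denom) / algebraMap _ _ (f.denom * g.denom) := by
    conv_lhs => rw [← RatFunc.num_div_denom f]
    simp only [map_mul]
    field_simp
  have eg : g = algebraMap _ _ (g.num * f.denom) / algebraMap _ _ (f.denom * g.denom) := by
    conv_lhs => rw [← RatFunc.num_div_denom g]
    simp only [map_mul]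
    field_simp
  have hP := (vanishesAtInfty_iff hQ ef).1 hf
  have hR := (vanishesAtInfty_iff hQ eg).1 hg
  have df := ratDeriv_eq hQ ef
  have dg := ratDeriv_eq hQ eg
  generalize f.num * g.denom = P at *
  generalize g.num * f.denom = R at *
  generalize f.denom * g.denom = Q at *
  have hQ' := RatFunc.algebraMap_ne_zero hQ
  have e : f * ratDeriv g - g * ratDeriv f =
      algebraMap _ _ (Polynomial.wronskian P R) / algebraMap _ _ (Q ^ 2) := by
    rw [df, dg]
    rw [ef, eg]
    simp only [Polynomial.wronskian, map_mul, map_sub, map_pow]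
    field_simp
    ring
  rw [vanishesAtInfty_iff (pow_ne_zero 2 hQ) e, Polynomial.degree_pow]
  rw [Polynomial.degree_eq_natDegree hQ] at *
  have := degree_wronskian_le hP hR
  rwa [two_nsmul]

/-! ### Binary curves -/

/-- The Kähler differential `f dg - g df`. -/
def wronskianDiff {R : Type*} [CommRing R] [Algebra ℂ R] (f g : R) : Ω[R⁄ℂ] :=
  f • KaehlerDifferential.D ℂ R g - g • KaehlerDifferential.D ℂ R f

theorem wronskianDiff_add_left {R : Type*} [CommRing R] [Algebra ℂ R] (f f' g : R) :
    wronskianDiff (f + f') g = wronskianDiff f g + wronskianDiff f' g := by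
  simp only [wronskianDiff, map_add, add_smul, smul_add]
  abel

theorem wronskianDiff_smul_left {R : Type*} [CommRing R] [Algebra ℂ R] (z : ℂ) (f g : R) :
    wronskianDiff (z • f) g = z • wronskianDiff f g := by
  simp only [wronskianDiff, Derivation.map_smul, smul_sub, smul_assoc, smul_comm g z]

/-- The total ring of fractions `ℂ(s) × ℂ(t)` of a curve with two rational components. -/
abbrev Tot : Type := RatFunc ℂ × RatFunc ℂ

/-- Differentiation `(f₁, f₂) ↦ (df₁/ds, df₂/dt)` on the total ring of fractions. -/
def derivTot : Derivation ℂ Tot Tot :=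
  Derivation.mk' (derivRat.toLinearMap.prodMap derivRat.toLinearMap) (fun f g => by
    ext <;> simp)

/-- A binary curve of genus `g` with numbered nodes: two copies `C₁`, `C₂` of `ℙ¹`, the `g + 1`
distinct points `p i` of `C₁` being glued transversally to the `g + 1` distinct points `q i` of
`C₂`. The affine coordinates `s`, `t` on the two components are chosen such that `∞` is not a
node, which is always possible. -/
structure BinaryCurve (g : ℕ) where
  /-- The nodes on the first component. -/
  p : Fin (g + 1) → ℂ
  /-- The nodes on the second component. -/
  q : Fin (g + 1) → ℂ
  p_injective : Function.Injective p
  q_injective : Function.Injective q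

namespace BinaryCurve

variable {g : ℕ} (C : BinaryCurve g)

/-- The local ring `𝒪_{C, Pᵢ}` at the `i`-th node: pairs of rational functions that are regular at
the two points over the node and have the same value there. -/
def nodeRing (i : Fin (g + 1)) : Subalgebra ℂ Tot where
  carrier := {f | IsRegularAt (C.p i) f.1 ∧ IsRegularAt (C.q i) f.2 ∧
    value (C.p i) f.1 = value (C.q i) f.2}
  mul_mem' := by
    rintro f f' ⟨h1, h2, h3⟩ ⟨h1', h2', h3'⟩
    refine ⟨h1.mul h1', h2.mul h2', ?_⟩
    rw [Prod.fst_mul, Prod.snd_mul, value_mul h1 h1', value_mul h2 h2', h3, h3']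
  add_mem' := by
    rintro f f' ⟨h1, h2, h3⟩ ⟨h1', h2', h3'⟩
    refine ⟨h1.add h1', h2.add h2', ?_⟩
    rw [Prod.fst_add, Prod.snd_add, value_add h1 h1', value_add h2 h2', h3, h3']
  algebraMap_mem' := fun z =>
    ⟨isRegularAt_const _ z, isRegularAt_const _ z, (value_const _ z).trans (value_const _ z).symm⟩

/-- The pair `f` is regular at all the finite points of `C` other than the nodes. -/
def IsRegularOffNodes (f : Tot) : Prop :=
  (∀ c, c ∉ Set.range C.p → IsRegularAt c f.1) ∧ (∀ c, c ∉ Set.range C.q → IsRegularAt c f.2)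

/-- The local generator `ξᵢ = (ds / (s - pᵢ), - dt / (t - qᵢ))` of the dualizing sheaf `ω_C` at the
`i`-th node, given by its coefficients with respect to `ds` and `dt`. -/
def xi (i : Fin (g + 1)) : Tot :=
  ((RatFunc.X - RatFunc.C (C.p i))⁻¹, -(RatFunc.X - RatFunc.C (C.q i))⁻¹)

/-- The local generator `lᵢ = (1, hᵢ)` at the `i`-th node of the line bundle `A_h` that is obtained
from the trivial bundles on `C₁` and `C₂` by gluing the fibre over `pᵢ` to the fibre over `qᵢ` by
multiplication with `hᵢ`. For signs `hᵢ` one has `A_h ⊗ A_h = 𝒪_C`, by `lᵢ² = 1`. -/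
def ell (h : Fin (g + 1) → ℤˣ) (i : Fin (g + 1)) : Tot := (1, ((h i : ℤ) : RatFunc ℂ))

theorem xi_ne_zero (i : Fin (g + 1)) : (C.xi i).1 ≠ 0 ∧ (C.xi i).2 ≠ 0 := by
  have key : ∀ a : ℂ, (RatFunc.X - RatFunc.C a : RatFunc ℂ) ≠ 0 := by
    intro a
    rw [← RatFunc.algebraMap_X, ← RatFunc.algebraMap_C, ← map_sub]
    exact RatFunc.algebraMap_ne_zero (Polynomial.X_sub_C_ne_zero a)
  exact ⟨inv_ne_zero (key _), neg_ne_zero.2 (inv_ne_zero (key _))⟩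

theorem ell_sq (h : Fin (g + 1) → ℤˣ) (i : Fin (g + 1)) : ell h i * ell h i = 1 := by
  ext
  · simp [ell]
  · rcases Int.units_eq_one_or (h i) with e | e <;> simp [ell, e]

/-- The coefficient `f` in `σ = f ξᵢ ⊗ lᵢ` of a rational section `σ` of `ω_C ⊗ A_h`. -/
def coeff (h : Fin (g + 1) → ℤˣ) (i : Fin (g + 1)) (σ : Tot) : Tot := σ / (C.xi i * ell h i)

theorem coeff_eq (h : Fin (g + 1) → ℤˣ) (i : Fin (g + 1)) (σ : Tot) :
    C.coeff h i σ = (C.xi i * ell h i)⁻¹ * σ := by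
  rw [coeff]
  ext <;> simp only [Prod.fst_div, Prod.snd_div, Prod.fst_mul, Prod.snd_mul, Prod.fst_inv,
    Prod.snd_inv] <;> rw [div_eq_inv_mul]

theorem coeff_mul (h : Fin (g + 1) → ℤˣ) (i : Fin (g + 1)) (σ : Tot) :
    C.coeff h i σ * (C.xi i * ell h i) = σ := by
  have h1 := C.xi_ne_zero i
  have h2 : (ell h i).1 ≠ 0 ∧ (ell h i).2 ≠ 0 := by
    have e := ell_sq h i
    constructor <;> intro h0
    · have := congrArg Prod.fst e
      simp [h0] at this
    · have := congrArg Prod.snd e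
      simp [h0] at this
  rw [coeff]
  ext
  · exact div_mul_cancel₀ _ (mul_ne_zero h1.1 h2.1)
  · exact div_mul_cancel₀ _ (mul_ne_zero h1.2 h2.2)

/-- The space `H⁰(C, ω_C ⊗ A_h)`: pairs of rational differentials `(σ₁ ds, σ₂ dt)` that are regular
away from the nodes (at `∞` this means that the coefficients vanish to order `2`) and belong at
each node to `𝒪_{C, Pᵢ} ξᵢ ⊗ lᵢ`. -/
def prymSections (h : Fin (g + 1) → ℤˣ) : Submodule ℂ Tot where
  carrier := {σ | C.IsRegularOffNodes σ ∧ VanishesAtInfty 2 σ.1 ∧ VanishesAtInfty 2 σ.2 ∧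
    ∀ i, C.coeff h i σ ∈ C.nodeRing i}
  add_mem' := by
    rintro σ τ ⟨h1, h2, h3, h4⟩ ⟨h1', h2', h3', h4'⟩
    refine ⟨⟨fun c hc => (h1.1 c hc).add (h1'.1 c hc), fun c hc => (h1.2 c hc).add (h1'.2 c hc)⟩,
      h2.add h2', h3.add h3', fun i => ?_⟩
    have := add_mem (h4 i) (h4' i)
    rwa [coeff_eq, coeff_eq, ← mul_add, ← coeff_eq] at this
  zero_mem' := by
    refine ⟨⟨fun c _ => ?_, fun c _ => ?_⟩, vanishesAtInfty_zero _, vanishesAtInfty_zero _,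
      fun i => ?_⟩
    · simpa using isRegularAt_algebraMap c 0
    · simpa using isRegularAt_algebraMap c 0
    · rw [coeff_eq, mul_zero]
      exact zero_mem _
  smul_mem' := by
    rintro z σ ⟨h1, h2, h3, h4⟩
    refine ⟨⟨fun c hc => (h1.1 c hc).smul z, fun c hc => (h1.2 c hc).smul z⟩,
      h2.smul z, h3.smul z, fun i => ?_⟩
    have := Subalgebra.smul_mem _ (h4 i) z
    rwa [coeff_eq, ← mul_smul_comm, ← coeff_eq] at this

/-- The restriction of a Kähler differential of the local ring at the `i`-th node to the generic
points of the two components: `f dg ↦ (f₁ g₁', f₂ g₂')`, the coefficients with respect to `ds`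
and `dt`. Its kernel is the torsion. -/
def restr (i : Fin (g + 1)) : Ω[C.nodeRing i⁄ℂ] →ₗ[C.nodeRing i] Tot :=
  (derivTot.compAlgebraMap (C.nodeRing i)).liftKaehlerDifferential

/-- The space `H⁰(C, Ω¹_C ⊗ ω_C^{⊗ 2})`. A section is given by its value `F₁ (ds)³`, `F₂ (dt)³` at
the generic points of the two components, and by its germs `x i ⊗ ξᵢ²` at the nodes, where `x i` is
a Kähler differential of the local ring. The germs have to restrict to the generic value, which
has to be regular away from the nodes (at `∞` this means that the coefficients vanish to order
`6`). At the smooth points the sheaf has no torsion, so that the germs there are determined by the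
generic value. -/
def cubicSections : Submodule ℂ (Tot × (∀ i : Fin (g + 1), Ω[C.nodeRing i⁄ℂ])) where
  carrier := {w | C.IsRegularOffNodes w.1 ∧ VanishesAtInfty 6 w.1.1 ∧ VanishesAtInfty 6 w.1.2 ∧
    ∀ i, C.restr i (w.2 i) * (C.xi i) ^ 2 = w.1}
  add_mem' := by
    rintro v w ⟨h1, h2, h3, h4⟩ ⟨h1', h2', h3', h4'⟩
    refine ⟨⟨fun c hc => (h1.1 c hc).add (h1'.1 c hc), fun c hc => (h1.2 c hc).add (h1'.2 c hc)⟩,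
      h2.add h2', h3.add h3', fun i => ?_⟩
    rw [Prod.snd_add, Prod.fst_add, Pi.add_apply, map_add, add_mul, h4, h4']
  zero_mem' := by
    refine ⟨⟨fun c _ => ?_, fun c _ => ?_⟩, vanishesAtInfty_zero _, vanishesAtInfty_zero _,
      fun i => ?_⟩
    · simpa using isRegularAt_algebraMap c 0
    · simpa using isRegularAt_algebraMap c 0
    · simp
  smul_mem' := by
    rintro z w ⟨h1, h2, h3, h4⟩
    refine ⟨⟨fun c hc => (h1.1 c hc).smul z, fun c hc => (h1.2 c hc).smul z⟩,
      h2.smul z, h3.smul z, fun i => ?_⟩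
    rw [Prod.smul_snd, Prod.smul_fst, Pi.smul_apply, LinearMap.map_smul_of_tower, smul_mul_assoc,
      h4]

/-- The coefficient `f` in `σ = f ξᵢ ⊗ lᵢ` of a section `σ` of `ω_C ⊗ A_h` at the `i`-th node, as
an element of the local ring. -/
def localCoeff (h : Fin (g + 1) → ℤˣ) (i : Fin (g + 1)) :
    C.prymSections h →ₗ[ℂ] C.nodeRing i where
  toFun σ := ⟨C.coeff h i σ, σ.2.2.2.2 i⟩
  map_add' σ τ := Subtype.ext (by simp [coeff_eq, mul_add])
  map_smul' z σ := Subtype.ext (by simp [coeff_eq])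

/-- The value of the Gaussian map on `σ ∧ τ`: the generic value is `(σ τ' - τ σ')` on each of the
two components; at the `i`-th node, where `σ = f₁ ξᵢ ⊗ lᵢ` and `τ = f₂ ξᵢ ⊗ lᵢ`, the germ is
`(f₁ df₂ - f₂ df₁) ξᵢ² ⊗ lᵢ²`, and `lᵢ² = 1`. -/
def gaussValue (h : Fin (g + 1) → ℤˣ) (σ τ : C.prymSections h) :
    Tot × (∀ i : Fin (g + 1), Ω[C.nodeRing i⁄ℂ]) :=
  ((σ : Tot) * derivTot (τ : Tot) - (τ : Tot) * derivTot (σ : Tot),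
    fun i => wronskianDiff (C.localCoeff h i σ) (C.localCoeff h i τ))

theorem gaussValue_mem (h : Fin (g + 1) → ℤˣ) (σ τ : C.prymSections h) :
    C.gaussValue h σ τ ∈ C.cubicSections := by
  obtain ⟨σ, hσ⟩ := σ
  obtain ⟨τ, hτ⟩ := τ
  obtain ⟨h1, h2, h3, h4⟩ := id hσ
  obtain ⟨h1', h2', h3', h4'⟩ := id hτ
  refine ⟨⟨fun c hc => ?_, fun c hc => ?_⟩, h2.wronskian h2', h3.wronskian h3', fun i => ?_⟩
  · exact ((h1.1 c hc).mul (h1'.1 c hc).ratDeriv).sub ((h1'.1 c hc).mul (h1.1 c hc).ratDeriv)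
  · exact ((h1.2 c hc).mul (h1'.2 c hc).ratDeriv).sub ((h1'.2 c hc).mul (h1.2 c hc).ratDeriv)
  · have e1 : C.restr i ((C.gaussValue h ⟨σ, hσ⟩ ⟨τ, hτ⟩).2 i) =
        C.coeff h i σ * derivTot (C.coeff h i τ) - C.coeff h i τ * derivTot (C.coeff h i σ) := by
      simp only [gaussValue, wronskianDiff, restr, map_sub, map_smul, Derivation.liftKaehlerDifferential_comp_D]
      rfl
    rw [e1]
    change _ = σ * derivTot τ - τ * derivTot σ
    have hs := C.coeff_mul h i σ
    have ht := C.coeff_mul h i τ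
    have hl := ell_sq h i
    generalize C.coeff h i σ = a at *
    generalize C.coeff h i τ = b at *
    rw [← hs, ← ht]
    simp only [Derivation.leibniz, smul_eq_mul]
    linear_combination (-(a * derivTot b - b * derivTot a) * (C.xi i) ^ 2) * hl

theorem gaussValue_add_left (h : Fin (g + 1) → ℤˣ) (σ σ' τ : C.prymSections h) :
    C.gaussValue h (σ + σ') τ = C.gaussValue h σ τ + C.gaussValue h σ' τ := by
  refine Prod.ext ?_ (funext fun i => ?_)
  · simp only [gaussValue, Prod.fst_add, Submodule.coe_add, map_add]
    ring
  · simp only [gaussValue, Prod.snd_add, Pi.add_apply, map_add]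
    exact wronskianDiff_add_left _ _ _

theorem gaussValue_smul_left (h : Fin (g + 1) → ℤˣ) (z : ℂ) (σ τ : C.prymSections h) :
    C.gaussValue h (z • σ) τ = z • C.gaussValue h σ τ := by
  refine Prod.ext ?_ (funext fun i => ?_)
  · simp only [gaussValue, Prod.smul_fst, Submodule.coe_smul, Derivation.map_smul,
      smul_mul_assoc, mul_smul_comm, smul_sub]
  · simp only [gaussValue, Prod.smul_snd, Pi.smul_apply, map_smul]
    exact wronskianDiff_smul_left _ _ _

theorem gaussValue_swap (h : Fin (g + 1) → ℤˣ) (σ τ : C.prymSections h) :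
    C.gaussValue h σ τ = -C.gaussValue h τ σ := by
  refine Prod.ext ?_ (funext fun i => ?_)
  · exact (neg_sub _ _).symm
  · exact (neg_sub _ _).symm

/-- The first Gaussian map as an alternating bilinear map. -/
def gaussAlt (h : Fin (g + 1) → ℤˣ) : C.prymSections h [⋀^Fin 2]→ₗ[ℂ] C.cubicSections where
  toFun v := ⟨C.gaussValue h (v 0) (v 1), C.gaussValue_mem h _ _⟩
  map_update_add' := by
    intro _ v i x y
    apply Subtype.ext
    fin_cases i
    · simpa using C.gaussValue_add_left h x y (v 1)
    · have := C.gaussValue_add_left h x y (v 0)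
      rw [C.gaussValue_swap h _ (v 0), C.gaussValue_swap h _ (v 0), C.gaussValue_swap h _ (v 0),
        ← neg_add, neg_inj] at this
      simpa using this
  map_update_smul' := by
    intro _ v i z x
    apply Subtype.ext
    fin_cases i
    · simpa using C.gaussValue_smul_left h z x (v 1)
    · have := C.gaussValue_smul_left h z x (v 0)
      rw [C.gaussValue_swap h _ (v 0), C.gaussValue_swap h _ (v 0), smul_neg, neg_inj] at this
      simpa using this
  map_eq_zero_of_eq' := by
    intro v i j hij hne
    have h01 : v 0 = v 1 := by
      fin_cases i <;> fin_cases j <;> first | exact absurd rfl hne | exact hij | exact hij.symm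
    apply Subtype.ext
    rw [h01]
    refine Prod.ext ?_ (funext fun j => ?_)
    · exact sub_self _
    · exact sub_self _

/-- The first Gaussian map `μ_A : Λ² H⁰(C, ω_C ⊗ A) → H⁰(C, Ω¹_C ⊗ ω_C^{⊗ 2})` for the `2`-torsion
line bundle `A = A_h`. -/
def gaussianMap (h : Fin (g + 1) → ℤˣ) : ⋀[ℂ]^2 (C.prymSections h) →ₗ[ℂ] C.cubicSections :=
  exteriorPower.alternatingMapLinearEquiv (C.gaussAlt h)

end BinaryCurve

/-- A property holds for the general binary curve of genus `g`: it holds on a non-empty Zariski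
open subset of the space of parameters `(p, q) ∈ ℂ^{g+1} × ℂ^{g+1}`. -/
def ForGeneralBinaryCurve (g : ℕ) (P : BinaryCurve g → Prop) : Prop :=
  ∃ F : MvPolynomial (Fin (g + 1) ⊕ Fin (g + 1)) ℂ, F ≠ 0 ∧
    ∀ C : BinaryCurve g, MvPolynomial.eval (Sum.elim C.p C.q) F ≠ 0 → P C

end PrymGauss

end

noncomputable section

open scoped Polynomial

namespace PrymGauss

/-! ### The Gaussian map in coordinates -/

/-! Put `n = g + 1`. A vector `a` with `∑ aⱼ = ∑ hⱼ aⱼ = 0` gives the section of `ω_C ⊗ A` with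
coefficients `∑ aⱼ / (s - pⱼ)` and `-∑ hⱼ aⱼ / (t - qⱼ)`. On the target side, a section of `Ω¹ ⊗ ω²`
consists of two cubic differentials with at most double poles at `n` points, hence `2n - 5`
parameters each, and of at most one torsion number per node: the torsion of the differentials of `xy
= 0` is spanned by `x dy = -y dx`. So the target has at most `5n - 10` parameters. Partial fractions
turn the value of the Gaussian map on `eⱼ ∧ eₖ` into the explicit vector `pairGauss` in `ℂ^{5n}`,
and surjectivity follows once the span `gaussSpan` of the values has dimension at least `5n - 10`
(`surjective_gaussianMap`).

The dimension of `gaussSpan` can only drop on a proper closed subset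
(`exists_polynomial_finrank_gaussSpan`). It is therefore enough to find, for each balanced sign
vector, one configuration of nodes with maximal rank.

Such configurations are built by induction on `n`, adding a node `(P, Q)` in general position
(`Admissible.cons`); five further dimensions have to appear. Four come from the polar parts at the
new node of wedges of a new section with old ones, since wedges of old sections have no pole there.
The fifth is the torsion at the new node: a non-zero element of `Λ²` on which the old Gaussian map
vanishes acquires non-zero torsion at a general `(P, Q)`. The dimension count used provides such an
element from `n = 14` on. At `n = 13` the source has dimension `11 · 10 / 2 = 55 = 5 · 13 - 10`, so
at maximal rank there is none.

Hence `n = 13` and `n = 14` are both base cases. They are settled by elimination modulo `17` for one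
explicit configuration. General balanced signs reduce to these by renumbering, by `h ↦ -h`, and by
dropping a node whose removal keeps the signs balanced (`admissible_of_balanced`). -/

/-- The coordinates of the value of the Gaussian map on `eⱼ ∧ eₖ`, for arrays `x`, `y` that stand
for `1 / (pⱼ - pₖ)` and `1 / (qⱼ - qₖ)`: at the node `r`, the first four coordinates are the
coefficients of the polar parts (of order two and one) on the two components, the last one is the
torsion. -/
def pairGauss {R ι : Type*} [CommRing R] [DecidableEq ι] (x y : ι → ι → R) (h : ι → R)
    (j k : ι) (κ : Fin 5 × ι) : R :=
  match κ.1 with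
  | 0 => (if κ.2 = j then x j k else 0) + (if κ.2 = k then x j k else 0)
  | 1 => (if κ.2 = j then x j k ^ 2 else 0) - (if κ.2 = k then x j k ^ 2 else 0)
  | 2 => h j * h k * ((if κ.2 = j then y j k else 0) + (if κ.2 = k then y j k else 0))
  | 3 => h j * h k * ((if κ.2 = j then y j k ^ 2 else 0) - (if κ.2 = k then y j k ^ 2 else 0))
  | 4 => h κ.2 * (h k * (x κ.2 j * y κ.2 k) - h j * (x κ.2 k * y κ.2 j))

/-- The vectors `a` with `∑ aⱼ = 0` and `∑ hⱼ aⱼ = 0`. -/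
def signKer {K ι : Type*} [Field K] [Fintype ι] (h : ι → K) : Submodule K (ι → K) where
  carrier := {a | ∑ j, a j = 0 ∧ ∑ j, h j * a j = 0}
  add_mem' := by
    rintro a b ⟨h1, h2⟩ ⟨h3, h4⟩
    simp [mul_add, Finset.sum_add_distrib, h1, h2, h3, h4]
  zero_mem' := by simp
  smul_mem' := by
    rintro z a ⟨h1, h2⟩
    simp [← Finset.mul_sum, mul_left_comm _ z, h1, h2]

/-- The span of the values `∑ aⱼ bₖ f(j, k)` for `a`, `b` in a subspace `V`. -/
def bilinSpan {K ι W : Type*} [Field K] [Fintype ι] [AddCommGroup W] [Module K W]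
    (V : Submodule K (ι → K)) (f : ι → ι → W) : Submodule K W :=
  Submodule.span K {w | ∃ a ∈ V, ∃ b ∈ V, w = ∑ j, ∑ k, (a j * b k) • f j k}

theorem mem_bilinSpan {K ι W : Type*} [Field K] [Fintype ι] [AddCommGroup W] [Module K W]
    {V : Submodule K (ι → K)} (f : ι → ι → W) {a b : ι → K} (ha : a ∈ V) (hb : b ∈ V) :
    ∑ j, ∑ k, (a j * b k) • f j k ∈ bilinSpan V f :=
  Submodule.subset_span ⟨a, ha, b, hb, rfl⟩

theorem map_bilinSpan {K ι W W' : Type*} [Field K] [Fintype ι] [AddCommGroup W] [Module K W]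
    [AddCommGroup W'] [Module K W'] (V : Submodule K (ι → K)) (f : ι → ι → W) (ρ : W →ₗ[K] W') :
    (bilinSpan V f).map ρ = bilinSpan V (fun j k => ρ (f j k)) := by
  rw [bilinSpan, Submodule.map_span, bilinSpan]
  congr 1
  ext w
  constructor
  · rintro ⟨_, ⟨a, ha, b, hb, rfl⟩, rfl⟩
    exact ⟨a, ha, b, hb, by simp⟩
  · rintro ⟨a, ha, b, hb, rfl⟩
    exact ⟨_, ⟨a, ha, b, hb, rfl⟩, by simp⟩

/-- The inverse differences `1 / (pⱼ - pₖ)`, zero on the diagonal. -/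
def diffInv {K ι : Type*} [Field K] (p : ι → K) (j k : ι) : K := (p j - p k)⁻¹

/-- Signs as elements of a field. -/
def signVal {ι : Type*} (h : ι → ℤˣ) (j : ι) : ℂ := ((h j : ℤ) : ℂ)

/-- The span of the coordinates of the values of the Gaussian map. -/
def gaussSpan {ι : Type*} [Fintype ι] [DecidableEq ι] (p q : ι → ℂ) (h : ι → ℤˣ) :
    Submodule ℂ (Fin 5 × ι → ℂ) :=
  bilinSpan (signKer (signVal h)) (pairGauss (diffInv p) (diffInv q) (signVal h))

/-- The matrix of the polar coordinates at a new node `(P, Q)` of `e_new ∧ bᵢ`. -/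
def nodeMatrix {ι : Type*} [Fintype ι] (p q : ι → ℂ) (h : ι → ℤˣ) (b : Fin 4 → ι → ℂ)
    (P Q : ℂ) : Matrix (Fin 4) (Fin 4) ℂ := fun i =>
  ![∑ k, b i k * (P - p k)⁻¹, ∑ k, b i k * (P - p k)⁻¹ ^ 2,
    ∑ k, signVal h k * b i k * (Q - q k)⁻¹, ∑ k, signVal h k * b i k * (Q - q k)⁻¹ ^ 2]

/-- There is a configuration of nodes for which the Gaussian map has maximal rank and for which
`(0, 0)` is a new node in general position. -/
def Admissible {ι : Type*} [Fintype ι] [DecidableEq ι] (h : ι → ℤˣ) : Prop :=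
  ∃ p q : ι → ℂ, Function.Injective p ∧ Function.Injective q ∧ (∀ i, p i ≠ 0) ∧ (∀ i, q i ≠ 0) ∧
    5 * Fintype.card ι ≤ Module.finrank ℂ (gaussSpan p q h) + 10 ∧
    ∃ b : Fin 4 → ι → ℂ, (∀ i, b i ∈ signKer (signVal h)) ∧ (nodeMatrix p q h b 0 0).det ≠ 0

/-! ### Gaussian elimination modulo `17` -/

/-- The combination of a row `x₀ :: x` with the pivot row `y₀ :: y` that has first entry zero,
without this entry. -/
def combineRow (y₀ : ℕ) (y : List ℕ) : List ℕ → List ℕ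
  | [] => []
  -- As `16 = -1` modulo `17`, the new entries are `y₀ u - x₀ v`: the row is scaled by the pivot,
  -- and no inverse is computed.
  | x₀ :: x => cond (Nat.beq x₀ 0) x (List.zipWith (fun u v => (y₀ * u + 16 * x₀ * v) % 17) x y)

/-- The first row with non-zero first entry. -/
def findPivot : List (List ℕ) → List ℕ
  | [] => []
  | [] :: _ => []
  | (x₀ :: x) :: rows => cond (Nat.beq (x₀ % 17) 0) (findPivot rows) (x₀ :: x)

/-- Gaussian elimination: whether the rows have full column rank `k` modulo `17`. -/
def fullColumnRank : ℕ → List (List ℕ) → Bool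
  | 0, _ => true
  | k + 1, rows =>
    match findPivot rows with
    | [] => false
    -- The pivot row need not be removed: combined with itself it becomes a zero row.
    | y₀ :: y => fullColumnRank k (rows.map (combineRow y₀ y))

/-- The pairing of a row with a vector modulo `17`. -/
def dotMod : List ℕ → List (ZMod 17) → ZMod 17
  | x :: xs, z :: zs => x * z + dotMod xs zs
  | _, _ => 0

theorem findPivot_spec (rows : List (List ℕ)) (y₀ : ℕ) (y : List ℕ)
    (e : findPivot rows = y₀ :: y) : (y₀ :: y) ∈ rows ∧ (y₀ : ZMod 17) ≠ 0 := by
  induction rows with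
  | nil => simp [findPivot] at e
  | cons r rows ih =>
    cases r with
    | nil => simp [findPivot] at e
    | cons x₀ x =>
      rw [findPivot] at e
      cases hb : Nat.beq (x₀ % 17) 0
      · rw [hb, cond_false] at e
        rw [List.cons.injEq] at e
        obtain ⟨rfl, rfl⟩ := e
        refine ⟨List.mem_cons_self, fun h0 => ?_⟩
        rw [ZMod.natCast_eq_zero_iff] at h0
        have := Nat.ne_of_beq_eq_false hb
        omega
      · rw [hb, cond_true] at e
        exact ⟨List.mem_cons_of_mem _ (ih e).1, (ih e).2⟩

theorem dotMod_zipWith (y₀ x₀ : ℕ) (x y : List ℕ) (z : List (ZMod 17))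
    (hxy : x.length = y.length) :
    dotMod (List.zipWith (fun u v => (y₀ * u + 16 * x₀ * v) % 17) x y) z =
      y₀ * dotMod x z - x₀ * dotMod y z := by
  induction x generalizing y z with
  | nil =>
    cases y with
    | nil => simp [dotMod]
    | cons b y => simp at hxy
  | cons a x ih =>
    cases y with
    | nil => simp at hxy
    | cons b y =>
      cases z with
      | nil => simp [dotMod]
      | cons c z =>
        have h16 : (16 : ZMod 17) = -1 := by decide
        simp only [List.zipWith_cons_cons, dotMod, ih y z (by simpa using hxy)]
        rw [ZMod.natCast_mod]
        push_cast
        rw [h16]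
        ring

theorem length_combineRow (k y₀ : ℕ) (y r : List ℕ) (hy : y.length = k) (hr : r.length = k + 1) :
    (combineRow y₀ y r).length = k := by
  cases r with
  | nil => simp at hr
  | cons x₀ x =>
    rw [combineRow]
    cases Nat.beq x₀ 0 <;> simp_all

/-- Soundness of the elimination. The combined rows annihilate the tail of `z`, which vanishes by
induction; the pivot row then reads `y₀ c = 0` with `y₀ ≠ 0`. -/
theorem eq_zero_of_fullColumnRank (k : ℕ) (rows : List (List ℕ))
    (e : fullColumnRank k rows = true) (hl : ∀ r ∈ rows, r.length = k) (z : List (ZMod 17))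
    (hz : z.length = k) (hd : ∀ r ∈ rows, dotMod r z = 0) : ∀ c ∈ z, c = 0 := by
  have : Fact (Nat.Prime 17) := ⟨by norm_num⟩
  induction k generalizing rows z with
  | zero => simp [List.length_eq_zero_iff.1 hz]
  | succ k ih =>
    cases z with
    | nil => simp
    | cons c z =>
      rw [fullColumnRank] at e
      cases hp : findPivot rows with
      | nil => simp [hp] at e
      | cons y₀ y =>
        simp only [hp] at e
        obtain ⟨hm, hne⟩ := findPivot_spec _ _ _ hp
        have hyk : y.length = k := by simpa using hl _ hm
        have hy := hd _ hm
        rw [dotMod] at hy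
        have tail : ∀ c ∈ z, c = 0 := by
          refine ih _ e ?_ z (by simpa using hz) ?_
          · simp only [List.mem_map]
            rintro _ ⟨r, hr, rfl⟩
            exact length_combineRow k y₀ y r hyk (hl r hr)
          · simp only [List.mem_map]
            rintro _ ⟨r, hr, rfl⟩
            have hlr := hl r hr
            have hdr := hd r hr
            cases r with
            | nil => simp at hlr
            | cons x₀ x =>
              rw [dotMod] at hdr
              rw [combineRow]
              cases hb : Nat.beq x₀ 0
              · rw [cond_false, dotMod_zipWith _ _ _ _ _ ((by simpa using hlr : x.length = k).trans hyk.symm)]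
                linear_combination (y₀ : ZMod 17) * hdr - (x₀ : ZMod 17) * hy
              · have hx : x₀ = 0 := Nat.eq_of_beq_eq_true hb
                rw [cond_true]
                simpa [hx] using hdr
        have h0 : dotMod y z = 0 := by
          clear hz hd hy ih e hm hne hyk hp
          induction z generalizing y with
          | nil => cases y <;> rfl
          | cons c z ih =>
            cases y with
            | nil => rfl
            | cons b y =>
              rw [dotMod, ih _ (fun c hc => tail c (List.mem_cons_of_mem _ hc)),
                tail c List.mem_cons_self, mul_zero, add_zero]
        rw [h0, add_zero] at hy
        intro d hd'
        rcases List.mem_cons.1 hd' with rfl | hd'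
        · exact (mul_eq_zero.1 hy).resolve_left hne
        · exact tail d hd'

/-! ### A configuration of thirteen or fourteen nodes -/

/-- The residue of `360360 / (j - k)` modulo `17`. -/
def invP (j k : ℕ) : ℕ := 11 * (j + 16 * k) ^ 15 % 17

/-- The residue of `360360 / (3 ^ (j + 1) - 3 ^ (k + 1))` modulo `17`. -/
def invQ (j k : ℕ) : ℕ := 11 * (3 ^ (j + 1) + 16 * 3 ^ (k + 1)) ^ 15 % 17

/-- The signs `1` (seven times) and `-1`, modulo `17`. -/
def sgnMod (j : ℕ) : ℕ := cond (Nat.blt j 7) 1 16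

/-- The node with which a node is compared. -/
def baseNode (j : ℕ) : ℕ := cond (Nat.blt j 7) 0 7

/-- The coordinate at the node `r` of a double pole with coefficient `z` at `j` and at `k`. -/
def dbl (z : ℕ) (r j k : ℕ) : ℕ := cond (Nat.beq r j) z 0 + cond (Nat.beq r k) z 0

/-- The coordinate at the node `r` of a simple pole with residue `z` at `j` and `-z` at `k`. -/
def smp (z : ℕ) (r j k : ℕ) : ℕ := cond (Nat.beq r j) z 0 + cond (Nat.beq r k) (16 * z) 0

/-- The torsion coordinate of `eⱼ ∧ eₖ` at the node `r`, modulo `17`. -/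
def tors (r j k : ℕ) : ℕ :=
  sgnMod r * (sgnMod k * (invP r j * invQ r k) + 16 * (sgnMod j * (invP r k * invQ r j)))

/-- The value modulo `17` of a bilinear form on the differences of `eⱼ`, `eₖ` with the vectors of
their base nodes. -/
def diffMod (f : ℕ → ℕ → ℕ) (j k : ℕ) : ℕ :=
  (f j k + 16 * f (baseNode j) k + 16 * f j (baseNode k) + f (baseNode j) (baseNode k)) % 17

/-- The coordinates modulo `17` of the value of the Gaussian map at a pair of nodes. The simple
poles at the first five nodes are left out: they are determined by the others. -/
def gaussRow (n : ℕ) (jk : ℕ × ℕ) : List ℕ :=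
  (List.range n).map (fun r => diffMod (fun j k => dbl (invP j k) r j k) jk.1 jk.2) ++
  ((List.range' 5 (n - 5)).map
    (fun r => diffMod (fun j k => smp (invP j k ^ 2) r j k) jk.1 jk.2) ++
  ((List.range n).map
    (fun r => diffMod (fun j k => dbl (sgnMod j * sgnMod k * invQ j k) r j k) jk.1 jk.2) ++
  ((List.range' 5 (n - 5)).map
    (fun r => diffMod (fun j k => smp (sgnMod j * sgnMod k * invQ j k ^ 2) r j k) jk.1 jk.2) ++
  (List.range n).map (fun r => diffMod (fun j k => tors r j k) jk.1 jk.2))))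

/-- The pairs of nodes. -/
def nodePairs (n : ℕ) : List (ℕ × ℕ) :=
  (List.range n).flatMap fun j => (List.range j).map fun k => (j, k)

/-- The number `55` is both `5 · 13 - 10` and the dimension of `Λ²` of an `11`-dimensional space:
there is no slack in this case. -/
theorem fullColumnRank_thirteen :
    fullColumnRank 55 ((nodePairs 13).map (gaussRow 13)) = true := by
  decide +kernel

/-- A base case of its own: the step from `n` to `n + 1` nodes needs a relation among the old
values, and maximal rank at thirteen nodes excludes one. -/
theorem fullColumnRank_fourteen :
    fullColumnRank 60 ((nodePairs 14).map (gaussRow 14)) = true := by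
  decide +kernel

/-! ### From full rank modulo a prime to full rank over `ℂ`. -/

/-- A left inverse modulo `ℓ` lifts to an integral matrix `B` with `det (B A) ≡ 1` modulo `ℓ`. This
determinant is a non-zero integer, so `B A` is invertible over `ℂ`. -/
theorem card_le_rank_of_injective_mod {α β : Type*} [Fintype α] [Fintype β] [DecidableEq α]
    [DecidableEq β] (A : Matrix α β ℤ) (ℓ : ℕ) [Fact ℓ.Prime]
    (hA : ∀ z : β → ZMod ℓ, (∀ a, ∑ b, (A a b : ZMod ℓ) * z b = 0) → z = 0) :
    Fintype.card β ≤ (A.map (Int.cast : ℤ → ℂ)).rank := by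
  have hker : LinearMap.ker (Matrix.toLin' (A.map (Int.cast : ℤ → ZMod ℓ))) = ⊥ := by
    rw [LinearMap.ker_eq_bot']
    intro z hz
    exact hA z fun a => congrFun hz a
  obtain ⟨f, hf⟩ := LinearMap.exists_leftInverse_of_injective _ hker
  let B : Matrix β α ℤ := fun b a => ((LinearMap.toMatrix' f b a).val : ℤ)
  have hB : B.map (Int.cast : ℤ → ZMod ℓ) = LinearMap.toMatrix' f := by
    ext b a
    rw [Matrix.map_apply, Int.cast_natCast, ZMod.natCast_zmod_val]
  have hmul : (B * A).map (Int.castRingHom (ZMod ℓ)) = 1 := by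
    rw [Matrix.map_mul]
    change B.map (Int.cast : ℤ → ZMod ℓ) * A.map (Int.cast : ℤ → ZMod ℓ) = 1
    rw [hB]
    have := congrArg LinearMap.toMatrix' hf
    rwa [LinearMap.toMatrix'_comp, LinearMap.toMatrix'_toLin', LinearMap.toMatrix'_id] at this
  have hdet : (B * A).det ≠ 0 := by
    intro h0
    have := RingHom.map_det (Int.castRingHom (ZMod ℓ)) (B * A)
    rw [RingHom.mapMatrix_apply, hmul, h0] at this
    simp at this
  have hdet' : IsUnit ((B * A).map (Int.castRingHom ℂ)) := by
    rw [Matrix.isUnit_iff_isUnit_det, isUnit_iff_ne_zero, ← RingHom.mapMatrix_apply,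
      ← RingHom.map_det]
    simpa using hdet
  rw [← Matrix.rank_of_isUnit _ hdet', Matrix.map_mul]
  exact Matrix.rank_mul_le_right _ _

theorem map_pairGauss {R S ι : Type*} [CommRing R] [CommRing S] [DecidableEq ι] (φ : R →+* S)
    (x y : ι → ι → R) (h : ι → R) (j k : ι) (κ : Fin 5 × ι) :
    φ (pairGauss x y h j k κ) =
      pairGauss (fun j k => φ (x j k)) (fun j k => φ (y j k)) (fun j => φ (h j)) j k κ := by
  obtain ⟨t, r⟩ := κ
  fin_cases t <;> simp [pairGauss, apply_ite φ]

/-- The degree of the coordinates of `pairGauss` in the arrays. -/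
def coordWeight : Fin 5 → ℕ := ![1, 2, 1, 2, 2]

/-- Each coordinate is homogeneous in the inverse differences, so multiplying these by `360360`
clears denominators and only rescales coordinates. -/
theorem pairGauss_smul {R ι : Type*} [CommRing R] [DecidableEq ι] (d : R)
    (x y : ι → ι → R) (h : ι → R) (j k : ι) (κ : Fin 5 × ι) :
    pairGauss (fun j k => d * x j k) (fun j k => d * y j k) h j k κ =
      d ^ coordWeight κ.1 * pairGauss x y h j k κ := by
  obtain ⟨t, r⟩ := κ
  fin_cases t <;> simp only [pairGauss, coordWeight] <;>
    (try split_ifs) <;> simp <;> ring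

theorem pairGauss_comp {R ι ι' : Type*} [CommRing R] [DecidableEq ι] [DecidableEq ι'] (e : ι → ι')
    (he : Function.Injective e) (x y : ι' → ι' → R) (h : ι' → R) (j k : ι) (t : Fin 5) (r : ι) :
    pairGauss (fun j k => x (e j) (e k)) (fun j k => y (e j) (e k)) (fun j => h (e j)) j k (t, r) =
      pairGauss x y h (e j) (e k) (t, e r) := by
  fin_cases t <;> simp [pairGauss, he.eq_iff]

theorem pairGauss_congr {R ι : Type*} [CommRing R] [DecidableEq ι] {x y x' y' : ι → ι → R}
    {h h' : ι → R} {j k r : ι} (t : Fin 5) (hx : x j k = x' j k) (hy : y j k = y' j k)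
    (hxj : x r j = x' r j) (hxk : x r k = x' r k) (hyj : y r j = y' r j) (hyk : y r k = y' r k)
    (hj : h j = h' j) (hk : h k = h' k) (hr : h r = h' r) :
    pairGauss x y h j k (t, r) = pairGauss x' y' h' j k (t, r) := by
  fin_cases t <;> simp [pairGauss, *]

/-- The difference array of `pairGauss` with respect to the base nodes. -/
def diffPair {R : Type*} [CommRing R] (f : ℕ → ℕ → R) (j k : ℕ) : R :=
  f j k - f (baseNode j) k - f j (baseNode k) + f (baseNode j) (baseNode k)

theorem natCast_diffMod (f : ℕ → ℕ → ℕ) (j k : ℕ) :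
    (diffMod f j k : ZMod 17) = diffPair (fun j k => (f j k : ZMod 17)) j k := by
  have h16 : (16 : ZMod 17) = -1 := by decide
  rw [diffMod, diffPair, ZMod.natCast_mod]
  push_cast
  rw [h16]
  ring

/-- The coordinates that are used for the nodes `0, …, n - 1`. -/
def coords (n : ℕ) : List (Fin 5 × ℕ) :=
  (List.range n).map (fun r => (0, r)) ++ ((List.range' 5 (n - 5)).map (fun r => (1, r)) ++
  ((List.range n).map (fun r => (2, r)) ++ ((List.range' 5 (n - 5)).map (fun r => (3, r)) ++
  (List.range n).map (fun r => (4, r)))))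

/-- Indexes the computed list by `coords n`, so that pairings of lists become sums over coordinates
of `pairGauss` over `ZMod 17`. -/
theorem gaussRow_eq (n : ℕ) (jk : ℕ × ℕ) : ∃ f : Fin 5 × ℕ → ℕ,
    gaussRow n jk = (coords n).map f ∧ ∀ κ, (f κ : ZMod 17) =
      diffPair (fun j k => pairGauss (fun j k => (invP j k : ZMod 17))
        (fun j k => (invQ j k : ZMod 17)) (fun j => (sgnMod j : ZMod 17)) j k κ) jk.1 jk.2 := by
  have h16 : (16 : ZMod 17) = -1 := by decide
  have hc : ∀ (a b c : ℕ), cond (Nat.beq a b) c 0 = if a = b then c else 0 := by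
    intro a b c
    cases e : Nat.beq a b
    · simp [Nat.ne_of_beq_eq_false e]
    · simp [Nat.eq_of_beq_eq_true e]
  refine ⟨fun κ => match κ.1 with
    | 0 => diffMod (fun j k => dbl (invP j k) κ.2 j k) jk.1 jk.2
    | 1 => diffMod (fun j k => smp (invP j k ^ 2) κ.2 j k) jk.1 jk.2
    | 2 => diffMod (fun j k => dbl (sgnMod j * sgnMod k * invQ j k) κ.2 j k) jk.1 jk.2
    | 3 => diffMod (fun j k => smp (sgnMod j * sgnMod k * invQ j k ^ 2) κ.2 j k) jk.1 jk.2
    | 4 => diffMod (fun j k => tors κ.2 j k) jk.1 jk.2, ?_, ?_⟩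
  · simp only [gaussRow, coords, List.map_append, List.map_map]
    rfl
  · rintro ⟨t, r⟩
    fin_cases t <;> simp only [natCast_diffMod] <;> congr 1 <;> funext j k <;>
      simp only [pairGauss, dbl, smp, tors, hc, Nat.cast_add, Nat.cast_mul, Nat.cast_ite,
        Nat.cast_pow, Nat.cast_zero, Nat.cast_ofNat, h16] <;> (try split_ifs) <;> ring

theorem dotMod_map {γ : Type*} (l : List γ) (f : γ → ℕ) (z : γ → ZMod 17) :
    dotMod (l.map f) (l.map z) = (l.map fun c => (f c : ZMod 17) * z c).sum := by
  induction l with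
  | nil => rfl
  | cons a l ih => simp [dotMod, ih]

theorem sum_single_sub_single {K ι W : Type*} [Field K] [Fintype ι] [DecidableEq ι]
    [AddCommGroup W] [Module K W] (f : ι → ι → W) (j j' k k' : ι) :
    ∑ l, ∑ m, (((Pi.single j 1 - Pi.single j' 1 : ι → K) l) *
      ((Pi.single k 1 - Pi.single k' 1 : ι → K) m)) • f l m =
        f j k - f j' k - f j k' + f j' k' := by
  simp only [Pi.sub_apply, mul_smul, sub_smul, smul_sub, Finset.sum_sub_distrib]
  simp [Pi.single_apply, Finset.sum_ite_eq', ite_smul, smul_ite]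
  abel

theorem single_sub_single_mem_signKer {K ι : Type*} [Field K] [Fintype ι] [DecidableEq ι]
    {h : ι → K} {j j' : ι} (e : h j = h j') : Pi.single j 1 - Pi.single j' 1 ∈ signKer h := by
  constructor
  · simp [Finset.sum_sub_distrib]
  · simp [mul_sub, Finset.sum_sub_distrib, Pi.single_apply, e]

/-- The integers `360360 / (j - k)`. -/
def xInt (j k : ℕ) : ℤ := 360360 / ((j : ℤ) - k)

/-- The second coordinates of the nodes. -/
def qNat (j : ℕ) : ℕ := 3 ^ (j + 1) % 17

/-- The integers `360360 / (qⱼ - qₖ)`. -/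
def yInt (j k : ℕ) : ℤ := 360360 / ((qNat j : ℤ) - qNat k)

/-- The signs `1` (seven times) and `-1`. -/
def sUnit (j : ℕ) : ℤˣ := if j < 7 then 1 else -1

/-- All differences occurring in `xInt` and `yInt` are at most `15` in absolute value and `360360 =
lcm(1, …, 15)`, so the integer divisions are exact; on the diagonal, division by zero returns `0`.
-/
theorem xInt_mul : ∀ j < 14, ∀ k < 14,
    xInt j k * ((j : ℤ) - k) = if j = k then 0 else 360360 := by decide +kernel

theorem yInt_mul : ∀ j < 14, ∀ k < 14,
    yInt j k * ((qNat j : ℤ) - qNat k) = if j = k then 0 else 360360 := by decide +kernel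

/-- Here `11` is the residue of `360360`, and by Fermat the fifteenth power inverts units modulo
`17` and fixes `0`, in accordance with the diagonal of `xInt`. -/
theorem invP_cast : ∀ j < 14, ∀ k < 14, (invP j k : ZMod 17) = (xInt j k : ZMod 17) := by
  decide +kernel

theorem invQ_cast : ∀ j < 14, ∀ k < 14, (invQ j k : ZMod 17) = (yInt j k : ZMod 17) := by
  decide +kernel

theorem sgnMod_cast : ∀ j < 14, (sgnMod j : ZMod 17) = (((sUnit j : ℤˣ) : ℤ) : ZMod 17) := by
  decide +kernel

theorem qNat_injOn : ∀ j < 14, ∀ k < 14, qNat j = qNat k → j = k := by decide +kernel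

theorem qNat_pos : ∀ j < 14, qNat j ≠ 0 := by decide +kernel

theorem baseNode_lt (j : ℕ) : baseNode j < 8 := by
  rw [baseNode]
  cases Nat.blt j 7 <;> simp

theorem sUnit_baseNode : ∀ j < 14, sUnit (baseNode j) = sUnit j := by decide +kernel

theorem xInt_eq {j k : ℕ} (hj : j < 14) (hk : k < 14) :
    ((xInt j k : ℤ) : ℂ) = 360360 * ((j + 1 : ℂ) - (k + 1))⁻¹ := by
  have e := congrArg (Int.cast : ℤ → ℂ) (xInt_mul j hj k hk)
  push_cast at e
  by_cases hjk : j = k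
  · subst hjk
    simp [xInt]
  · rw [if_neg hjk] at e
    have : (j : ℂ) - k ≠ 0 := sub_ne_zero.2 (by exact_mod_cast hjk)
    rw [add_sub_add_right_eq_sub, eq_mul_inv_iff_mul_eq₀ this, e]

theorem yInt_eq {j k : ℕ} (hj : j < 14) (hk : k < 14) :
    ((yInt j k : ℤ) : ℂ) = 360360 * ((qNat j : ℂ) - qNat k)⁻¹ := by
  have e := congrArg (Int.cast : ℤ → ℂ) (yInt_mul j hj k hk)
  push_cast at e
  by_cases hjk : j = k
  · subst hjk
    simp [yInt]
  · rw [if_neg hjk] at e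
    have : (qNat j : ℂ) - qNat k ≠ 0 :=
      sub_ne_zero.2 (by exact_mod_cast fun h => hjk (qNat_injOn j hj k hk h))
    rw [eq_mul_inv_iff_mul_eq₀ this, e]

theorem nodePairs_lt {n : ℕ} {jk : ℕ × ℕ} (h : jk ∈ nodePairs n) : jk.1 < n ∧ jk.2 < n := by
  simp only [nodePairs, List.mem_flatMap, List.mem_range, List.mem_map] at h
  obtain ⟨j, hj, k, hk, rfl⟩ := h
  exact ⟨hj, hk.trans hj⟩

/-- The integral matrix of the Gaussian map of the configuration. -/
def intMatrix (n : ℕ) : Matrix {jk // jk ∈ (nodePairs n).toFinset} {κ // κ ∈ (coords n).toFinset} ℤ :=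
  fun jk κ => diffPair (fun j k => pairGauss xInt yInt (fun j => (sUnit j : ℤ)) j k κ) jk.1.1 jk.1.2

theorem intMatrix_injective_mod (n : ℕ) (hn : n ≤ 14) (hd : (coords n).Nodup)
    (hlt : ∀ κ ∈ coords n, κ.2 < n)
    (hr : fullColumnRank (coords n).length ((nodePairs n).map (gaussRow n)) = true)
    (z : {κ // κ ∈ (coords n).toFinset} → ZMod 17)
    (hz : ∀ jk, ∑ κ, (intMatrix n jk κ : ZMod 17) * z κ = 0) : z = 0 := by
  classical
  let z' : Fin 5 × ℕ → ZMod 17 := fun κ => if h : κ ∈ (coords n).toFinset then z ⟨κ, h⟩ else 0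
  have key : ∀ c ∈ (coords n).map z', c = 0 := by
    refine eq_zero_of_fullColumnRank _ _ hr ?_ _ (by simp) ?_
    · simp only [List.mem_map]
      rintro _ ⟨jk, -, rfl⟩
      obtain ⟨f, hf, -⟩ := gaussRow_eq n jk
      simp [hf]
    · simp only [List.mem_map]
      rintro _ ⟨jk, hjk, rfl⟩
      obtain ⟨f, hf, hf'⟩ := gaussRow_eq n jk
      rw [hf, dotMod_map, ← List.sum_toFinset _ hd, ← Finset.sum_coe_sort]
      rw [← hz ⟨jk, by simpa using hjk⟩]
      refine Finset.sum_congr rfl fun κ _ => ?_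
      have hκ : κ.1.2 < 14 := (hlt _ (List.mem_toFinset.1 κ.2)).trans_le hn
      have h1 : jk.1 < 14 := (nodePairs_lt hjk).1.trans_le hn
      have h2 : jk.2 < 14 := (nodePairs_lt hjk).2.trans_le hn
      have h3 : baseNode jk.1 < 14 := (baseNode_lt _).trans (by norm_num)
      have h4 : baseNode jk.2 < 14 := (baseNode_lt _).trans (by norm_num)
      have hp : ∀ j < 14, ∀ k < 14,
          pairGauss (fun j k => (invP j k : ZMod 17)) (fun j k => (invQ j k : ZMod 17))
            (fun j => (sgnMod j : ZMod 17)) j k κ.1 = ((pairGauss xInt yInt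
              (fun j => (sUnit j : ℤ)) j k κ : ℤ) : ZMod 17) := by
        intro j hj k hk
        refine Eq.trans ?_ (map_pairGauss (Int.castRingHom (ZMod 17)) xInt yInt
          (fun j => (sUnit j : ℤ)) j k κ.1).symm
        exact pairGauss_congr κ.1.1 (invP_cast j hj k hk) (invQ_cast j hj k hk)
          (invP_cast _ hκ j hj) (invP_cast _ hκ k hk) (invQ_cast _ hκ j hj) (invQ_cast _ hκ k hk)
          (sgnMod_cast j hj) (sgnMod_cast k hk) (sgnMod_cast _ hκ)
      rw [hf']
      have e1 : z' κ.1 = z κ := dif_pos κ.2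
      rw [e1]
      congr 1
      simp only [intMatrix, diffPair]
      rw [hp _ h1 _ h2, hp _ h3 _ h2, hp _ h1 _ h4, hp _ h3 _ h4]
      push_cast
      ring
  funext κ
  have := key (z' κ.1) (List.mem_map.2 ⟨κ.1, List.mem_toFinset.1 κ.2, rfl⟩)
  rwa [show z' κ.1 = z κ from dif_pos κ.2] at this

theorem finrank_gaussSpan_of_fullColumnRank (n : ℕ) (hn8 : 8 ≤ n) (hn : n ≤ 14)
    (hd : (coords n).Nodup) (hlt : ∀ κ ∈ coords n, κ.2 < n)
    (hr : fullColumnRank (coords n).length ((nodePairs n).map (gaussRow n)) = true) :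
    (coords n).length ≤ Module.finrank ℂ (gaussSpan (fun j : Fin n => ((j : ℕ) : ℂ) + 1)
      (fun j : Fin n => (qNat j : ℂ)) (fun j : Fin n => sUnit j)) := by
  have : Fact (Nat.Prime 17) := ⟨by norm_num⟩
  have h1 := card_le_rank_of_injective_mod (intMatrix n) 17
    (intMatrix_injective_mod n hn hd hlt hr)
  rw [Fintype.card_coe, List.toFinset_card_of_nodup hd, Matrix.rank_eq_finrank_span_row] at h1
  refine h1.trans ?_
  -- Projection to the chosen coordinates, rescaled so that the values on differences with base
  -- nodes become rows of `intMatrix`.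
  let pr : (Fin 5 × Fin n → ℂ) →ₗ[ℂ] ({κ // κ ∈ (coords n).toFinset} → ℂ) :=
    LinearMap.pi fun κ => (360360 : ℂ) ^ coordWeight κ.1.1 •
      LinearMap.proj (κ.1.1, (⟨κ.1.2, hlt _ (List.mem_toFinset.1 κ.2)⟩ : Fin n))
  refine le_trans (Submodule.finrank_mono ?_) (Submodule.finrank_map_le pr _)
  rw [Submodule.span_le]
  rintro _ ⟨⟨⟨j, k⟩, hjk⟩, rfl⟩
  obtain ⟨hj, hk⟩ := nodePairs_lt (by simpa using hjk : (j, k) ∈ nodePairs n)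
  have hj' : baseNode j < n := (baseNode_lt _).trans_le hn8
  have hk' : baseNode k < n := (baseNode_lt _).trans_le hn8
  have hs : ∀ i (hi : i < n) (hi' : baseNode i < n),
      signVal (fun j : Fin n => sUnit j) ⟨i, hi⟩ =
        signVal (fun j : Fin n => sUnit j) ⟨baseNode i, hi'⟩ := by
    intro i hi hi'
    simp [signVal, sUnit_baseNode i (hi.trans_le hn)]
  refine ⟨_, mem_bilinSpan _ (single_sub_single_mem_signKer (hs j hj hj'))
    (single_sub_single_mem_signKer (hs k hk hk')), ?_⟩
  rw [sum_single_sub_single]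
  funext κ
  have hκ : κ.1.2 < n := hlt _ (List.mem_toFinset.1 κ.2)
  have hp : ∀ (j k : Fin n), ((pairGauss xInt yInt (fun j => (sUnit j : ℤ)) j k κ.1 : ℤ) : ℂ) =
      (360360 : ℂ) ^ coordWeight κ.1.1 * pairGauss (diffInv fun j : Fin n => ((j : ℕ) : ℂ) + 1)
        (diffInv fun j : Fin n => (qNat j : ℂ)) (signVal fun j : Fin n => sUnit j) j k
          (κ.1.1, ⟨κ.1.2, hκ⟩) := by
    intro j k
    have e1 := map_pairGauss (Int.castRingHom ℂ) xInt yInt (fun j => (sUnit j : ℤ)) j k κ.1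
    have e2 := pairGauss_comp (Fin.val : Fin n → ℕ) Fin.val_injective
      (fun j k => (xInt j k : ℂ)) (fun j k => (yInt j k : ℂ)) (fun j => ((sUnit j : ℤ) : ℂ)) j k
      κ.1.1 ⟨κ.1.2, hκ⟩
    refine e1.trans (e2.symm.trans ?_)
    have e3 := pairGauss_smul (360360 : ℂ) (diffInv fun j : Fin n => ((j : ℕ) : ℂ) + 1)
      (diffInv fun j : Fin n => (qNat j : ℂ)) (signVal fun j : Fin n => sUnit j) j k
        (κ.1.1, ⟨κ.1.2, hκ⟩)
    rw [← e3]
    have hx : ∀ i l : Fin n, ((xInt i l : ℤ) : ℂ) =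
        360360 * diffInv (fun j : Fin n => ((j : ℕ) : ℂ) + 1) i l := fun i l =>
      xInt_eq (i.2.trans_le hn) (l.2.trans_le hn)
    have hy : ∀ i l : Fin n, ((yInt i l : ℤ) : ℂ) =
        360360 * diffInv (fun j : Fin n => (qNat j : ℂ)) i l := fun i l =>
      yInt_eq (i.2.trans_le hn) (l.2.trans_le hn)
    exact pairGauss_congr _ (hx _ _) (hy _ _) (hx _ _) (hx _ _) (hy _ _) (hy _ _) rfl rfl rfl
  have e := fun j k => (hp j k).symm
  simp only [pr, LinearMap.pi_apply, LinearMap.smul_apply, LinearMap.proj_apply, Pi.add_apply,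
    Pi.sub_apply, smul_eq_mul, mul_add, mul_sub, e, Matrix.row, Matrix.map_apply, intMatrix,
    diffPair, Int.cast_add, Int.cast_sub]

theorem admissible_of_fullColumnRank (n : ℕ) (hn8 : 8 ≤ n) (hn : n ≤ 14)
    (hd : (coords n).Nodup) (hlt : ∀ κ ∈ coords n, κ.2 < n) (hl : 5 * n ≤ (coords n).length + 10)
    (hr : fullColumnRank (coords n).length ((nodePairs n).map (gaussRow n)) = true) :
    Admissible (fun j : Fin n => sUnit j) := by
  refine ⟨fun j : Fin n => ((j : ℕ) : ℂ) + 1, fun j : Fin n => (qNat j : ℂ), ?_, ?_, ?_, ?_, ?_, ?_⟩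
  · intro i j e
    simpa [Fin.ext_iff] using e
  · intro i j e
    exact Fin.ext (qNat_injOn i (i.2.trans_le hn) j (j.2.trans_le hn) (Nat.cast_injective e))
  · intro i
    exact Nat.cast_add_one_ne_zero _
  · intro i
    exact Nat.cast_ne_zero.2 (qNat_pos i (i.2.trans_le hn))
  · rw [Fintype.card_fin]
    have := finrank_gaussSpan_of_fullColumnRank n hn8 hn hd hlt hr
    omega
  · have h5 : ∀ i : Fin 4, (i : ℕ) + 1 < n := fun i => by omega
    -- The nodes `0, …, 4` all carry the sign `1`, so these differences satisfy both linear
    -- conditions. With `p = 1, …, 5` and `q = 3, 9, 10, 13, 5` at these nodes, the matrix is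
    -- explicit.
    refine ⟨fun i => Pi.single ⟨i + 1, h5 i⟩ 1 - Pi.single ⟨0, by omega⟩ 1, fun i => ?_, ?_⟩
    · apply single_sub_single_mem_signKer
      fin_cases i <;> simp [signVal, sUnit]
    · have e : ∀ (i : Fin 4) (f : Fin n → ℂ), ∑ k, (Pi.single (⟨i + 1, h5 i⟩ : Fin n) (1 : ℂ) -
          Pi.single ⟨0, by omega⟩ 1 : Fin n → ℂ) k * f k = f ⟨i + 1, h5 i⟩ - f ⟨0, by omega⟩ := by
        intro i f
        simp [sub_mul, Finset.sum_sub_distrib, Pi.single_apply]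
      have hM : nodeMatrix (fun j : Fin n => ((j : ℕ) : ℂ) + 1) (fun j : Fin n => (qNat j : ℂ))
          (fun j : Fin n => sUnit j)
          (fun i => Pi.single ⟨i + 1, h5 i⟩ 1 - Pi.single ⟨0, by omega⟩ 1) 0 0 =
          !![1 / 2, -3 / 4, 2 / 9, -8 / 81; 2 / 3, -8 / 9, 7 / 30, -91 / 900;
            3 / 4, -15 / 16, 10 / 39, -160 / 1521; 4 / 5, -24 / 25, 2 / 15, -16 / 225] := by
        ext i t
        have key : nodeMatrix (fun j : Fin n => ((j : ℕ) : ℂ) + 1) (fun j : Fin n => (qNat j : ℂ))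
            (fun j : Fin n => sUnit j)
            (fun i => Pi.single ⟨i + 1, h5 i⟩ 1 - Pi.single ⟨0, by omega⟩ 1) 0 0 i =
            ![1 - 1 / (i + 2 : ℂ), 1 / (i + 2 : ℂ) ^ 2 - 1, 1 / 3 - 1 / (qNat (i + 1) : ℂ),
              1 / (qNat (i + 1) : ℂ) ^ 2 - 1 / 9] := by
          have hs : sUnit (i + 1) = 1 := by fin_cases i <;> rfl
          have hs0 : sUnit 0 = 1 := rfl
          have hq0 : qNat 0 = 3 := rfl
          have c : ∀ u v w : ℂ, u * v * w = v * (u * w) := fun u v w => by ring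
          simp only [nodeMatrix, c, e, signVal, hs, hs0, hq0]
          have h2 : (0 - (((((i : ℕ) + 1 : ℕ) : ℕ) : ℂ) + 1)) = -(i + 2 : ℂ) := by
            push_cast
            ring
          simp only [h2, inv_neg, zero_sub]
          norm_num
          refine ⟨?_, ?_⟩ <;> ring
        rw [key]
        fin_cases i <;> fin_cases t <;> norm_num [qNat]
      rw [hM]
      simp [Matrix.det_succ_row_zero, Fin.sum_univ_succ, Fin.succAbove]
      norm_num

theorem admissible_thirteen : Admissible (fun j : Fin 13 => sUnit j) :=
  admissible_of_fullColumnRank 13 (by norm_num) (by norm_num) (by decide +kernel)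
    (by decide +kernel) (by decide +kernel) fullColumnRank_thirteen

theorem admissible_fourteen : Admissible (fun j : Fin 14 => sUnit j) :=
  admissible_of_fullColumnRank 14 (by norm_num) (by norm_num) (by decide +kernel)
    (by decide +kernel) (by decide +kernel) fullColumnRank_fourteen

/-! ### Rational functions of several variables without poles on a set -/

/-- The function `f` is on `U` a quotient of polynomials whose denominator does not vanish on `U`. -/
def RationalOn {σ : Type*} (U : Set (σ → ℂ)) (f : (σ → ℂ) → ℂ) : Prop :=
  ∃ N D : MvPolynomial σ ℂ, ∀ u ∈ U, MvPolynomial.eval u D ≠ 0 ∧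
    f u * MvPolynomial.eval u D = MvPolynomial.eval u N

namespace RationalOn

variable {σ : Type*} {U : Set (σ → ℂ)} {f g : (σ → ℂ) → ℂ}

theorem const (U : Set (σ → ℂ)) (z : ℂ) : RationalOn U (fun _ => z) :=
  ⟨MvPolynomial.C z, 1, fun u _ => by simp⟩

theorem coord (U : Set (σ → ℂ)) (i : σ) : RationalOn U (fun u => u i) :=
  ⟨MvPolynomial.X i, 1, fun u _ => by simp⟩

theorem add (hf : RationalOn U f) (hg : RationalOn U g) : RationalOn U (fun u => f u + g u) := by
  obtain ⟨N, D, h⟩ := hf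
  obtain ⟨N', D', h'⟩ := hg
  refine ⟨N * D' + N' * D, D * D', fun u hu => ?_⟩
  obtain ⟨h1, h2⟩ := h u hu
  obtain ⟨h1', h2'⟩ := h' u hu
  simp only [map_mul, map_add]
  refine ⟨mul_ne_zero h1 h1', ?_⟩
  rw [← h2, ← h2']
  ring

theorem mul (hf : RationalOn U f) (hg : RationalOn U g) : RationalOn U (fun u => f u * g u) := by
  obtain ⟨N, D, h⟩ := hf
  obtain ⟨N', D', h'⟩ := hg
  refine ⟨N * N', D * D', fun u hu => ?_⟩
  obtain ⟨h1, h2⟩ := h u hu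
  obtain ⟨h1', h2'⟩ := h' u hu
  simp only [map_mul]
  refine ⟨mul_ne_zero h1 h1', ?_⟩
  rw [← h2, ← h2']
  ring

theorem sub (hf : RationalOn U f) (hg : RationalOn U g) : RationalOn U (fun u => f u - g u) := by
  have := hf.add ((const U (-1)).mul hg)
  simpa [sub_eq_add_neg] using this

theorem pow (hf : RationalOn U f) (n : ℕ) : RationalOn U (fun u => f u ^ n) := by
  induction n with
  | zero => simpa using const U 1
  | succ n ih => simpa [pow_succ] using ih.mul hf

theorem inv (hf : RationalOn U f) (h0 : ∀ u ∈ U, f u ≠ 0) : RationalOn U (fun u => (f u)⁻¹) := by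
  obtain ⟨N, D, h⟩ := hf
  refine ⟨D, N, fun u hu => ?_⟩
  obtain ⟨h1, h2⟩ := h u hu
  rw [← h2]
  exact ⟨mul_ne_zero (h0 u hu) h1, inv_mul_cancel_left₀ (h0 u hu) _⟩

theorem sum {α : Type*} (s : Finset α) {F : α → (σ → ℂ) → ℂ} (hF : ∀ a ∈ s, RationalOn U (F a)) :
    RationalOn U (fun u => ∑ a ∈ s, F a u) := by
  classical
  induction s using Finset.induction_on with
  | empty => simpa using const U 0
  | insert a s ha ih =>
    simp only [Finset.sum_insert ha]
    exact (hF a (Finset.mem_insert_self _ _)).add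
      (ih fun b hb => hF b (Finset.mem_insert_of_mem hb))

theorem prod {α : Type*} (s : Finset α) {F : α → (σ → ℂ) → ℂ} (hF : ∀ a ∈ s, RationalOn U (F a)) :
    RationalOn U (fun u => ∏ a ∈ s, F a u) := by
  classical
  induction s using Finset.induction_on with
  | empty => simpa using const U 1
  | insert a s ha ih =>
    simp only [Finset.prod_insert ha]
    exact (hF a (Finset.mem_insert_self _ _)).mul
      (ih fun b hb => hF b (Finset.mem_insert_of_mem hb))

theorem det {α : Type*} [Fintype α] [DecidableEq α] {M : (σ → ℂ) → Matrix α α ℂ}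
    (hM : ∀ a b, RationalOn U (fun u => M u a b)) : RationalOn U (fun u => (M u).det) := by
  simp only [Matrix.det_apply']
  exact sum _ fun τ _ => (const U _).mul (prod _ fun a _ => hM _ _)

/-- The numerator of `f` does it: it is non-zero because `f` is non-zero at `u₀`, and it vanishes
wherever `f` does. -/
theorem exists_polynomial (hf : RationalOn U f) {u₀ : σ → ℂ} (hu₀ : u₀ ∈ U) (h0 : f u₀ ≠ 0) :
    ∃ N : MvPolynomial σ ℂ, N ≠ 0 ∧ ∀ u ∈ U, MvPolynomial.eval u N ≠ 0 → f u ≠ 0 := by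
  obtain ⟨N, D, h⟩ := hf
  refine ⟨N, ?_, fun u hu hN hfu => hN ?_⟩
  · rintro rfl
    obtain ⟨h1, h2⟩ := h u₀ hu₀
    exact mul_ne_zero h0 h1 (by simpa using h2)
  · rw [← (h u hu).2, hfu, zero_mul]

end RationalOn

/-- Simple poles at distinct points are linearly independent: after clearing denominators the sum
becomes a polynomial whose value at `q k` is `d k` times a non-zero product. -/
theorem exists_sum_inv_sub_ne_zero {n : ℕ} {q : Fin n → ℂ} (hq : Function.Injective q)
    {d : Fin n → ℂ} (hd : d ≠ 0) : ∃ Q, (∀ k, Q ≠ q k) ∧ ∑ k, d k * (Q - q k)⁻¹ ≠ 0 := by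
  by_contra! hcon
  apply hd
  set F : ℂ[X] := ∑ k, Polynomial.C (d k) *
    ∏ l ∈ Finset.univ.erase k, (Polynomial.X - Polynomial.C (q l)) with hF
  set G : ℂ[X] := ∏ l, (Polynomial.X - Polynomial.C (q l)) with hG
  -- The factor `G` takes care of the points `q k`, where the hypothesis says nothing, so the
  -- product can be tested at every point.
  have hFG : F * G = 0 := by
    apply Polynomial.funext
    intro Q
    rw [Polynomial.eval_mul, Polynomial.eval_zero]
    by_cases hQ : ∀ k, Q ≠ q k
    · have h1 : F.eval Q = G.eval Q * ∑ k, d k * (Q - q k)⁻¹ := by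
        rw [hF, Polynomial.eval_finsetSum, Finset.mul_sum]
        refine Finset.sum_congr rfl fun k _ => ?_
        rw [hG, ← Finset.mul_prod_erase _ _ (Finset.mem_univ k)]
        simp only [Polynomial.eval_mul, Polynomial.eval_C, Polynomial.eval_sub, Polynomial.eval_X]
        have : Q - q k ≠ 0 := sub_ne_zero.2 (hQ k)
        field_simp
      rw [h1, hcon Q hQ, mul_zero, zero_mul]
    · push Not at hQ
      obtain ⟨k, hk⟩ := hQ
      have : G.eval Q = 0 := by
        rw [hG, Polynomial.eval_prod]
        exact Finset.prod_eq_zero (Finset.mem_univ k) (by simp [hk])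
      rw [this, mul_zero]
  have hG0 : G ≠ 0 := Finset.prod_ne_zero_iff.2 fun l _ => Polynomial.X_sub_C_ne_zero _
  have hF0 : F = 0 := (mul_eq_zero.1 hFG).resolve_right hG0
  funext k
  have := congrArg (Polynomial.eval (q k)) hF0
  rw [hF, Polynomial.eval_finsetSum, Finset.sum_eq_single k] at this
  · rw [Polynomial.eval_mul, Polynomial.eval_C, Polynomial.eval_prod, Polynomial.eval_zero,
      mul_eq_zero] at this
    refine this.resolve_right (Finset.prod_ne_zero_iff.2 fun l hl => ?_)
    simp only [Polynomial.eval_sub, Polynomial.eval_X, Polynomial.eval_C]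
    exact sub_ne_zero.2 fun e => (Finset.ne_of_mem_erase hl) (hq e).symm
  · intro l _ hl
    rw [Polynomial.eval_mul, Polynomial.eval_prod, Finset.prod_eq_zero
      (Finset.mem_erase.2 ⟨hl.symm, Finset.mem_univ k⟩) (by simp), mul_zero]
  · simp

/-! ### Dimension counts -/

/-- Rank and nullity for `π` on `R`. It is used with `polarCoords`, to count the new poles, and with
`oldCoords`, to count a relation among the old values. -/
theorem finrank_add_finrank_map_le {K W W' : Type*} [Field K] [AddCommGroup W] [Module K W]
    [AddCommGroup W'] [Module K W'] [FiniteDimensional K W] (π : W →ₗ[K] W') {R₀ R : Submodule K W}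
    (h : R₀ ≤ R) (hker : R₀ ≤ LinearMap.ker π) :
    Module.finrank K R₀ + Module.finrank K (R.map π) ≤ Module.finrank K R := by
  have h1 := LinearMap.finrank_range_add_finrank_ker (π.domRestrict R)
  have h2 : LinearMap.range (π.domRestrict R) = R.map π := by
    rw [LinearMap.domRestrict, LinearMap.range_comp, Submodule.range_subtype]
  rw [h2] at h1
  have h3 : Module.finrank K R₀ ≤ Module.finrank K (LinearMap.ker (π.domRestrict R)) := by
    refine LinearMap.finrank_le_finrank_of_injective (f := LinearMap.codRestrict _
      (Submodule.inclusion h) ?_) ?_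
    · rintro ⟨w, hw⟩
      exact hker hw
    · intro a b e
      have := congrArg (fun w : LinearMap.ker (π.domRestrict R) => ((w : R) : W)) e
      exact Subtype.ext this
  omega

/-- The skew-symmetric matrix with given entries below the diagonal. -/
def skew (n : ℕ) : ((Σ j : Fin n, Fin j) → ℂ) →ₗ[ℂ] (Fin n → Fin n → ℂ) where
  toFun z j k := if hkj : k < j then z ⟨j, ⟨k, hkj⟩⟩ else if hjk : j < k then -z ⟨k, ⟨j, hjk⟩⟩ else 0
  map_add' z w := by
    funext j k
    simp only [Pi.add_apply]
    split_ifs <;> ring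
  map_smul' c z := by
    funext j k
    simp only [Pi.smul_apply, smul_eq_mul, RingHom.id_apply]
    split_ifs <;> ring

theorem skew_swap {n : ℕ} (z : (Σ j : Fin n, Fin j) → ℂ) (j k : Fin n) :
    skew n z j k = -skew n z k j := by
  simp only [skew, LinearMap.coe_mk, AddHom.coe_mk]
  rcases lt_trichotomy j k with h | h | h
  · simp [h, h.not_gt]
  · simp [h]
  · simp [h, h.not_gt]

theorem skew_injective (n : ℕ) : Function.Injective (skew n) := by
  rw [injective_iff_map_eq_zero]
  intro z hz
  funext ⟨j, k⟩
  have := congrFun (congrFun hz j) (⟨k, k.2.trans j.2⟩ : Fin n)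
  have hlt : (⟨k, k.2.trans j.2⟩ : Fin n) < j := k.2
  simpa [skew, hlt] using this

/-- The row sums, and the row sums with signs, of a matrix. -/
def rowSums {n : ℕ} (s : Fin n → ℂ) :
    (Fin n → Fin n → ℂ) →ₗ[ℂ] (Fin n → ℂ) × (Fin n → ℂ) where
  toFun c := (fun j => ∑ k, c j k, fun j => ∑ k, s k * c j k)
  map_add' c d := by
    ext j <;> simp [Finset.sum_add_distrib, mul_add]
  map_smul' z c := by
    ext j <;> simp [Finset.mul_sum, mul_left_comm]

/-- The two conditions say that `c` has sum zero over the nodes of each sign, and `F` is evaluated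
at a node that depends only on the sign. -/
theorem sum_smul_baseNode_eq_zero {n : ℕ} {W : Type*} [AddCommGroup W] [Module ℂ W]
    (h : Fin n → ℤˣ) (mp mm : Fin n) (c : Fin n → ℂ) (h1 : ∑ k, c k = 0)
    (h2 : ∑ k, signVal h k * c k = 0) (F : Fin n → W) :
    ∑ k, c k • F (if h k = 1 then mp else mm) = 0 := by
  have e : ∀ k, c k • F (if h k = 1 then mp else mm) =
      ((1 / 2 : ℂ) * (c k + signVal h k * c k)) • F mp +
        ((1 / 2 : ℂ) * (c k - signVal h k * c k)) • F mm := by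
    intro k
    rcases Int.units_eq_one_or (h k) with hk | hk
    · have : signVal h k = 1 := by simp [signVal, hk]
      rw [if_pos hk, this, show (1 / 2 : ℂ) * (c k + 1 * c k) = c k by ring,
        show (1 / 2 : ℂ) * (c k - 1 * c k) = 0 by ring, zero_smul, add_zero]
    · have : signVal h k = -1 := by simp [signVal, hk]
      rw [if_neg (by rw [hk]; decide), this, show (1 / 2 : ℂ) * (c k + -1 * c k) = 0 by ring,
        show (1 / 2 : ℂ) * (c k - -1 * c k) = c k by ring, zero_smul, zero_add]
  simp only [e, Finset.sum_add_distrib, ← Finset.sum_smul, ← Finset.mul_sum,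
    Finset.sum_sub_distrib, h1, h2]
  simp

/-- A skew matrix whose rows lie in `signKer` is an element of `Λ²` of that space. Subtracting base
nodes in both indices does not change the sum and makes every term a value on vectors of `signKer`.
-/
theorem sum_skew_mem_bilinSpan {n : ℕ} {W : Type*} [AddCommGroup W] [Module ℂ W]
    (h : Fin n → ℤˣ) {mp mm : Fin n} (hp : h mp = 1) (hm : h mm = -1)
    (c : Fin n → Fin n → ℂ) (hc : ∀ j k, c j k = -c k j) (hrow : rowSums (signVal h) c = 0)
    (f : Fin n → Fin n → W) :
    ∑ j, ∑ k, c j k • f j k ∈ bilinSpan (signKer (signVal h)) f := by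
  have r1 : ∀ j, ∑ k, c j k = 0 := fun j => congrFun (congrArg Prod.fst hrow) j
  have r2 : ∀ j, ∑ k, signVal h k * c j k = 0 := fun j => congrFun (congrArg Prod.snd hrow) j
  have c1 : ∀ k, ∑ j, c j k = 0 := fun k => by
    simp only [hc _ k, Finset.sum_neg_distrib, r1, neg_zero]
  have c2 : ∀ k, ∑ j, signVal h j * c j k = 0 := fun k => by
    simp only [hc _ k, mul_neg, Finset.sum_neg_distrib, r2, neg_zero]
  set β : Fin n → Fin n := fun k => if h k = 1 then mp else mm with hβ
  have hs : ∀ j, signVal h j = signVal h (β j) := by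
    intro j
    rcases Int.units_eq_one_or (h j) with hj | hj
    · simp [signVal, hβ, hj, hp]
    · simp [signVal, hβ, hj, hm]
  have key : ∑ j, ∑ k, c j k • f j k = ∑ j, ∑ k, c j k •
      (f j k - f (β j) k - f j (β k) + f (β j) (β k)) := by
    simp only [smul_add, smul_sub, Finset.sum_add_distrib, Finset.sum_sub_distrib]
    have e1 : ∑ j, ∑ k, c j k • f (β j) k = 0 := by
      rw [Finset.sum_comm]
      exact Finset.sum_eq_zero fun k _ =>
        sum_smul_baseNode_eq_zero h mp mm _ (c1 k) (c2 k) (fun j => f j k)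
    have e2 : ∑ j, ∑ k, c j k • f j (β k) = 0 := Finset.sum_eq_zero fun j _ =>
      sum_smul_baseNode_eq_zero h mp mm _ (r1 j) (r2 j) (fun k => f j k)
    have e3 : ∑ j, ∑ k, c j k • f (β j) (β k) = 0 := Finset.sum_eq_zero fun j _ =>
      sum_smul_baseNode_eq_zero h mp mm _ (r1 j) (r2 j) (fun k => f (β j) k)
    rw [e1, e2, e3]
    simp
  rw [key]
  refine Submodule.sum_mem _ fun j _ => Submodule.sum_mem _ fun k _ => Submodule.smul_mem _ _ ?_
  rw [← sum_single_sub_single (K := ℂ)]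
  exact mem_bilinSpan f (single_sub_single_mem_signKer (hs j)) (single_sub_single_mem_signKer (hs k))

/-- Dimension count: the matrices in question form a space of dimension at least `n(n-1)/2 - 2n`,
which exceeds `5n - 10` exactly when `n² - 15n + 20 > 0`, true from `n = 14` on. The bound `2n` for
the conditions ignores three dependencies due to skew symmetry. -/
theorem exists_skew_eq_zero {n : ℕ} (hn : 14 ≤ n) {W : Type*} [AddCommGroup W] [Module ℂ W]
    [FiniteDimensional ℂ W] (h : Fin n → ℤˣ) {mp mm : Fin n} (hp : h mp = 1) (hm : h mm = -1)
    (f : Fin n → Fin n → W)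
    (hf : Module.finrank ℂ (bilinSpan (signKer (signVal h)) f) + 10 ≤ 5 * n) :
    ∃ c : Fin n → Fin n → ℂ, c ≠ 0 ∧ (∀ j k, c j k = -c k j) ∧ rowSums (signVal h) c = 0 ∧
      ∑ j, ∑ k, c j k • f j k = 0 := by
  let Φ := rowSums (signVal h) ∘ₗ skew n
  let Ψ : (Fin n → Fin n → ℂ) →ₗ[ℂ] W :=
    { toFun := fun c => ∑ j, ∑ k, c j k • f j k
      map_add' := fun c d => by simp [add_smul, Finset.sum_add_distrib]
      map_smul' := fun z c => by simp [mul_smul, Finset.smul_sum] }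
  let Ξ : LinearMap.ker Φ →ₗ[ℂ] bilinSpan (signKer (signVal h)) f :=
    ((Ψ ∘ₗ skew n) ∘ₗ (LinearMap.ker Φ).subtype).codRestrict _ fun z =>
      sum_skew_mem_bilinSpan h hp hm (skew n z) (skew_swap _) z.2 f
  have hcard : 2 * Module.finrank ℂ ((Σ j : Fin n, Fin j) → ℂ) = n * (n - 1) := by
    rw [Module.finrank_fintype_fun_eq_card, Fintype.card_sigma]
    simp only [Fintype.card_fin]
    rw [Fin.sum_univ_eq_sum_range (fun i => i) n, mul_comm, Finset.sum_range_id_mul_two]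
  have h1 := LinearMap.finrank_range_add_finrank_ker Φ
  have h2 : Module.finrank ℂ (LinearMap.range Φ) ≤ 2 * n := by
    refine (Submodule.finrank_le _).trans ?_
    rw [Module.finrank_prod, Module.finrank_fintype_fun_eq_card, Fintype.card_fin]
    omega
  have h3 : LinearMap.ker Ξ ≠ ⊥ := by
    apply LinearMap.ker_ne_bot_of_finrank_lt
    obtain ⟨m, rfl⟩ := Nat.exists_eq_add_of_le hn
    rw [show 14 + m - 1 = 13 + m by omega] at hcard
    nlinarith
  obtain ⟨z, hz, hz0⟩ := Submodule.exists_mem_ne_zero_of_ne_bot h3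
  refine ⟨skew n z, ?_, skew_swap _, z.2, ?_⟩
  · intro e
    apply hz0
    exact Subtype.ext (skew_injective n (e.trans (map_zero _).symm))
  · exact congrArg Subtype.val hz

/-! ### Adding a node -/

section AddNode

variable {n : ℕ} (p q : Fin n → ℂ) (h : Fin n → ℤˣ) (P Q : ℂ) (ε : ℤˣ)

/-- The coordinates of `eⱼ ∧ eₖ` for the configuration with an additional node. -/
def extGauss (j k : Fin (n + 1)) : Fin 5 × Fin (n + 1) → ℂ :=
  pairGauss (diffInv (Fin.cons P p : Fin (n + 1) → ℂ)) (diffInv (Fin.cons Q q : Fin (n + 1) → ℂ))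
    (signVal (Fin.cons ε h : Fin (n + 1) → ℤˣ)) j k

theorem extGauss_succ (j k : Fin n) (t : Fin 5) (r : Fin n) :
    extGauss p q h P Q ε j.succ k.succ (t, r.succ) =
      pairGauss (diffInv p) (diffInv q) (signVal h) j k (t, r) :=
  (pairGauss_comp Fin.succ (Fin.succ_injective n) _ _ _ j k t r).symm

/-- Old sections are regular on both components at the new node, so their Wronskians have no poles
there; only the torsion coordinate can be non-zero. -/
theorem extGauss_succ_polar (j k : Fin n) (t : Fin 4) :
    extGauss p q h P Q ε j.succ k.succ (t.castSucc, 0) = 0 := by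
  have h0 : ∀ i : Fin n, ¬ (0 : Fin (n + 1)) = i.succ := fun i => (Fin.succ_ne_zero i).symm
  fin_cases t <;> simp [extGauss, pairGauss, h0]

theorem extGauss_succ_torsion (j k : Fin n) :
    extGauss p q h P Q ε j.succ k.succ (4, 0) = ((ε : ℤ) : ℂ) *
      (signVal h k * ((P - p j)⁻¹ * (Q - q k)⁻¹) - signVal h j * ((P - p k)⁻¹ * (Q - q j)⁻¹)) := by
  simp [extGauss, pairGauss, diffInv, signVal]

theorem cons_zero_mem_signKer {a : Fin n → ℂ} (ha : a ∈ signKer (signVal h)) :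
    (Fin.cons 0 a : Fin (n + 1) → ℂ) ∈ signKer (signVal (Fin.cons ε h : Fin (n + 1) → ℤˣ)) := by
  refine ⟨?_, ?_⟩
  · rw [Fin.sum_univ_succ]
    simpa using ha.1
  · rw [Fin.sum_univ_succ]
    simpa [signVal] using ha.2

theorem cons_one_mem_signKer {m : Fin n} (hm : h m = ε) :
    (Fin.cons 1 (-Pi.single m 1) : Fin (n + 1) → ℂ) ∈
      signKer (signVal (Fin.cons ε h : Fin (n + 1) → ℤˣ)) := by
  refine ⟨?_, ?_⟩
  · rw [Fin.sum_univ_succ]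
    simp
  · rw [Fin.sum_univ_succ]
    simp [signVal, Pi.single_apply, hm]

/-- The span of the values of the Gaussian map at the old sections. -/
def oldSpan : Submodule ℂ (Fin 5 × Fin (n + 1) → ℂ) :=
  bilinSpan (signKer (signVal h)) fun j k => extGauss p q h P Q ε j.succ k.succ

theorem oldSpan_le : oldSpan p q h P Q ε ≤
    gaussSpan (Fin.cons P p : Fin (n + 1) → ℂ) (Fin.cons Q q : Fin (n + 1) → ℂ)
      (Fin.cons ε h : Fin (n + 1) → ℤˣ) := by
  rw [oldSpan, bilinSpan, Submodule.span_le]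
  rintro _ ⟨a, ha, b, hb, rfl⟩
  have := mem_bilinSpan (extGauss p q h P Q ε) (cons_zero_mem_signKer h ε ha)
    (cons_zero_mem_signKer h ε hb)
  rw [Fin.sum_univ_succ] at this
  simp only [Fin.sum_univ_succ, Fin.cons_zero, Fin.cons_succ, zero_mul, mul_zero, zero_smul,
    Finset.sum_const_zero, zero_add] at this
  exact this

/-- The polar coordinates at the new node. -/
def polarCoords : (Fin 5 × Fin (n + 1) → ℂ) →ₗ[ℂ] (Fin 4 → ℂ) :=
  -- Multiplication by `ε` cancels the sign of the new node in the coordinates on the second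
  -- component.
  LinearMap.pi fun t => (![1, 1, ((ε : ℤ) : ℂ), ((ε : ℤ) : ℂ)] t) •
    LinearMap.proj (φ := fun _ : Fin 5 × Fin (n + 1) => ℂ) (t.castSucc, 0)

theorem oldSpan_le_ker : oldSpan p q h P Q ε ≤ LinearMap.ker (polarCoords (n := n) ε) := by
  rw [oldSpan, bilinSpan, Submodule.span_le]
  rintro _ ⟨a, ha, b, hb, rfl⟩
  rw [SetLike.mem_coe, LinearMap.mem_ker]
  funext t
  simp [polarCoords, extGauss_succ_polar]

/-- The wedges of `e_new - e_m` with the `b i` have the rows of `nodeMatrix` as polar coordinates at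
the new node, since the part with `e_m` has no pole there. The old span is killed by these
coordinates, so four dimensions are gained. -/
theorem finrank_gaussSpan_cons {m : Fin n} (hm : h m = ε) {b : Fin 4 → Fin n → ℂ}
    (hb : ∀ i, b i ∈ signKer (signVal h)) (hdet : (nodeMatrix p q h b P Q).det ≠ 0) :
    Module.finrank ℂ (oldSpan p q h P Q ε) + 4 ≤ Module.finrank ℂ
      (gaussSpan (Fin.cons P p : Fin (n + 1) → ℂ) (Fin.cons Q q : Fin (n + 1) → ℂ)
        (Fin.cons ε h : Fin (n + 1) → ℤˣ)) := by
  refine le_trans ?_ (finrank_add_finrank_map_le (polarCoords ε) (oldSpan_le p q h P Q ε)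
    (oldSpan_le_ker p q h P Q ε))
  refine Nat.add_le_add_left ?_ _
  have hε : ((ε : ℤ) : ℂ) * ((ε : ℤ) : ℂ) = 1 := by
    rcases Int.units_eq_one_or ε with e | e <;> simp [e]
  have hli : LinearIndependent ℂ (nodeMatrix p q h b P Q).row :=
    Matrix.linearIndependent_rows_of_det_ne_zero hdet
  have h4 := finrank_span_eq_card hli
  rw [Fintype.card_fin] at h4
  refine h4.symm.le.trans (Submodule.finrank_mono ?_)
  rw [Submodule.span_le]
  rintro _ ⟨i, rfl⟩
  refine ⟨_, mem_bilinSpan (extGauss p q h P Q ε) (cons_one_mem_signKer h ε hm)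
    (cons_zero_mem_signKer h ε (hb i)), ?_⟩
  have h0 : ∀ i : Fin n, ¬ (0 : Fin (n + 1)) = i.succ := fun i => (Fin.succ_ne_zero i).symm
  funext t
  simp only [polarCoords, LinearMap.pi_apply, LinearMap.smul_apply, LinearMap.proj_apply,
    Finset.sum_apply, Pi.smul_apply, Pi.add_apply, Fin.sum_univ_succ (n := n), Fin.cons_zero,
    Fin.cons_succ, extGauss_succ_polar, Finset.sum_const_zero, add_zero, mul_zero,
    zero_smul, one_mul, zero_add, smul_eq_mul]
  rw [Matrix.row]
  fin_cases t
  · simp [extGauss, pairGauss, nodeMatrix, h0, diffInv]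
  · simp [extGauss, pairGauss, nodeMatrix, h0, diffInv]
  · simp only [Fin.reduceFinMk, nodeMatrix, Matrix.cons_val, Finset.mul_sum]
    refine Finset.sum_congr rfl fun k _ => ?_
    simp [extGauss, pairGauss, diffInv, signVal, h0]
    linear_combination (((h k : ℤ) : ℂ) * b i k * (Q - q k)⁻¹) * hε
  · simp only [Fin.reduceFinMk, nodeMatrix, Matrix.cons_val, Finset.mul_sum]
    refine Finset.sum_congr rfl fun k _ => ?_
    simp [extGauss, pairGauss, diffInv, signVal, h0]
    linear_combination (((h k : ℤ) : ℂ) * b i k * ((Q - q k) ^ 2)⁻¹) * hε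

/-- Forgetting the coordinates at the new node. -/
def oldCoords : (Fin 5 × Fin (n + 1) → ℂ) →ₗ[ℂ] (Fin 5 × Fin n → ℂ) :=
  LinearMap.pi fun κ => LinearMap.proj (κ.1, κ.2.succ)

theorem oldCoords_extGauss (j k : Fin n) :
    oldCoords (extGauss p q h P Q ε j.succ k.succ) =
      pairGauss (diffInv p) (diffInv q) (signVal h) j k := by
  funext ⟨t, r⟩
  exact extGauss_succ p q h P Q ε j k t r

theorem map_oldSpan : (oldSpan p q h P Q ε).map oldCoords = gaussSpan p q h := by
  rw [oldSpan, map_bilinSpan, gaussSpan]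
  simp only [oldCoords_extGauss]

/-- The relation `c` gives an element of the old span that vanishes in all old coordinates. By skew
symmetry its torsion at the new node is `2ε` times the sum in `hT`, so the element is non-zero and
lies in the kernel of the projection onto `gaussSpan p q h`. -/
theorem finrank_oldSpan {mp mm : Fin n} (hp : h mp = 1) (hm : h mm = -1)
    {c : Fin n → Fin n → ℂ} (hc : ∀ j k, c j k = -c k j) (hrow : rowSums (signVal h) c = 0)
    (hc0 : ∑ j, ∑ k, c j k • pairGauss (diffInv p) (diffInv q) (signVal h) j k = 0)
    (hT : ∑ j, (∑ k, signVal h k * c j k * (Q - q k)⁻¹) * (P - p j)⁻¹ ≠ 0) :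
    Module.finrank ℂ (gaussSpan p q h) + 1 ≤ Module.finrank ℂ (oldSpan p q h P Q ε) := by
  set w := ∑ j, ∑ k, c j k • extGauss p q h P Q ε j.succ k.succ with hw
  have hmem : w ∈ oldSpan p q h P Q ε := sum_skew_mem_bilinSpan h hp hm c hc hrow _
  have hker : w ∈ LinearMap.ker (oldCoords (n := n)) := by
    rw [LinearMap.mem_ker, hw]
    simp only [map_sum, map_smul, oldCoords_extGauss]
    exact hc0
  have hw0 : w ≠ 0 := by
    intro e
    have e1 : w (4, 0) = 2 * ((ε : ℤ) : ℂ) *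
        ∑ j, (∑ k, signVal h k * c j k * (Q - q k)⁻¹) * (P - p j)⁻¹ := by
      have e2 : w (4, 0) = ((ε : ℤ) : ℂ) *
          (∑ j, ∑ k, signVal h k * c j k * (Q - q k)⁻¹ * (P - p j)⁻¹ -
            ∑ j, ∑ k, signVal h j * c j k * (Q - q j)⁻¹ * (P - p k)⁻¹) := by
        rw [hw]
        simp only [Finset.sum_apply, Pi.smul_apply, extGauss_succ_torsion, smul_eq_mul,
          ← Finset.sum_sub_distrib, Finset.mul_sum]
        refine Finset.sum_congr rfl fun j _ => Finset.sum_congr rfl fun k _ => ?_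
        ring
      have e3 : ∑ j, ∑ k, signVal h j * c j k * (Q - q j)⁻¹ * (P - p k)⁻¹ =
          -∑ j, ∑ k, signVal h k * c j k * (Q - q k)⁻¹ * (P - p j)⁻¹ := by
        rw [Finset.sum_comm, ← Finset.sum_neg_distrib]
        refine Finset.sum_congr rfl fun j _ => ?_
        rw [← Finset.sum_neg_distrib]
        refine Finset.sum_congr rfl fun k _ => ?_
        rw [hc k j]
        ring
      rw [e2, e3]
      simp only [Finset.sum_mul]
      ring
    have hε : ((ε : ℤ) : ℂ) ≠ 0 := by
      rcases Int.units_eq_one_or ε with e | e <;> simp [e]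
    rw [e] at e1
    exact mul_ne_zero (mul_ne_zero two_ne_zero hε) hT e1.symm
  have := finrank_add_finrank_map_le oldCoords (R₀ := Submodule.span ℂ {w})
    (R := oldSpan p q h P Q ε) (by simpa using hmem) (by simpa using hker)
  rw [map_oldSpan, finrank_span_singleton hw0] at this
  omega

end AddNode

theorem Admissible.cons {n : ℕ} (hn : 14 ≤ n) {h : Fin n → ℤˣ} (H : Admissible h) {mp mm : Fin n}
    (hp : h mp = 1) (hm : h mm = -1) (ε : ℤˣ) :
    Admissible (Fin.cons ε h : Fin (n + 1) → ℤˣ) := by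
  obtain ⟨p, q, pinj, qinj, p0, q0, hrank, b, hb, hdet⟩ := H
  rw [Fintype.card_fin] at hrank
  let U : Set (Fin 2 → ℂ) := {u | (∀ j, u 0 ≠ p j) ∧ ∀ j, u 1 ≠ q j}
  have rp : ∀ j, RationalOn U (fun u => (u 0 - p j)⁻¹) := fun j =>
    ((RationalOn.coord U 0).sub (RationalOn.const U _)).inv fun u hu => sub_ne_zero.2 (hu.1 j)
  have rq : ∀ j, RationalOn U (fun u => (u 1 - q j)⁻¹) := fun j =>
    ((RationalOn.coord U 1).sub (RationalOn.const U _)).inv fun u hu => sub_ne_zero.2 (hu.2 j)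
  obtain ⟨N, hN, hN'⟩ : ∃ N : MvPolynomial (Fin 2) ℂ, N ≠ 0 ∧
      ∀ u ∈ U, MvPolynomial.eval u N ≠ 0 → (nodeMatrix p q h b (u 0) (u 1)).det ≠ 0 := by
    have hr : RationalOn U (fun u => (nodeMatrix p q h b (u 0) (u 1)).det) := by
      refine RationalOn.det fun i t => ?_
      fin_cases t
      · change RationalOn U fun u => ∑ k, b i k * (u 0 - p k)⁻¹
        exact RationalOn.sum _ fun k _ => (RationalOn.const U _).mul (rp k)
      · change RationalOn U fun u => ∑ k, b i k * (u 0 - p k)⁻¹ ^ 2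
        exact RationalOn.sum _ fun k _ => (RationalOn.const U _).mul ((rp k).pow 2)
      · change RationalOn U fun u => ∑ k, signVal h k * b i k * (u 1 - q k)⁻¹
        exact RationalOn.sum _ fun k _ => (RationalOn.const U _).mul (rq k)
      · change RationalOn U fun u => ∑ k, signVal h k * b i k * (u 1 - q k)⁻¹ ^ 2
        exact RationalOn.sum _ fun k _ => (RationalOn.const U _).mul ((rq k).pow 2)
    -- This is where the condition at `(0, 0)` in `Admissible` enters: it shows that the determinant
    -- is not identically zero.
    exact hr.exists_polynomial (u₀ := 0) ⟨fun j => (p0 j).symm, fun j => (q0 j).symm⟩ hdet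
  obtain ⟨N₁, hN₁, hN₁'⟩ : ∃ N : MvPolynomial (Fin 2) ℂ, N ≠ 0 ∧ ∀ u ∈ U,
      MvPolynomial.eval u N ≠ 0 →
        5 * n ≤ Module.finrank ℂ (oldSpan p q h (u 0) (u 1) ε) + 9 := by
    -- Rank above `5n - 10` does not occur, but it need not be excluded: the projection onto
    -- `gaussSpan` would then suffice. Otherwise there is a relation to work with.
    by_cases hlt : 5 * n ≤ Module.finrank ℂ (gaussSpan p q h) + 9
    · refine ⟨1, one_ne_zero, fun u _ _ => hlt.trans (Nat.add_le_add_right ?_ _)⟩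
      rw [← map_oldSpan p q h (u 0) (u 1) ε]
      exact Submodule.finrank_map_le _ _
    · obtain ⟨c, hc0, hc, hrow, hsum⟩ := exists_skew_eq_zero hn h hp hm
        (pairGauss (diffInv p) (diffInv q) (signVal h)) (by rw [gaussSpan] at *; omega)
      have hr : RationalOn U (fun u =>
          ∑ j, (∑ k, signVal h k * c j k * (u 1 - q k)⁻¹) * (u 0 - p j)⁻¹) :=
        RationalOn.sum _ fun j _ => (RationalOn.sum _ fun k _ =>
          (RationalOn.const U _).mul (rq k)).mul (rp j)
      obtain ⟨j, hj⟩ := Function.ne_iff.1 hc0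
      have hd : (fun k => signVal h k * c j k) ≠ 0 := by
        obtain ⟨k, hk⟩ := Function.ne_iff.1 hj
        refine Function.ne_iff.2 ⟨k, mul_ne_zero ?_ hk⟩
        rcases Int.units_eq_one_or (h k) with e | e <;> simp [signVal, e]
      -- One variable at a time: a non-zero row of `c` gives `Q` with a non-zero inner sum, and the
      -- inner sums are then the coefficients from which `P` is found.
      obtain ⟨Q, hQ, hQ'⟩ := exists_sum_inv_sub_ne_zero qinj hd
      obtain ⟨P, hP, hP'⟩ := exists_sum_inv_sub_ne_zero pinj
        (d := fun j => ∑ k, signVal h k * c j k * (Q - q k)⁻¹) (Function.ne_iff.2 ⟨j, hQ'⟩)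
      obtain ⟨N₁, h1, h2⟩ := hr.exists_polynomial (u₀ := ![P, Q]) ⟨hP, hQ⟩ hP'
      refine ⟨N₁, h1, fun u hu hNu => ?_⟩
      have := finrank_oldSpan p q h (u 0) (u 1) ε hp hm hc hrow hsum (h2 u hu hNu)
      omega
  -- Non-vanishing of `E` keeps the new node away from the old ones and from coordinate `0`, so that
  -- `(0, 0)` stays available for the next node.
  let E : MvPolynomial (Fin 2) ℂ := (MvPolynomial.X 0 * MvPolynomial.X 1) *
    ∏ j, ((MvPolynomial.X 0 - MvPolynomial.C (p j)) * (MvPolynomial.X 1 - MvPolynomial.C (q j)))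
  have hX : ∀ (i : Fin 2) (z : ℂ),
      (MvPolynomial.X i - MvPolynomial.C z : MvPolynomial (Fin 2) ℂ) ≠ 0 := by
    intro i z e
    have := congrArg (MvPolynomial.eval fun _ => z + 1) e
    simp at this
  have hE : E ≠ 0 := mul_ne_zero (mul_ne_zero (MvPolynomial.X_ne_zero _) (MvPolynomial.X_ne_zero _))
    (Finset.prod_ne_zero_iff.2 fun j _ => mul_ne_zero (hX _ _) (hX _ _))
  obtain ⟨u, hu⟩ : ∃ u, MvPolynomial.eval u (N * N₁ * E) ≠ 0 := by
    by_contra! hcon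
    exact mul_ne_zero (mul_ne_zero hN hN₁) hE (MvPolynomial.funext fun u => by simp [hcon u])
  rw [map_mul, map_mul] at hu
  have hu1 := left_ne_zero_of_mul (left_ne_zero_of_mul hu)
  have hu2 := right_ne_zero_of_mul (left_ne_zero_of_mul hu)
  have hu3 := right_ne_zero_of_mul hu
  simp only [E, map_mul, map_prod, map_sub, MvPolynomial.eval_X, MvPolynomial.eval_C] at hu3
  have hu4 := right_ne_zero_of_mul hu3
  rw [Finset.prod_ne_zero_iff] at hu4
  have hu0 := left_ne_zero_of_mul hu3
  have hU : u ∈ U := ⟨fun j => sub_ne_zero.1 (left_ne_zero_of_mul (hu4 j (Finset.mem_univ j))),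
    fun j => sub_ne_zero.1 (right_ne_zero_of_mul (hu4 j (Finset.mem_univ j)))⟩
  refine ⟨Fin.cons (u 0) p, Fin.cons (u 1) q, ?_, ?_, ?_, ?_, ?_, ?_⟩
  · rw [Fin.cons_injective_iff]
    exact ⟨fun ⟨j, hj⟩ => hU.1 j hj.symm, pinj⟩
  · rw [Fin.cons_injective_iff]
    exact ⟨fun ⟨j, hj⟩ => hU.2 j hj.symm, qinj⟩
  · exact Fin.cases (left_ne_zero_of_mul hu0) p0
  · exact Fin.cases (right_ne_zero_of_mul hu0) q0
  · obtain ⟨m, hm'⟩ : ∃ m, h m = ε := by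
      rcases Int.units_eq_one_or ε with e | e
      · exact ⟨mp, hp.trans e.symm⟩
      · exact ⟨mm, hm.trans e.symm⟩
    -- Four dimensions from the poles and one from the torsion: the bound `5n - 10` grows by five.
    have h1 := finrank_gaussSpan_cons p q h (u 0) (u 1) ε hm' hb (hN' u hU hu1)
    have h2 := hN₁' u hU hu2
    rw [Fintype.card_fin]
    omega
  · refine ⟨fun i => Fin.cons 0 (b i), fun i => cons_zero_mem_signKer h ε (hb i), ?_⟩
    have e : nodeMatrix (Fin.cons (u 0) p : Fin (n + 1) → ℂ) (Fin.cons (u 1) q : Fin (n + 1) → ℂ)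
        (Fin.cons ε h : Fin (n + 1) → ℤˣ) (fun i => Fin.cons 0 (b i)) 0 0 =
          nodeMatrix p q h b 0 0 := by
      funext i
      simp [nodeMatrix, Fin.sum_univ_succ (n := n), signVal]
    rw [e]
    exact hdet

/-! ### Balanced signs -/

theorem Admissible.comp_equiv {ι ι' : Type*} [Fintype ι] [DecidableEq ι] [Fintype ι']
    [DecidableEq ι'] {h : ι → ℤˣ} (H : Admissible h) (e : ι' ≃ ι) : Admissible (h ∘ e) := by
  obtain ⟨p, q, pinj, qinj, p0, q0, hrank, b, hb, hdet⟩ := H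
  have hV : ∀ {a : ι → ℂ}, a ∈ signKer (signVal h) → a ∘ e ∈ signKer (signVal (h ∘ e)) := by
    intro a ha
    exact ⟨(e.sum_comp a).trans ha.1, (e.sum_comp fun j => signVal h j * a j).trans ha.2⟩
  refine ⟨p ∘ e, q ∘ e, pinj.comp e.injective, qinj.comp e.injective, fun i => p0 _, fun i => q0 _,
    ?_, fun i => b i ∘ e, fun i => hV (hb i), ?_⟩
  · rw [Fintype.card_congr e]
    refine hrank.trans (Nat.add_le_add_right ?_ _)
    let ρ : (Fin 5 × ι → ℂ) ≃ₗ[ℂ] (Fin 5 × ι' → ℂ) :=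
      LinearEquiv.funCongrLeft ℂ ℂ ((Equiv.refl (Fin 5)).prodCongr e)
    rw [← LinearEquiv.finrank_map_eq ρ]
    refine Submodule.finrank_mono ?_
    rw [gaussSpan, map_bilinSpan, bilinSpan, Submodule.span_le]
    rintro _ ⟨a, ha, c, hc, rfl⟩
    have := mem_bilinSpan (pairGauss (diffInv (p ∘ e)) (diffInv (q ∘ e)) (signVal (h ∘ e)))
      (hV ha) (hV hc)
    have hE : ∑ j, ∑ k, (a j * c k) •
        ρ.toLinearMap (pairGauss (diffInv p) (diffInv q) (signVal h) j k) =
        ∑ j, ∑ k, ((a ∘ e) j * (c ∘ e) k) •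
          pairGauss (diffInv (p ∘ e)) (diffInv (q ∘ e)) (signVal (h ∘ e)) j k := ?_
    · rw [hE]
      exact this
    refine (e.sum_comp _).symm.trans ?_
    refine Finset.sum_congr rfl fun j _ => (e.sum_comp _).symm.trans ?_
    refine Finset.sum_congr rfl fun k _ => ?_
    congr 1
    funext ⟨t, r⟩
    exact (pairGauss_comp e e.injective (diffInv p) (diffInv q) (signVal h) j k t r).symm
  · have hM : nodeMatrix (p ∘ e) (q ∘ e) (h ∘ e) (fun i => b i ∘ e) 0 0 =
        nodeMatrix p q h b 0 0 := by
      funext i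
      simp only [nodeMatrix]
      rw [← e.sum_comp fun k => b i k * (0 - p k)⁻¹, ← e.sum_comp fun k => b i k * (0 - p k)⁻¹ ^ 2,
        ← e.sum_comp fun k => signVal h k * b i k * (0 - q k)⁻¹,
        ← e.sum_comp fun k => signVal h k * b i k * (0 - q k)⁻¹ ^ 2]
      rfl
    rw [hM]
    exact hdet

/-- The signs `h` and `-h` define the same bundle. All coordinates in `pairGauss` are even in `h`,
and the last two columns of `nodeMatrix` just change sign. -/
theorem Admissible.neg {ι : Type*} [Fintype ι] [DecidableEq ι] {h : ι → ℤˣ} (H : Admissible h) :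
    Admissible (-h) := by
  obtain ⟨p, q, pinj, qinj, p0, q0, hrank, b, hb, hdet⟩ := H
  have hs : signVal (-h) = -signVal h := by
    funext j
    simp [signVal]
  have hV : signKer (signVal (-h)) = signKer (signVal h) := by
    ext a
    simp [signKer, hs]
  refine ⟨p, q, pinj, qinj, p0, q0, ?_, b, fun i => hV ▸ hb i, ?_⟩
  · have : gaussSpan p q (-h) = gaussSpan p q h := by
      rw [gaussSpan, gaussSpan, hV]
      congr 1
      funext j k ⟨t, r⟩
      fin_cases t <;> simp only [pairGauss, hs, Pi.neg_apply] <;> ring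
    rwa [this]
  · have hM : nodeMatrix p q (-h) b 0 0 =
        nodeMatrix p q h b 0 0 * Matrix.diagonal ![1, 1, -1, -1] := by
      ext i t
      rw [Matrix.mul_diagonal]
      fin_cases t <;> simp [nodeMatrix, hs]
    rw [hM, Matrix.det_mul]
    refine mul_ne_zero hdet ?_
    simp [Matrix.det_diagonal, Fin.prod_univ_succ]

theorem two_mul_card_fiber {ι : Type*} [Fintype ι] [DecidableEq ι] (h : ι → ℤˣ) (ε : ℤˣ) :
    2 * (Fintype.card {i // h i = ε} : ℤ) = Fintype.card ι + ε * ∑ i, (h i : ℤ) := by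
  have e : ∀ i, 1 + (ε : ℤ) * h i = if h i = ε then 2 else 0 := by
    intro i
    rcases Int.units_eq_one_or (h i) with h1 | h1 <;> rcases Int.units_eq_one_or ε with h2 | h2 <;>
      simp [h1, h2]
  have := Finset.sum_congr rfl fun i (_ : i ∈ Finset.univ) => e i
  rw [Finset.sum_add_distrib, ← Finset.mul_sum, ← Finset.sum_filter] at this
  simp only [Finset.sum_const, nsmul_eq_mul, Finset.card_univ, mul_one] at this
  rw [this, Fintype.card_subtype, mul_comm]

/-- The number of nodes and the sum of the signs determine how many nodes carry each sign. -/
theorem exists_equiv_of_sum_eq {ι ι' : Type*} [Fintype ι] [DecidableEq ι] [Fintype ι']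
    [DecidableEq ι'] (h : ι → ℤˣ) (h' : ι' → ℤˣ) (hc : Fintype.card ι = Fintype.card ι')
    (hs : ∑ i, (h i : ℤ) = ∑ i, (h' i : ℤ)) : ∃ e : ι ≃ ι', h' ∘ e = h := by
  have hf : ∀ ε, Nonempty ({i // h i = ε} ≃ {i // h' i = ε}) := by
    intro ε
    rw [← Fintype.card_eq]
    have h1 := two_mul_card_fiber h ε
    have h2 := two_mul_card_fiber h' ε
    rw [← hs, ← hc] at h2
    omega
  refine ⟨Equiv.ofFiberEquiv fun ε => (hf ε).some, ?_⟩
  funext i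
  exact Equiv.ofFiberEquiv_map _ i

theorem exists_sign_eq {n : ℕ} (hn : 2 ≤ n) (h : Fin n → ℤˣ) (hbal : |∑ i, (h i : ℤ)| ≤ 1)
    (ε : ℤˣ) : ∃ i, h i = ε := by
  have h1 := two_mul_card_fiber h ε
  rw [abs_le] at hbal
  have : 0 < Fintype.card {i // h i = ε} := by
    rw [Fintype.card_fin] at h1
    rcases Int.units_eq_one_or ε with e | e <;> simp [e] at h1 ⊢ <;> omega
  obtain ⟨i, hi⟩ := Fintype.card_pos_iff.1 this
  exact ⟨i, hi⟩

/-- The identity `two_mul_card_fiber` fixes the parity of the sum of the signs: it is `±1` for odd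
`n` and `0` for even `n`. So up to renumbering, and up to `h ↦ -h` for `n = 13`, the signs in the
base cases are those of `sUnit`. -/
theorem admissible_of_balanced {n : ℕ} (hn : 13 ≤ n) (h : Fin n → ℤˣ)
    (hbal : |∑ i, (h i : ℤ)| ≤ 1) : Admissible h := by
  have h2 := two_mul_card_fiber h 1
  have hb := abs_le.1 hbal
  rw [Fintype.card_fin, Units.val_one, one_mul] at h2
  rcases hn.eq_or_lt with rfl | hn
  · have h13 : ∑ i : Fin 13, ((sUnit i : ℤˣ) : ℤ) = 1 := by decide
    rcases (by omega : ∑ i, (h i : ℤ) = 1 ∨ ∑ i, (h i : ℤ) = -1) with e | e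
    · obtain ⟨σ, hσ⟩ := exists_equiv_of_sum_eq h (fun j : Fin 13 => sUnit j) rfl (e.trans h13.symm)
      exact hσ ▸ admissible_thirteen.comp_equiv σ
    · obtain ⟨σ, hσ⟩ := exists_equiv_of_sum_eq (-h) (fun j : Fin 13 => sUnit j) rfl
        (by simp [e, h13])
      have := (admissible_thirteen.comp_equiv σ).neg
      rwa [show ((fun j : Fin 13 => sUnit j) ∘ σ) = -h from hσ, neg_neg] at this
  · induction n, (hn : 14 ≤ n) using Nat.le_induction with
    | base =>
      have h14 : ∑ i : Fin 14, ((sUnit i : ℤˣ) : ℤ) = 0 := by decide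
      obtain ⟨σ, hσ⟩ := exists_equiv_of_sum_eq h (fun j : Fin 14 => sUnit j) rfl
        ((by omega : ∑ i, (h i : ℤ) = 0).trans h14.symm)
      exact hσ ▸ admissible_fourteen.comp_equiv σ
    | succ n hn' ih =>
      -- A node of the majority sign is removed; when the sum is `0`, one of sign `-1`. It is
      -- swapped to position `0`, where `Admissible.cons` puts it back.
      obtain ⟨i, hi⟩ : ∃ i, |∑ i, (h i : ℤ) - h i| ≤ 1 := by
        rcases (by omega : ∑ i, (h i : ℤ) = 1 ∨ ∑ i, (h i : ℤ) ≤ 0) with e | e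
        · obtain ⟨i, hi⟩ := exists_sign_eq (by omega) h hbal 1
          exact ⟨i, by simp [e, hi]⟩
        · obtain ⟨i, hi⟩ := exists_sign_eq (by omega) h hbal (-1)
          refine ⟨i, ?_⟩
          rw [hi, abs_le]
          simp
          omega
      set h' := h ∘ Equiv.swap 0 i with hh'
      have hsum : ∑ j, (h j : ℤ) = h i + ∑ j : Fin n, (h' j.succ : ℤ) := by
        rw [← Equiv.sum_comp (Equiv.swap 0 i) fun j => (h j : ℤ), Fin.sum_univ_succ]
        simp [hh']
      have hbal' : |∑ j : Fin n, (h' j.succ : ℤ)| ≤ 1 := by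
        rwa [hsum, add_sub_cancel_left] at hi
      have h3 := two_mul_card_fiber (fun j : Fin n => h' j.succ) 1
      rw [Fintype.card_fin, Units.val_one, one_mul] at h3
      have hA := ih (by omega) (fun j => h' j.succ) hbal' h3 (abs_le.1 hbal')
      obtain ⟨mp, hp⟩ := exists_sign_eq (by omega) (fun j : Fin n => h' j.succ) hbal' 1
      obtain ⟨mm, hm⟩ := exists_sign_eq (by omega) (fun j : Fin n => h' j.succ) hbal' (-1)
      have hC := (hA.cons hn' hp hm (h' 0)).comp_equiv (Equiv.swap 0 i)
      rw [show (Fin.cons (h' 0) (fun j => h' j.succ) : Fin (n + 1) → ℤˣ) = h' from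
        Fin.cons_self_tail h', hh', Function.comp_assoc] at hC
      have hswap : (Equiv.swap 0 i : Fin (n + 1) → Fin (n + 1)) ∘ Equiv.swap 0 i = id :=
        funext fun j => Equiv.swap_apply_self 0 i j
      rwa [hswap, Function.comp_id] at hC

/-! ### The local ring of the projective line at a point -/

/-- The rational functions that are regular at `c`. -/
def regAt (c : ℂ) : Subalgebra ℂ (RatFunc ℂ) where
  carrier := {f | IsRegularAt c f}
  mul_mem' := IsRegularAt.mul
  add_mem' := IsRegularAt.add
  algebraMap_mem' := isRegularAt_const c

/-- Evaluation at `c`. -/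
def regVal (c : ℂ) : regAt c →ₐ[ℂ] ℂ where
  toFun f := value c f
  map_one' := by
    have := value_const c 1
    rwa [map_one] at this
  map_mul' f g := value_mul f.2 g.2
  map_zero' := by
    have := value_const c 0
    rwa [map_zero] at this
  map_add' f g := value_add f.2 g.2
  commutes' z := value_const c z

/-- Differentiation of regular functions. -/
def regDeriv (c : ℂ) : Derivation ℂ (regAt c) (regAt c) :=
  Derivation.mk'
    { toFun := fun f => ⟨ratDeriv f, f.2.ratDeriv⟩
      map_add' := fun f g => Subtype.ext (ratDeriv_add f g)
      map_smul' := fun z f => Subtype.ext (derivRat.map_smul z (f : RatFunc ℂ)) }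
    (fun f g => Subtype.ext (ratDeriv_mul f g))

/-- The coordinate function. -/
def regX (c : ℂ) : regAt c :=
  ⟨RatFunc.X, by rw [← RatFunc.algebraMap_X]; exact isRegularAt_algebraMap c _⟩

theorem ratDeriv_algebraMap (P : ℂ[X]) :
    ratDeriv (algebraMap ℂ[X] (RatFunc ℂ) P) =
      algebraMap ℂ[X] (RatFunc ℂ) (Polynomial.derivative P) := by
  rw [ratDeriv_eq (p := P) (q := 1) one_ne_zero (by simp)]
  simp

theorem ratDeriv_X : ratDeriv RatFunc.X = 1 := by
  rw [← RatFunc.algebraMap_X, ratDeriv_algebraMap]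
  simp

theorem regVal_regX (c : ℂ) : regVal c (regX c) = c := by
  change value c RatFunc.X = c
  simp [value]

theorem regDeriv_regX (c : ℂ) : regDeriv c (regX c) = 1 := Subtype.ext ratDeriv_X

theorem coe_aeval_regX (c : ℂ) (P : ℂ[X]) :
    ((Polynomial.aeval (regX c) P : regAt c) : RatFunc ℂ) = algebraMap ℂ[X] (RatFunc ℂ) P := by
  have h1 := Polynomial.aeval_algHom_apply (regAt c).val (regX c) P
  have h2 : (Polynomial.aeval (RatFunc.X : RatFunc ℂ)) P = algebraMap ℂ[X] (RatFunc ℂ) P := by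
    rw [← RatFunc.algebraMap_X, Polynomial.aeval_algebraMap_apply, Polynomial.aeval_X_left_apply]
  exact h1.symm.trans h2

theorem exists_aeval_regX_mul_eq {c : ℂ} (f : regAt c) : ∃ P Q : ℂ[X], ∃ g : regAt c,
    f * Polynomial.aeval (regX c) Q = Polynomial.aeval (regX c) P ∧
      g * Polynomial.aeval (regX c) Q = 1 := by
  have hd := RatFunc.algebraMap_ne_zero (f : RatFunc ℂ).denom_ne_zero
  refine ⟨(f : RatFunc ℂ).num, (f : RatFunc ℂ).denom,
    ⟨1 / algebraMap ℂ[X] (RatFunc ℂ) (f : RatFunc ℂ).denom,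
      isRegularAt_of_eq 1 _ f.2 (by rw [map_one])⟩, Subtype.ext ?_, Subtype.ext ?_⟩
  · rw [MulMemClass.coe_mul, coe_aeval_regX, coe_aeval_regX]
    exact (eq_div_iff hd).1 (RatFunc.num_div_denom _).symm
  · rw [MulMemClass.coe_mul, coe_aeval_regX]
    exact one_div_mul_cancel hd

/-- A derivation along a homomorphism from the local ring is determined by its value at the
coordinate function. -/
theorem derivation_regAt {c : ℂ} {A M : Type*} [CommRing A] [Algebra ℂ A] [AddCommGroup M]
    [Module A M] [Module ℂ M] [IsScalarTower ℂ A M] (φ : regAt c →ₐ[ℂ] A) (D : Derivation ℂ A M)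
    (f : regAt c) : D (φ f) = φ (regDeriv c f) • D (φ (regX c)) := by
  obtain ⟨P, Q, g, h1, h2⟩ := exists_aeval_regX_mul_eq f
  have hD : ∀ P : ℂ[X], D (φ (Polynomial.aeval (regX c) P)) =
      φ (regDeriv c (Polynomial.aeval (regX c) P)) • D (φ (regX c)) := by
    intro P
    rw [← Polynomial.aeval_algHom_apply, Derivation.map_aeval, Derivation.map_aeval, regDeriv_regX,
      smul_eq_mul, mul_one, Polynomial.aeval_algHom_apply]
  -- Apply `D` to `f Q = P`: the terms with the differential of `Q` cancel, and the remaining factor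
  -- `Q` is a unit.
  have e1 := hD P
  have e2 := hD Q
  rw [← h1] at e1
  simp only [map_mul, Derivation.leibniz, map_add, smul_eq_mul, e2, add_smul, mul_smul] at e1
  rw [add_right_inj] at e1
  have e3 := congrArg (fun m => φ g • m) e1
  simpa only [← mul_smul, ← map_mul, h2, map_one, one_smul, ← mul_assoc, one_mul] using e3

/-- First-order Taylor expansion: with `f = P / Q`, the polynomial `P - f(c) Q` is divisible by `X -
c`, and differentiating the resulting identity at `c` identifies the value of `g`. -/
theorem exists_eq_mul_of_regAt {c : ℂ} (f : regAt c) : ∃ g : regAt c,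
    f = algebraMap ℂ _ (regVal c f) + (regX c - algebraMap ℂ _ c) * g ∧
      regVal c g = regVal c (regDeriv c f) := by
  obtain ⟨P, Q, g, h1, h2⟩ := exists_aeval_regX_mul_eq f
  set z := regVal c f with hz
  have hroot : (P - Polynomial.C z * Q).IsRoot c := by
    have e := congrArg (regVal c) h1
    rw [map_mul, ← Polynomial.aeval_algHom_apply, ← Polynomial.aeval_algHom_apply, regVal_regX,
      Polynomial.aeval_def, Polynomial.aeval_def, Algebra.algebraMap_self,
      Polynomial.eval₂_id, Polynomial.eval₂_id] at e
    simp [Polynomial.IsRoot, ← e, hz]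
  obtain ⟨S, hS⟩ := Polynomial.dvd_iff_isRoot.2 hroot
  have hS' := congrArg (Polynomial.aeval (regX c)) hS
  simp only [map_sub, map_mul, Polynomial.aeval_C, Polynomial.aeval_X] at hS'
  have main : f = algebraMap ℂ _ z + (regX c - algebraMap ℂ _ c) *
      (g * Polynomial.aeval (regX c) S) := by
    linear_combination g * hS' - (f - algebraMap ℂ _ z) * h2 + g * h1
  refine ⟨g * Polynomial.aeval (regX c) S, main, ?_⟩
  have e := congrArg (fun f => regVal c (regDeriv c f)) main
  simp only [map_add, Derivation.leibniz, Derivation.map_algebraMap, map_sub, regDeriv_regX,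
    smul_eq_mul, map_mul, regVal_regX, AlgHom.commutes, Algebra.algebraMap_self, RingHom.id_apply,
    sub_self, zero_mul, zero_add, sub_zero, mul_one] at e
  rw [map_mul]
  exact e.symm

/-! ### Differentials at a node -/

namespace BinaryCurve

variable {g : ℕ} (C : BinaryCurve g) (i : Fin (g + 1))

/-- Functions on the first component, extended by a constant. -/
def inLeft : regAt (C.p i) →ₐ[ℂ] C.nodeRing i where
  toFun f := ⟨(f, algebraMap ℂ _ (regVal _ f)), f.2, isRegularAt_const _ _, (value_const _ _).symm⟩
  map_one' := Subtype.ext (Prod.ext rfl (by simp))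
  map_mul' f g := Subtype.ext (Prod.ext rfl (by simp))
  map_zero' := Subtype.ext (Prod.ext rfl (by simp))
  map_add' f g := Subtype.ext (Prod.ext rfl (by simp))
  commutes' z := Subtype.ext (Prod.ext rfl (by simp))

/-- Functions on the second component, extended by a constant. -/
def inRight : regAt (C.q i) →ₐ[ℂ] C.nodeRing i where
  toFun f := ⟨(algebraMap ℂ _ (regVal _ f), f), isRegularAt_const _ _, f.2, value_const _ _⟩
  map_one' := Subtype.ext (Prod.ext (by simp) rfl)
  map_mul' f g := Subtype.ext (Prod.ext (by simp) rfl)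
  map_zero' := Subtype.ext (Prod.ext (by simp) rfl)
  map_add' f g := Subtype.ext (Prod.ext (by simp) rfl)
  commutes' z := Subtype.ext (Prod.ext (by simp) rfl)

/-- The restriction of a function at the node to the first component. -/
def resLeft : C.nodeRing i →ₐ[ℂ] regAt (C.p i) where
  toFun f := ⟨f.1.1, f.2.1⟩
  map_one' := rfl
  map_mul' _ _ := rfl
  map_zero' := rfl
  map_add' _ _ := rfl
  commutes' _ := rfl

/-- The restriction of a function at the node to the second component. -/
def resRight : C.nodeRing i →ₐ[ℂ] regAt (C.q i) where
  toFun f := ⟨f.1.2, f.2.2.1⟩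
  map_one' := rfl
  map_mul' _ _ := rfl
  map_zero' := rfl
  map_add' _ _ := rfl
  commutes' _ := rfl

/-- The local ring is a fibre product over `ℂ`: with common value `c` at the node, `(f₁, f₂) = (f₁,
c) + (c, f₂) - (c, c)`. -/
theorem eq_inLeft_add_inRight (f : C.nodeRing i) :
    f = C.inLeft i (C.resLeft i f) + C.inRight i (C.resRight i f) -
      algebraMap ℂ _ (regVal _ (C.resLeft i f)) := by
  have h : regVal _ (C.resRight i f) = regVal _ (C.resLeft i f) := f.2.2.2.symm
  refine Subtype.ext (Prod.ext ?_ ?_)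
  · change f.1.1 = f.1.1 + algebraMap ℂ _ (regVal _ (C.resRight i f)) - algebraMap ℂ _ _
    rw [h, add_sub_cancel_right]
  · change f.1.2 = algebraMap ℂ _ (regVal _ (C.resLeft i f)) + f.1.2 - algebraMap ℂ _ _
    rw [add_sub_cancel_left]

/-- The local equation of the second component. -/
def eqLeft : C.nodeRing i := C.inLeft i (regX _ - algebraMap ℂ _ (C.p i))

/-- The local equation of the first component. -/
def eqRight : C.nodeRing i := C.inRight i (regX _ - algebraMap ℂ _ (C.q i))

theorem eqLeft_mul_eqRight : C.eqLeft i * C.eqRight i = 0 := by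
  refine Subtype.ext (Prod.ext ?_ ?_)
  · change _ * algebraMap ℂ (RatFunc ℂ) (regVal _ (regX _ - algebraMap ℂ _ (C.q i))) = 0
    rw [map_sub, regVal_regX, AlgHom.commutes]
    simp
  · change algebraMap ℂ (RatFunc ℂ) (regVal _ (regX _ - algebraMap ℂ _ (C.p i))) * _ = 0
    rw [map_sub, regVal_regX, AlgHom.commutes]
    simp

theorem sub_smul_add_add_smul {N : Type*} [AddCommGroup N] [Module ℂ N] (x y τ : N) {c d e : ℂ}
    (he : e = d - c) : x - c • τ + (y + d • τ) = x + y + e • τ := by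
  rw [he, sub_smul]
  abel

section Derivation

variable {i} {M : Type*} [AddCommGroup M] [Module (C.nodeRing i) M] [Module ℂ M]
  (D : Derivation ℂ (C.nodeRing i) M)

/-- The differential of the coordinate on the first component. -/
def dLeft : M := D (C.inLeft i (regX _))

/-- The differential of the coordinate on the second component. -/
def dRight : M := D (C.inRight i (regX _))

/-- The generator of the torsion differentials. -/
def torsionDiff : M := C.eqLeft i • C.dRight D

theorem D_eqLeft : D (C.eqLeft i) = C.dLeft D := by
  rw [eqLeft, map_sub, map_sub, AlgHom.commutes, Derivation.map_algebraMap, sub_zero, dLeft]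

theorem D_eqRight : D (C.eqRight i) = C.dRight D := by
  rw [eqRight, map_sub, map_sub, AlgHom.commutes, Derivation.map_algebraMap, sub_zero, dRight]

/-- Differentiate `x y = 0`, the equation of the node. -/
theorem eqRight_smul_dLeft : C.eqRight i • C.dLeft D = -C.torsionDiff D := by
  have h := congrArg D (C.eqLeft_mul_eqRight i)
  rw [Derivation.leibniz, map_zero, D_eqLeft, D_eqRight] at h
  exact eq_neg_of_add_eq_zero_right h

/-- The differential with given restrictions to the components and given torsion. -/
def germ (a : regAt (C.p i)) (b : regAt (C.q i)) (z : ℂ) : M :=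
  C.inLeft i a • C.dLeft D + C.inRight i b • C.dRight D + z • C.torsionDiff D

theorem germ_add (a a' : regAt (C.p i)) (b b' : regAt (C.q i)) (z z' : ℂ) :
    C.germ D (a + a') (b + b') (z + z') = C.germ D a b z + C.germ D a' b' z' := by
  simp only [germ, map_add, add_smul]
  abel

variable [IsScalarTower ℂ (C.nodeRing i) M]

/-- With `τ = x dy = -y dx`, the relation `x y = 0` gives `x τ = 0`, so functions act on the torsion
through their value at the node. -/
theorem inLeft_smul_torsionDiff (f : regAt (C.p i)) :
    C.inLeft i f • C.torsionDiff D = regVal _ f • C.torsionDiff D := by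
  obtain ⟨u, hu, -⟩ := exists_eq_mul_of_regAt f
  have h0 : C.eqLeft i • C.torsionDiff D = 0 := by
    rw [← neg_neg (C.torsionDiff D), ← eqRight_smul_dLeft, smul_neg, ← mul_smul, eqLeft_mul_eqRight,
      zero_smul, neg_zero]
  conv_lhs => rw [hu]
  rw [map_add, map_mul, AlgHom.commutes, add_smul, algebraMap_smul, mul_comm, mul_smul]
  change _ + C.inLeft i u • C.eqLeft i • C.torsionDiff D = _
  rw [h0, smul_zero, add_zero]

theorem inRight_smul_torsionDiff (f : regAt (C.q i)) :
    C.inRight i f • C.torsionDiff D = regVal _ f • C.torsionDiff D := by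
  obtain ⟨u, hu, -⟩ := exists_eq_mul_of_regAt f
  have h0 : C.eqRight i • C.torsionDiff D = 0 := by
    rw [torsionDiff, ← mul_smul, mul_comm, eqLeft_mul_eqRight, zero_smul]
  conv_lhs => rw [hu]
  rw [map_add, map_mul, AlgHom.commutes, add_smul, algebraMap_smul, mul_comm, mul_smul]
  change _ + C.inRight i u • C.eqRight i • C.torsionDiff D = _
  rw [h0, smul_zero, add_zero]

/-- Write `r` as a function on the first component plus `u y`, where `u` takes at the node the value
of the derivative of `r` along the second component; then use `y dx = -τ`. -/
theorem smul_dLeft (r : C.nodeRing i) : r • C.dLeft D = C.inLeft i (C.resLeft i r) • C.dLeft D -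
    regVal _ (regDeriv _ (C.resRight i r)) • C.torsionDiff D := by
  obtain ⟨u, hu, hu'⟩ := exists_eq_mul_of_regAt (C.resRight i r)
  have h : regVal _ (C.resRight i r) = regVal _ (C.resLeft i r) := r.2.2.2.symm
  have e : r = C.inLeft i (C.resLeft i r) + C.inRight i u * C.eqRight i := by
    conv_lhs => rw [C.eq_inLeft_add_inRight i r, hu]
    rw [map_add, map_mul, AlgHom.commutes, h, eqRight]
    ring
  conv_lhs => rw [e]
  rw [add_smul, mul_smul, eqRight_smul_dLeft, smul_neg, inRight_smul_torsionDiff, hu', sub_eq_add_neg]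

theorem smul_dRight (r : C.nodeRing i) : r • C.dRight D = C.inRight i (C.resRight i r) • C.dRight D +
    regVal _ (regDeriv _ (C.resLeft i r)) • C.torsionDiff D := by
  obtain ⟨u, hu, hu'⟩ := exists_eq_mul_of_regAt (C.resLeft i r)
  have e : r = C.inRight i (C.resRight i r) + C.inLeft i u * C.eqLeft i := by
    conv_lhs => rw [C.eq_inLeft_add_inRight i r]
    have hu2 := congrArg (C.inLeft i) hu
    rw [map_add, map_mul, AlgHom.commutes] at hu2
    rw [eqLeft, hu2]
    ring
  conv_lhs => rw [e]
  rw [add_smul, mul_smul]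
  change _ + C.inLeft i u • C.torsionDiff D = _
  rw [inLeft_smul_torsionDiff, hu']

theorem D_nodeRing (f : C.nodeRing i) : D f =
    C.inLeft i (regDeriv _ (C.resLeft i f)) • C.dLeft D +
      C.inRight i (regDeriv _ (C.resRight i f)) • C.dRight D := by
  conv_lhs => rw [C.eq_inLeft_add_inRight i f]
  rw [map_sub, map_add, Derivation.map_algebraMap, sub_zero, derivation_regAt (C.inLeft i),
    derivation_regAt (C.inRight i), dLeft, dRight]

theorem germ_smul (c : ℂ) (a : regAt (C.p i)) (b : regAt (C.q i)) (z : ℂ) :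
    C.germ D (c • a) (c • b) (c * z) = c • C.germ D a b z := by
  simp only [germ, map_smul, smul_add, mul_smul, smul_assoc]

/-- The Wronskian differential in terms of its restrictions to the components and the torsion. -/
theorem wronskian_nodeRing (f₁ f₂ : C.nodeRing i) : f₁ • D f₂ - f₂ • D f₁ = C.germ D
    (C.resLeft i f₁ * regDeriv _ (C.resLeft i f₂) - C.resLeft i f₂ * regDeriv _ (C.resLeft i f₁))
    (C.resRight i f₁ * regDeriv _ (C.resRight i f₂) -
      C.resRight i f₂ * regDeriv _ (C.resRight i f₁))
    (2 * (regVal _ (regDeriv _ (C.resLeft i f₁)) * regVal _ (regDeriv _ (C.resRight i f₂)) -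
      regVal _ (regDeriv _ (C.resLeft i f₂)) * regVal _ (regDeriv _ (C.resRight i f₁)))) := by
  have hLL : ∀ f, C.resLeft i (C.inLeft i f) = f := fun f => rfl
  have hRR : ∀ f, C.resRight i (C.inRight i f) = f := fun f => rfl
  have hLR : ∀ f, C.resRight i (C.inLeft i f) = algebraMap ℂ _ (regVal _ f) := fun f => rfl
  have hRL : ∀ f, C.resLeft i (C.inRight i f) = algebraMap ℂ _ (regVal _ f) := fun f => rfl
  have e : f₁ • D f₂ - f₂ • D f₁ =
      (f₁ * C.inLeft i (regDeriv _ (C.resLeft i f₂)) -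
        f₂ * C.inLeft i (regDeriv _ (C.resLeft i f₁))) • C.dLeft D +
      (f₁ * C.inRight i (regDeriv _ (C.resRight i f₂)) -
        f₂ * C.inRight i (regDeriv _ (C.resRight i f₁))) • C.dRight D := by
    rw [D_nodeRing, D_nodeRing]
    simp only [smul_add, sub_smul, mul_smul]
    abel
  -- The summands with `dLeft` and `dRight` contribute the same torsion, whence the factor `2`.
  rw [e, smul_dLeft, smul_dRight, germ]
  simp only [map_sub, map_mul, hLL, hRR, hLR, hRL, Derivation.leibniz, Derivation.map_algebraMap,
    smul_eq_mul, mul_zero, zero_add, AlgHom.commutes, Algebra.algebraMap_self, RingHom.id_apply]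
  exact sub_smul_add_add_smul _ _ _ (by ring)

/-- By `D_nodeRing` all differentials are combinations of `dLeft` and `dRight`. Coefficients can be
replaced by functions on a single component at the cost of torsion, and `ρ` reads off these
functions. -/
theorem exists_eq_of_mem_span (ρ : M →ₗ[C.nodeRing i] Tot) (hρ : ∀ f, ρ (D f) = derivTot (f : Tot))
    (x : M) (hx : x ∈ Submodule.span (C.nodeRing i) (Set.range D)) :
    ∃ (a : regAt (C.p i)) (b : regAt (C.q i)) (z : ℂ),
      x = C.germ D a b z ∧ ρ x = ((a : RatFunc ℂ), (b : RatFunc ℂ)) := by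
  have hle : Submodule.span (C.nodeRing i) (Set.range D) ≤
      Submodule.span (C.nodeRing i) {C.dLeft D, C.dRight D} := by
    rw [Submodule.span_le]
    rintro _ ⟨f, rfl⟩
    rw [SetLike.mem_coe, D_nodeRing]
    exact add_mem (Submodule.smul_mem _ _ (Submodule.subset_span (by simp)))
      (Submodule.smul_mem _ _ (Submodule.subset_span (by simp)))
  obtain ⟨a, b, rfl⟩ := Submodule.mem_span_pair.1 (hle hx)
  refine ⟨C.resLeft i a, C.resRight i b, regVal _ (regDeriv _ (C.resLeft i b)) -
    regVal _ (regDeriv _ (C.resRight i a)), ?_, ?_⟩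
  · rw [smul_dLeft, smul_dRight]
    exact sub_smul_add_add_smul _ _ _ rfl
  · have hL : ρ (C.dLeft D) = (1, 0) := by
      rw [dLeft, hρ]
      exact Prod.ext ratDeriv_X (ratDeriv_const _)
    have hR : ρ (C.dRight D) = (0, 1) := by
      rw [dRight, hρ]
      exact Prod.ext (ratDeriv_const _) ratDeriv_X
    rw [map_add, map_smul, map_smul, hL, hR]
    refine Prod.ext ?_ ?_
    · change a.1.1 * 1 + b.1.1 * 0 = a.1.1
      ring
    · change a.1.2 * 0 + b.1.2 * 1 = b.1.2
      ring

end Derivation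

theorem wronskianDiff_nodeRing (f₁ f₂ : C.nodeRing i) : wronskianDiff f₁ f₂ =
    C.germ (KaehlerDifferential.D ℂ (C.nodeRing i))
      (C.resLeft i f₁ * regDeriv _ (C.resLeft i f₂) - C.resLeft i f₂ * regDeriv _ (C.resLeft i f₁))
      (C.resRight i f₁ * regDeriv _ (C.resRight i f₂) -
        C.resRight i f₂ * regDeriv _ (C.resRight i f₁))
      (2 * (regVal _ (regDeriv _ (C.resLeft i f₁)) * regVal _ (regDeriv _ (C.resRight i f₂)) -
        regVal _ (regDeriv _ (C.resLeft i f₂)) * regVal _ (regDeriv _ (C.resRight i f₁)))) :=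
  C.wronskian_nodeRing (KaehlerDifferential.D ℂ (C.nodeRing i)) f₁ f₂

theorem exists_eq_of_kaehler (x : Ω[C.nodeRing i⁄ℂ]) :
    ∃ (a : regAt (C.p i)) (b : regAt (C.q i)) (z : ℂ),
      x = C.germ (KaehlerDifferential.D ℂ (C.nodeRing i)) a b z ∧
        C.restr i x = ((a : RatFunc ℂ), (b : RatFunc ℂ)) := by
  refine C.exists_eq_of_mem_span (KaehlerDifferential.D ℂ (C.nodeRing i)) (C.restr i)
    (fun f => ?_) x ?_
  · rw [restr, Derivation.liftKaehlerDifferential_comp_D]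
    rfl
  · rw [KaehlerDifferential.span_range_derivation]
    trivial

end BinaryCurve

/-! ### Simple poles -/

/-- The linear function with zero at `c`. -/
def linAt (c : ℂ) : RatFunc ℂ := RatFunc.X - RatFunc.C c

/-- The function with a simple pole at `c`. -/
def poleAt (c : ℂ) : RatFunc ℂ := (linAt c)⁻¹

theorem linAt_eq (c : ℂ) :
    linAt c = algebraMap ℂ[X] (RatFunc ℂ) (Polynomial.X - Polynomial.C c) := by
  rw [linAt, map_sub, RatFunc.algebraMap_X, RatFunc.algebraMap_C]

theorem linAt_ne_zero (c : ℂ) : linAt c ≠ 0 := by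
  rw [linAt_eq]
  exact RatFunc.algebraMap_ne_zero (Polynomial.X_sub_C_ne_zero c)

theorem linAt_mul_poleAt (c : ℂ) : linAt c * poleAt c = 1 := mul_inv_cancel₀ (linAt_ne_zero c)

theorem isRegularAt_linAt (b c : ℂ) : IsRegularAt b (linAt c) := by
  rw [linAt_eq]
  exact isRegularAt_algebraMap _ _

theorem isRegularAt_poleAt {b c : ℂ} (h : b ≠ c) : IsRegularAt b (poleAt c) :=
  isRegularAt_of_eq 1 (Polynomial.X - Polynomial.C c) (by simpa [sub_eq_zero] using h)
    (by rw [poleAt, linAt_eq, map_one, one_div])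

theorem value_linAt (b c : ℂ) : value b (linAt c) = b - c := by
  rw [linAt_eq, value, RatFunc.eval_algebraMap]
  simp

theorem value_poleAt {b c : ℂ} (h : b ≠ c) : value b (poleAt c) = (b - c)⁻¹ := by
  have h1 := value_mul (isRegularAt_linAt b c) (isRegularAt_poleAt h)
  have h2 := value_const b 1
  rw [map_one] at h2
  rw [linAt_mul_poleAt, value_linAt, h2] at h1
  exact eq_inv_of_mul_eq_one_right h1.symm

theorem ratDeriv_linAt (c : ℂ) : ratDeriv (linAt c) = 1 := by
  rw [linAt_eq, ratDeriv_algebraMap]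
  simp

theorem ratDeriv_poleAt (c : ℂ) : ratDeriv (poleAt c) = -poleAt c ^ 2 := by
  have h := ratDeriv_mul (linAt c) (poleAt c)
  have h1 := ratDeriv_const 1
  rw [map_one] at h1
  rw [linAt_mul_poleAt, h1, ratDeriv_linAt] at h
  linear_combination (-poleAt c) * h - ratDeriv (poleAt c) * linAt_mul_poleAt c

theorem poleAt_sub_poleAt (b c : ℂ) : poleAt b - poleAt c = (b - c) • (poleAt b * poleAt c) := by
  have h1 := linAt_mul_poleAt b
  have h2 := linAt_mul_poleAt c
  have h3 : linAt c - linAt b = algebraMap ℂ (RatFunc ℂ) (b - c) := by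
    rw [linAt, linAt, map_sub, RatFunc.algebraMap_eq_C]
    ring
  rw [Algebra.smul_def, ← h3]
  linear_combination poleAt c * h1 - poleAt b * h2

/-- The wedge of two functions with simple poles. -/
theorem poleAt_wedge (b c : ℂ) : poleAt b * poleAt c * (poleAt b - poleAt c) =
    (b - c)⁻¹ • (poleAt b ^ 2 + poleAt c ^ 2) - (2 * (b - c)⁻¹ ^ 2) • (poleAt b - poleAt c) := by
  by_cases h : b = c
  · simp [h]
  · have h0 : algebraMap ℂ (RatFunc ℂ) (b - c) * algebraMap ℂ (RatFunc ℂ) (b - c)⁻¹ = 1 := by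
      rw [← map_mul, mul_inv_cancel₀ (sub_ne_zero.2 h), map_one]
    have h1 := poleAt_sub_poleAt b c
    simp only [Algebra.smul_def, map_mul, map_pow, map_ofNat] at h1 ⊢
    generalize algebraMap ℂ (RatFunc ℂ) (b - c) = d at *
    generalize algebraMap ℂ (RatFunc ℂ) (b - c)⁻¹ = e at *
    have h2 : poleAt b * poleAt c = e * (poleAt b - poleAt c) := by
      linear_combination (-e) * h1 - (poleAt b * poleAt c) * h0
    linear_combination (poleAt b - poleAt c) * h2 - 2 * e * h2

theorem isRegularAt_linAt_mul_poleAt {ι : Type*} {p : ι → ℂ} (hp : Function.Injective p) (i j : ι) :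
    IsRegularAt (p i) (linAt (p i) * poleAt (p j)) := by
  by_cases h : i = j
  · rw [h, linAt_mul_poleAt]
    exact (regAt (p j)).one_mem
  · exact (isRegularAt_linAt _ _).mul (isRegularAt_poleAt (hp.ne h))

/-- The coefficient at the node `i` of the function with a simple pole at the node `j`. -/
def nodeTerm {ι : Type*} {p : ι → ℂ} (hp : Function.Injective p) (i j : ι) : regAt (p i) :=
  ⟨linAt (p i) * poleAt (p j), isRegularAt_linAt_mul_poleAt hp i j⟩

theorem nodeTerm_self {ι : Type*} {p : ι → ℂ} (hp : Function.Injective p) (i : ι) :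
    nodeTerm hp i i = 1 := Subtype.ext (linAt_mul_poleAt _)

theorem regVal_nodeTerm {ι : Type*} [DecidableEq ι] {p : ι → ℂ} (hp : Function.Injective p)
    (i j : ι) : regVal _ (nodeTerm hp i j) = if i = j then 1 else 0 := by
  split_ifs with h
  · rw [← h, nodeTerm_self, map_one]
  · have := value_mul (isRegularAt_linAt (p i) (p i)) (isRegularAt_poleAt (hp.ne h))
    rwa [value_linAt, sub_self, zero_mul] at this

/-- For `i ≠ j` the function `(s - pᵢ) / (s - pⱼ)` has derivative `1 / (pᵢ - pⱼ)` at `pᵢ`; for `i =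
j` it is constant, in accordance with the zero diagonal of `diffInv`. These numbers enter the
torsion coordinate. -/
theorem regVal_regDeriv_nodeTerm {ι : Type*} {p : ι → ℂ} (hp : Function.Injective p)
    (i j : ι) : regVal _ (regDeriv _ (nodeTerm hp i j)) = diffInv p i j := by
  by_cases h : i = j
  · rw [← h, nodeTerm_self, Derivation.map_one_eq_zero, map_zero, diffInv, sub_self, inv_zero]
  · have h1 := isRegularAt_poleAt (hp.ne h)
    let l : regAt (p i) := ⟨linAt (p i), isRegularAt_linAt _ _⟩
    let t : regAt (p i) := ⟨poleAt (p j), h1⟩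
    have e : nodeTerm hp i j = l * t := rfl
    have hl : regVal _ l = 0 := (value_linAt _ _).trans (sub_self _)
    have hl' : regDeriv _ l = 1 := Subtype.ext (ratDeriv_linAt _)
    rw [e, Derivation.leibniz, smul_eq_mul, smul_eq_mul, map_add, map_mul, map_mul, hl, hl',
      zero_mul, zero_add, map_one, mul_one]
    exact value_poleAt (hp.ne h)

/-! ### Sections with given residues -/

theorem VanishesAtInfty.sum {α : Type*} {n : ℕ} (s : Finset α) {f : α → RatFunc ℂ}
    (hf : ∀ a ∈ s, VanishesAtInfty n (f a)) : VanishesAtInfty n (∑ a ∈ s, f a) :=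
  Finset.sum_induction f (VanishesAtInfty n) (fun _ _ => VanishesAtInfty.add)
    (vanishesAtInfty_zero n) hf

/-- As the residues add up to zero, the pole at `p 0` may be subtracted from each term, and a
difference of two simple poles has order two at infinity. -/
theorem vanishesAtInfty_sum_poleAt {n : ℕ} (p : Fin (n + 1) → ℂ) (a : Fin (n + 1) → ℂ)
    (ha : ∑ j, a j = 0) : VanishesAtInfty 2 (∑ j, a j • poleAt (p j)) := by
  have e : ∑ j, a j • poleAt (p j) = ∑ j, a j • (poleAt (p j) - poleAt (p 0)) := by
    simp only [smul_sub, Finset.sum_sub_distrib, ← Finset.sum_smul, ha, zero_smul, sub_zero]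
  rw [e]
  refine VanishesAtInfty.sum _ fun j _ => VanishesAtInfty.smul _ ?_
  rw [poleAt_sub_poleAt]
  refine VanishesAtInfty.smul _ ?_
  rw [vanishesAtInfty_iff (p := 1)
    (q := (Polynomial.X - Polynomial.C (p j)) * (Polynomial.X - Polynomial.C (p 0)))
    (mul_ne_zero (Polynomial.X_sub_C_ne_zero _) (Polynomial.X_sub_C_ne_zero _))]
  · rw [Polynomial.degree_mul, Polynomial.degree_X_sub_C, Polynomial.degree_X_sub_C,
      Polynomial.degree_one]
    norm_num
  · rw [poleAt, poleAt, linAt_eq, linAt_eq, map_mul, map_one, one_div, mul_inv]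

theorem isRegularAt_sum_poleAt {n : ℕ} (p : Fin n → ℂ) (a : Fin n → ℂ) {c : ℂ}
    (hc : c ∉ Set.range p) : IsRegularAt c (∑ j, a j • poleAt (p j)) :=
  (regAt c).sum_mem fun j _ => (regAt c).smul_mem
    (isRegularAt_poleAt fun e => hc ⟨j, e.symm⟩) _

namespace BinaryCurve

variable {g : ℕ} (C : BinaryCurve g) (h : Fin (g + 1) → ℤˣ)

/-- The rational section of `ω_C ⊗ A` with given residues. -/
def residueSection (a : Fin (g + 1) → ℂ) : Tot :=
  (∑ j, a j • poleAt (C.p j), ∑ j, (-(signVal h j * a j)) • poleAt (C.q j))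

theorem coeff_eq_linAt (i : Fin (g + 1)) (σ : Tot) : C.coeff h i σ =
    (linAt (C.p i) * σ.1, (-signVal h i) • (linAt (C.q i) * σ.2)) := by
  have e : C.xi i * ell h i = (poleAt (C.p i) * 1, -poleAt (C.q i) * ((h i : ℤ) : RatFunc ℂ)) := rfl
  rw [coeff, e]
  refine Prod.ext ?_ ?_
  · change σ.1 / (poleAt (C.p i) * 1) = _
    rw [mul_one, poleAt, div_inv_eq_mul, mul_comm]
  · change σ.2 / (-poleAt (C.q i) * ((h i : ℤ) : RatFunc ℂ)) = _
    rcases Int.units_eq_one_or (h i) with e | e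
    · simp only [signVal, e, poleAt]
      simp [div_neg, mul_comm]
    · simp only [signVal, e, poleAt]
      simp [mul_comm]

theorem coeff_residueSection (i : Fin (g + 1)) (a : Fin (g + 1) → ℂ) :
    C.coeff h i (C.residueSection h a) =
      (((∑ j, a j • nodeTerm C.p_injective i j : regAt (C.p i)) : RatFunc ℂ),
        ((∑ j, (signVal h i * signVal h j * a j) • nodeTerm C.q_injective i j : regAt (C.q i)) :
          RatFunc ℂ)) := by
  rw [coeff_eq_linAt, residueSection]
  refine Prod.ext ?_ ?_
  · simp only [AddSubmonoidClass.coe_finsetSum, Finset.mul_sum, SetLike.val_smul, nodeTerm,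
      mul_smul_comm]
  · simp only [AddSubmonoidClass.coe_finsetSum, Finset.mul_sum, SetLike.val_smul, nodeTerm,
      mul_smul_comm, Finset.smul_sum, smul_smul]
    refine Finset.sum_congr rfl fun j _ => ?_
    congr 1
    ring

theorem signVal_mul_self (i : Fin (g + 1)) : signVal h i * signVal h i = 1 := by
  rcases Int.units_eq_one_or (h i) with e | e <;> simp [signVal, e]

/-- At the `i`-th node both branches of the coefficient take the value `a i`, because `hᵢ² = 1`.
Whether all sections arise in this way does not matter for surjectivity. -/
theorem residueSection_mem {a : Fin (g + 1) → ℂ} (ha : a ∈ signKer (signVal h)) :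
    C.residueSection h a ∈ C.prymSections h := by
  refine ⟨⟨fun c hc => isRegularAt_sum_poleAt _ _ hc, fun c hc => isRegularAt_sum_poleAt _ _ hc⟩,
    vanishesAtInfty_sum_poleAt _ _ ha.1, vanishesAtInfty_sum_poleAt _ _ ?_, fun i => ?_⟩
  · rw [Finset.sum_neg_distrib, ha.2, neg_zero]
  · rw [coeff_residueSection]
    refine ⟨Subtype.prop _, Subtype.prop _, ?_⟩
    change regVal _ (∑ j, a j • nodeTerm C.p_injective i j) = regVal _ (∑ j, _ • _)
    simp only [map_sum, map_smul, regVal_nodeTerm, smul_eq_mul, mul_ite, mul_one, mul_zero,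
      Finset.sum_ite_eq, Finset.mem_univ, if_true, signVal_mul_self, one_mul]

theorem resLeft_localCoeff (i : Fin (g + 1)) {a : Fin (g + 1) → ℂ}
    (ha : a ∈ signKer (signVal h)) :
    C.resLeft i (C.localCoeff h i ⟨_, C.residueSection_mem h ha⟩) =
      ∑ j, a j • nodeTerm C.p_injective i j :=
  Subtype.ext (congrArg Prod.fst (C.coeff_residueSection h i a))

theorem resRight_localCoeff (i : Fin (g + 1)) {a : Fin (g + 1) → ℂ}
    (ha : a ∈ signKer (signVal h)) :
    C.resRight i (C.localCoeff h i ⟨_, C.residueSection_mem h ha⟩) =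
      ∑ j, (signVal h i * signVal h j * a j) • nodeTerm C.q_injective i j :=
  Subtype.ext (congrArg Prod.snd (C.coeff_residueSection h i a))

/-- A value of the Gaussian map, with germs at the nodes, lies over a pair of cubic differentials
with numbers that measure the torsion at the nodes. -/
def LiesOver (w : Tot × (∀ i : Fin (g + 1), Ω[C.nodeRing i⁄ℂ])) (v : Tot × (Fin (g + 1) → ℂ)) :
    Prop :=
  w.1 = v.1 ∧ ∀ i, ∃ (a : regAt (C.p i)) (b : regAt (C.q i)),
    (a : RatFunc ℂ) = linAt (C.p i) ^ 2 * v.1.1 ∧ (b : RatFunc ℂ) = linAt (C.q i) ^ 2 * v.1.2 ∧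
      w.2 i = C.germ (KaehlerDifferential.D ℂ (C.nodeRing i)) a b (v.2 i)

variable {C}

/-- Only this direction is needed: the numbers at the nodes determine the germs. That they are
themselves determined, i.e. that the torsion is non-zero, plays no role. -/
theorem LiesOver.unique {w w' : Tot × (∀ i : Fin (g + 1), Ω[C.nodeRing i⁄ℂ])}
    {v : Tot × (Fin (g + 1) → ℂ)} (hw : C.LiesOver w v) (hw' : C.LiesOver w' v) : w = w' := by
  refine Prod.ext (hw.1.trans hw'.1.symm) (funext fun i => ?_)
  obtain ⟨a, b, ha, hb, e⟩ := hw.2 i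
  obtain ⟨a', b', ha', hb', e'⟩ := hw'.2 i
  rw [e, e', Subtype.ext (ha.trans ha'.symm), Subtype.ext (hb.trans hb'.symm)]

theorem LiesOver.add {w w' : Tot × (∀ i : Fin (g + 1), Ω[C.nodeRing i⁄ℂ])}
    {v v' : Tot × (Fin (g + 1) → ℂ)} (hw : C.LiesOver w v) (hw' : C.LiesOver w' v') :
    C.LiesOver (w + w') (v + v') := by
  refine ⟨by rw [Prod.fst_add, Prod.fst_add, hw.1, hw'.1], fun i => ?_⟩
  obtain ⟨a, b, ha, hb, e⟩ := hw.2 i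
  obtain ⟨a', b', ha', hb', e'⟩ := hw'.2 i
  refine ⟨a + a', b + b', ?_, ?_, ?_⟩
  · rw [AddMemClass.coe_add, ha, ha', Prod.fst_add, Prod.fst_add, mul_add]
  · rw [AddMemClass.coe_add, hb, hb', Prod.fst_add, Prod.snd_add, mul_add]
  · rw [Prod.snd_add, Pi.add_apply, e, e', Prod.snd_add, Pi.add_apply]
    exact (C.germ_add (KaehlerDifferential.D ℂ (C.nodeRing i)) _ _ _ _ _ _).symm

theorem LiesOver.smul (z : ℂ) {w : Tot × (∀ i : Fin (g + 1), Ω[C.nodeRing i⁄ℂ])}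
    {v : Tot × (Fin (g + 1) → ℂ)} (hw : C.LiesOver w v) : C.LiesOver (z • w) (z • v) := by
  refine ⟨by rw [Prod.smul_fst, Prod.smul_fst, hw.1], fun i => ?_⟩
  obtain ⟨a, b, ha, hb, e⟩ := hw.2 i
  refine ⟨z • a, z • b, ?_, ?_, ?_⟩
  · rw [SetLike.val_smul, ha, Prod.smul_fst, Prod.smul_fst, mul_smul_comm]
  · rw [SetLike.val_smul, hb, Prod.smul_fst, Prod.smul_snd, mul_smul_comm]
  · rw [Prod.smul_snd, Pi.smul_apply, e, Prod.smul_snd, Pi.smul_apply]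
    exact (C.germ_smul (KaehlerDifferential.D ℂ (C.nodeRing i)) _ _ _ _).symm

/-- The normal form of Kähler differentials at each node supplies the torsion numbers;
multiplication by the square of the local coordinate undoes `ξᵢ²`. -/
theorem exists_liesOver {w : Tot × (∀ i : Fin (g + 1), Ω[C.nodeRing i⁄ℂ])}
    (hw : w ∈ C.cubicSections) : ∃ z, C.LiesOver w (w.1, z) := by
  choose a b z hx hr using fun i => C.exists_eq_of_kaehler i (w.2 i)
  refine ⟨z, rfl, fun i => ⟨a i, b i, ?_, ?_, hx i⟩⟩
  · have := congrArg Prod.fst (hw.2.2.2 i)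
    rw [hr i] at this
    change (a i : RatFunc ℂ) * poleAt (C.p i) ^ 2 = w.1.1 at this
    rw [← this]
    have := linAt_mul_poleAt (C.p i)
    linear_combination (-(a i : RatFunc ℂ) * (linAt (C.p i) * poleAt (C.p i) + 1)) * this
  · have := congrArg Prod.snd (hw.2.2.2 i)
    rw [hr i] at this
    change (b i : RatFunc ℂ) * (-poleAt (C.q i)) ^ 2 = w.1.2 at this
    rw [← this]
    have := linAt_mul_poleAt (C.q i)
    linear_combination (-(b i : RatFunc ℂ) * (linAt (C.q i) * poleAt (C.q i) + 1)) * this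

end BinaryCurve

/-! ### Partial fractions -/

/-- The function with given polar parts of order at most two. -/
def polarSum {n : ℕ} (p : Fin n → ℂ) : (Fin n → ℂ) × (Fin n → ℂ) →ₗ[ℂ] RatFunc ℂ where
  -- The factor `-2` is that of the simple poles in `poleAt_wedge`, which `pairGauss` leaves out.
  toFun uv := ∑ r, (uv.1 r • poleAt (p r) ^ 2 - (2 * uv.2 r) • poleAt (p r))
  map_add' x y := by
    rw [← Finset.sum_add_distrib]
    refine Finset.sum_congr rfl fun r _ => ?_
    simp only [Prod.fst_add, Prod.snd_add, Pi.add_apply, mul_add, add_smul]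
    abel
  map_smul' z x := by
    rw [RingHom.id_apply, Finset.smul_sum]
    refine Finset.sum_congr rfl fun r _ => ?_
    simp only [Prod.smul_fst, Prod.smul_snd, Pi.smul_apply, smul_eq_mul, smul_sub, smul_smul,
      mul_left_comm z 2]

/-- After multiplication by `(s - pᵢ)²`, the value at `pᵢ` is `u i` and the derivative there is `-2
v i`. -/
theorem polarSum_injective {n : ℕ} {p : Fin n → ℂ} (hp : Function.Injective p) :
    Function.Injective (polarSum p) := by
  rw [injective_iff_map_eq_zero]
  rintro ⟨u, v⟩ h0
  have key : ∀ i, u i = 0 ∧ -(2 * v i) = 0 := by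
    intro i
    let l : regAt (p i) := ⟨linAt (p i), isRegularAt_linAt _ _⟩
    let f : regAt (p i) := ∑ r, (u r • nodeTerm hp i r ^ 2 - (2 * v r) • (l * nodeTerm hp i r))
    have hf : f = 0 := by
      apply Subtype.ext
      have e : (f : RatFunc ℂ) = linAt (p i) ^ 2 * polarSum p (u, v) := by
        simp only [f, polarSum, LinearMap.coe_mk, AddHom.coe_mk, AddSubmonoidClass.coe_finsetSum,
          Finset.mul_sum]
        refine Finset.sum_congr rfl fun r _ => ?_
        change u r • (linAt (p i) * poleAt (p r)) ^ 2 -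
          (2 * v r) • (linAt (p i) * (linAt (p i) * poleAt (p r))) = _
        rw [mul_sub, mul_smul_comm, mul_smul_comm]
        congr 2 <;> ring
      rw [e, h0, mul_zero]
      rfl
    have hl : regVal _ l = 0 := (value_linAt _ _).trans (sub_self _)
    have hl' : regDeriv _ l = 1 := Subtype.ext (ratDeriv_linAt _)
    have h1 : regVal _ f = u i := by
      simp only [f, map_sum, map_sub, map_smul, map_mul, map_pow, hl, zero_mul, regVal_nodeTerm,
        smul_eq_mul, mul_zero, sub_zero, ite_pow, one_pow]
      simp
    have h2 : regVal _ (regDeriv _ f) = -(2 * v i) := by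
      have hr : ∀ r, regVal _ (regDeriv _ (u r • nodeTerm hp i r ^ 2 -
          (2 * v r) • (l * nodeTerm hp i r))) = if i = r then -(2 * v i) else 0 := by
        intro r
        rw [map_sub, Derivation.map_smul, Derivation.map_smul, sq, Derivation.leibniz,
          Derivation.leibniz, hl', map_sub, map_smul, map_smul]
        simp only [smul_eq_mul, map_add, map_mul, hl, regVal_nodeTerm, regVal_regDeriv_nodeTerm,
          mul_one, zero_mul, zero_add]
        split_ifs with e
        · simp [diffInv, e]
        · simp
      simp only [f, map_sum, hr, Finset.sum_ite_eq, Finset.mem_univ, if_true]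
    rw [hf, map_zero] at h1
    rw [hf, map_zero, map_zero] at h2
    exact ⟨h1.symm, h2.symm⟩
  refine Prod.ext (funext fun i => (key i).1) (funext fun i => ?_)
  simpa using (key i).2

/-- The cubic differentials on the components and the torsion with given coordinates. -/
def polarMap {n : ℕ} (p q : Fin n → ℂ) : (Fin 5 × Fin n → ℂ) →ₗ[ℂ] Tot × (Fin n → ℂ) where
  toFun w := ((polarSum p (fun r => w (0, r), fun r => w (1, r)),
    polarSum q (fun r => w (2, r), fun r => w (3, r))), fun r => 2 * w (4, r))
  map_add' x y := by
    refine Prod.ext (Prod.ext ?_ ?_) ?_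
    · exact map_add (polarSum p) (fun r => x (0, r), fun r => x (1, r)) (fun r => y (0, r), fun r => y (1, r))
    · exact map_add (polarSum q) (fun r => x (2, r), fun r => x (3, r)) (fun r => y (2, r), fun r => y (3, r))
    · funext r
      simp [mul_add]
  map_smul' z x := by
    refine Prod.ext (Prod.ext ?_ ?_) ?_
    · exact map_smul (polarSum p) z (fun r => x (0, r), fun r => x (1, r))
    · exact map_smul (polarSum q) z (fun r => x (2, r), fun r => x (3, r))
    · funext r
      simp [mul_left_comm]

theorem polarMap_injective {n : ℕ} {p q : Fin n → ℂ} (hp : Function.Injective p)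
    (hq : Function.Injective q) : Function.Injective (polarMap p q) := by
  rw [injective_iff_map_eq_zero]
  intro w hw
  have h1 := (injective_iff_map_eq_zero _).1 (polarSum_injective hp) _
    (congrArg (fun v => v.1.1) hw)
  have h2 := (injective_iff_map_eq_zero _).1 (polarSum_injective hq) _
    (congrArg (fun v => v.1.2) hw)
  funext ⟨t, r⟩
  have h3 := congrFun (congrArg Prod.snd hw) r
  fin_cases t
  · exact congrFun (congrArg Prod.fst h1) r
  · exact congrFun (congrArg Prod.snd h1) r
  · exact congrFun (congrArg Prod.fst h2) r
  · exact congrFun (congrArg Prod.snd h2) r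
  · exact (mul_eq_zero.1 h3).resolve_left two_ne_zero

theorem polarSum_pair {n : ℕ} (p : Fin n → ℂ) (z : ℂ) (j k : Fin n) :
    polarSum p (fun r => z * ((if r = j then diffInv p j k else 0) +
        (if r = k then diffInv p j k else 0)),
      fun r => z * ((if r = j then diffInv p j k ^ 2 else 0) -
        (if r = k then diffInv p j k ^ 2 else 0))) =
      z • (poleAt (p j) * poleAt (p k) * (poleAt (p j) - poleAt (p k))) := by
  rw [poleAt_wedge]
  simp only [polarSum, LinearMap.coe_mk, AddHom.coe_mk, mul_add, mul_sub, add_smul, sub_smul,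
    Finset.sum_sub_distrib, Finset.sum_add_distrib, mul_ite, mul_zero, ite_smul, zero_smul,
    Finset.sum_ite_eq', Finset.mem_univ, if_true, diffInv, smul_sub, smul_add, smul_smul,
    mul_left_comm (2 : ℂ) z]

/-- Expand bilinearly, using that the derivative of a simple pole is minus its square, and
interchange the indices in the second double sum. -/
theorem wronskian_sum_poleAt {n : ℕ} (p : Fin n → ℂ) (a b : Fin n → ℂ) :
    (∑ j, a j • poleAt (p j)) * ratDeriv (∑ j, b j • poleAt (p j)) -
      (∑ j, b j • poleAt (p j)) * ratDeriv (∑ j, a j • poleAt (p j)) =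
    ∑ j, ∑ k, (a j * b k) • (poleAt (p j) * poleAt (p k) * (poleAt (p j) - poleAt (p k))) := by
  have hd : ∀ c : Fin n → ℂ, ratDeriv (∑ j, c j • poleAt (p j)) =
      ∑ j, c j • -poleAt (p j) ^ 2 := by
    intro c
    have : derivRat (∑ j, c j • poleAt (p j)) = ∑ j, c j • derivRat (poleAt (p j)) := by
      rw [map_sum]
      exact Finset.sum_congr rfl fun j _ => derivRat.map_smul _ _
    refine this.trans (Finset.sum_congr rfl fun j _ => ?_)
    exact congrArg _ (ratDeriv_poleAt _)
  rw [hd, hd, Finset.sum_mul_sum, Finset.sum_mul_sum]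
  conv_lhs => rw [Finset.sum_comm (f := fun j k => b j • poleAt (p j) * a k • -poleAt (p k) ^ 2)]
  rw [← Finset.sum_sub_distrib]
  refine Finset.sum_congr rfl fun j _ => ?_
  rw [← Finset.sum_sub_distrib]
  refine Finset.sum_congr rfl fun k _ => ?_
  simp only [Algebra.smul_def, map_mul]
  ring

/-- A common factor comes out of the Wronskian squared, its own derivative cancelling; the sign
squares to one. -/
theorem linAt_sq_mul_wronskian {c : ℂ} (z : ℂ) (hz : z ^ 2 = 1) {f₁ f₂ σ τ : RatFunc ℂ}
    (h₁ : f₁ = z • (linAt c * σ)) (h₂ : f₂ = z • (linAt c * τ)) :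
    f₁ * ratDeriv f₂ - f₂ * ratDeriv f₁ =
      linAt c ^ 2 * (σ * ratDeriv τ - τ * ratDeriv σ) := by
  have hd : ∀ f, ratDeriv (z • (linAt c * f)) = z • (f + linAt c * ratDeriv f) := by
    intro f
    refine (derivRat.map_smul z _).trans (congrArg _ ?_)
    refine (ratDeriv_mul _ _).trans ?_
    rw [ratDeriv_linAt]
    ring
  have hz' : algebraMap ℂ (RatFunc ℂ) z ^ 2 = 1 := by rw [← map_pow, hz, map_one]
  rw [h₁, h₂, hd, hd]
  simp only [Algebra.smul_def]
  linear_combination (linAt c ^ 2 * (σ * ratDeriv τ - τ * ratDeriv σ)) * hz'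

namespace BinaryCurve

variable {g : ℕ} (C : BinaryCurve g) (h : Fin (g + 1) → ℤˣ)

/-- The generic values agree by `poleAt_wedge`; the torsion agrees because it depends only on the
derivatives at the node of the two branches of each coefficient. -/
theorem liesOver_gaussValue {a b : Fin (g + 1) → ℂ} (ha : a ∈ signKer (signVal h))
    (hb : b ∈ signKer (signVal h)) :
    C.LiesOver (C.gaussValue h ⟨_, C.residueSection_mem h ha⟩ ⟨_, C.residueSection_mem h hb⟩)
      (∑ j, ∑ k, (a j * b k) • polarMap C.p C.q
        (pairGauss (diffInv C.p) (diffInv C.q) (signVal h) j k)) := by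
  have hval : ∀ (i : Fin (g + 1)) {a : Fin (g + 1) → ℂ} (ha : a ∈ signKer (signVal h)),
      regVal _ (regDeriv _ (C.resLeft i (C.localCoeff h i ⟨_, C.residueSection_mem h ha⟩))) =
        ∑ j, a j * diffInv C.p i j ∧
      regVal _ (regDeriv _ (C.resRight i (C.localCoeff h i ⟨_, C.residueSection_mem h ha⟩))) =
        ∑ j, signVal h i * signVal h j * a j * diffInv C.q i j := by
    intro i a ha
    rw [C.resLeft_localCoeff h i ha, C.resRight_localCoeff h i ha]
    simp only [map_sum, Derivation.map_smul, map_smul, regVal_regDeriv_nodeTerm, smul_eq_mul, and_self]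
  have hw : (C.gaussValue h ⟨_, C.residueSection_mem h ha⟩ ⟨_, C.residueSection_mem h hb⟩).1 =
      (∑ j, ∑ k, (a j * b k) • polarMap C.p C.q
        (pairGauss (diffInv C.p) (diffInv C.q) (signVal h) j k)).1 := by
    rw [Prod.fst_sum]
    simp only [Prod.fst_sum, Prod.smul_fst]
    refine Prod.ext ?_ ?_
    · rw [Prod.fst_sum]
      simp only [Prod.fst_sum, Prod.smul_fst]
      refine (wronskian_sum_poleAt C.p a b).trans ?_
      refine Finset.sum_congr rfl fun j _ => Finset.sum_congr rfl fun k _ => ?_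
      congr 1
      have := polarSum_pair C.p 1 j k
      simp only [one_mul, one_smul] at this
      exact this.symm
    · rw [Prod.snd_sum]
      simp only [Prod.snd_sum, Prod.smul_snd]
      refine (wronskian_sum_poleAt C.q _ _).trans ?_
      refine Finset.sum_congr rfl fun j _ => Finset.sum_congr rfl fun k _ => ?_
      have := polarSum_pair C.q (signVal h j * signVal h k) j k
      refine Eq.trans ?_ (congrArg _ this.symm)
      rw [smul_smul]
      congr 1
      ring
  refine ⟨hw, fun i => ⟨_, _, ?_, ?_, (C.wronskianDiff_nodeRing i _ _).trans (congrArg _ ?_)⟩⟩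
  · rw [← hw]
    exact linAt_sq_mul_wronskian 1 (one_pow 2)
      ((congrArg Prod.fst (C.coeff_eq_linAt h i _)).trans (one_smul _ _).symm)
      ((congrArg Prod.fst (C.coeff_eq_linAt h i _)).trans (one_smul _ _).symm)
  · rw [← hw]
    exact linAt_sq_mul_wronskian (-signVal h i) (by rw [neg_sq, sq, signVal_mul_self])
      (congrArg Prod.snd (C.coeff_eq_linAt h i _)) (congrArg Prod.snd (C.coeff_eq_linAt h i _))
  · rw [(hval i ha).1, (hval i ha).2, (hval i hb).1, (hval i hb).2, Prod.snd_sum,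
      Finset.sum_apply, Finset.sum_mul_sum, Finset.sum_mul_sum]
    conv_lhs => rw [Finset.sum_comm (f := fun j k => b j * diffInv C.p i j * _)]
    rw [← Finset.sum_sub_distrib, Finset.mul_sum]
    refine Finset.sum_congr rfl fun j _ => ?_
    rw [← Finset.sum_sub_distrib, Finset.mul_sum, Prod.snd_sum, Finset.sum_apply]
    refine Finset.sum_congr rfl fun k _ => ?_
    change _ = a j * b k * (2 * (signVal h i * (signVal h k * (diffInv C.p i j * diffInv C.q i k) -
      signVal h j * (diffInv C.p i k * diffInv C.q i j))))
    ring

end BinaryCurve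

/-! ### Cubic differentials with double poles -/

/-- The square of the polynomial with zeros at given points. -/
def polarDenom {n : ℕ} (p : Fin n → ℂ) : ℂ[X] := ∏ j, (Polynomial.X - Polynomial.C (p j)) ^ 2

theorem polarDenom_ne_zero {n : ℕ} (p : Fin n → ℂ) : polarDenom p ≠ 0 :=
  Finset.prod_ne_zero_iff.2 fun j _ => pow_ne_zero 2 (Polynomial.X_sub_C_ne_zero (p j))

theorem degree_polarDenom {n : ℕ} (p : Fin n → ℂ) : (polarDenom p).degree = (2 * n : ℕ) := by
  rw [polarDenom, Polynomial.degree_prod]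
  simp [Polynomial.degree_pow, mul_comm]

/-- Division by the square of the polynomial with zeros at given points. -/
def polarFun {n : ℕ} (p : Fin n → ℂ) : ℂ[X] →ₗ[ℂ] RatFunc ℂ where
  toFun P := algebraMap _ _ P / algebraMap _ _ (polarDenom p)
  map_add' P Q := by rw [map_add, add_div]
  map_smul' z P := by
    rw [RingHom.id_apply, Algebra.smul_def, Algebra.smul_def, map_mul, mul_div_assoc]
    rfl

theorem exists_eq_algebraMap {f : RatFunc ℂ} (hf : ∀ c, IsRegularAt c f) :
    ∃ P : ℂ[X], f = algebraMap _ _ P := by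
  have h1 : f.denom = 1 := by
    by_contra h1
    obtain ⟨c, hc⟩ := IsAlgClosed.exists_root f.denom fun h0 =>
      h1 (f.monic_denom.degree_le_zero_iff_eq_one.1 h0.le)
    exact hf c hc
  refine ⟨f.num, ?_⟩
  conv_lhs => rw [← RatFunc.num_div_denom f, h1, map_one, div_one]

/-- Multiplying by `polarDenom`, of degree `2n`, removes all poles and leaves a polynomial `P`;
vanishing to order `6` at infinity means `deg P ≤ 2n - 6`. -/
theorem exists_eq_polarFun {n : ℕ} {p : Fin n → ℂ} {F : RatFunc ℂ}
    (hreg : ∀ c, c ∉ Set.range p → IsRegularAt c F) (hinf : VanishesAtInfty 6 F)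
    (hpole : ∀ j, IsRegularAt (p j) (linAt (p j) ^ 2 * F)) :
    ∃ P ∈ Polynomial.degreeLT ℂ (2 * n - 5), polarFun p P = F := by
  have h0 := RatFunc.algebraMap_ne_zero (polarDenom_ne_zero p)
  obtain ⟨P, hP⟩ := exists_eq_algebraMap (f := algebraMap _ _ (polarDenom p) * F) (by
    intro c
    by_cases hc : c ∈ Set.range p
    · obtain ⟨j, rfl⟩ := hc
      rw [polarDenom, ← Finset.mul_prod_erase _ _ (Finset.mem_univ j), map_mul, map_pow, ← linAt_eq,
        mul_right_comm]
      exact (hpole j).mul (isRegularAt_algebraMap _ _)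
    · exact (isRegularAt_algebraMap _ _).mul (hreg c hc))
  have e : F = algebraMap _ _ P / algebraMap _ _ (polarDenom p) := by
    rw [← hP, mul_div_cancel_left₀ _ h0]
  refine ⟨P, ?_, e.symm⟩
  rw [vanishesAtInfty_iff (polarDenom_ne_zero p) e, degree_polarDenom] at hinf
  rw [Polynomial.mem_degreeLT]
  by_cases hP0 : P = 0
  · rw [hP0, Polynomial.degree_zero]
    exact WithBot.bot_lt_coe _
  · rw [Polynomial.degree_eq_natDegree hP0] at hinf ⊢
    norm_cast at hinf ⊢
    omega

/-- The pairs of cubic differentials with at most double poles at the nodes, with torsion. -/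
def cubicSpace {n : ℕ} (p q : Fin n → ℂ) : Submodule ℂ (Tot × (Fin n → ℂ)) :=
  LinearMap.range
    ((((polarFun p).domRestrict (Polynomial.degreeLT ℂ (2 * n - 5))).prodMap
      ((polarFun q).domRestrict (Polynomial.degreeLT ℂ (2 * n - 5)))).prodMap
        (LinearMap.id : (Fin n → ℂ) →ₗ[ℂ] (Fin n → ℂ)))

instance (m : ℕ) : FiniteDimensional ℂ (Polynomial.degreeLT ℂ m) :=
  (Polynomial.degreeLTEquiv ℂ m).symm.finiteDimensional

instance {n : ℕ} (p q : Fin n → ℂ) : FiniteDimensional ℂ (cubicSpace p q) :=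
  LinearMap.finiteDimensional_range _

/-- The parameter space has dimension `2(2n - 5) + n = 5n - 10`; `3 ≤ n` keeps the natural
subtraction from truncating. -/
theorem finrank_cubicSpace_le {n : ℕ} (hn : 3 ≤ n) (p q : Fin n → ℂ) :
    Module.finrank ℂ (cubicSpace p q) + 10 ≤ 5 * n := by
  have h1 : Module.finrank ℂ (cubicSpace p q) ≤ _ := LinearMap.finrank_range_le _
  rw [Module.finrank_prod, Module.finrank_prod, (Polynomial.degreeLTEquiv ℂ (2 * n - 5)).finrank_eq,
    Module.finrank_fin_fun, Module.finrank_fin_fun] at h1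
  omega

namespace BinaryCurve

variable {g : ℕ} {C : BinaryCurve g} {h : Fin (g + 1) → ℤˣ}

theorem LiesOver.mem_cubicSpace {w : Tot × (∀ i : Fin (g + 1), Ω[C.nodeRing i⁄ℂ])}
    {v : Tot × (Fin (g + 1) → ℂ)} (hw : w ∈ C.cubicSections) (hv : C.LiesOver w v) :
    v ∈ cubicSpace C.p C.q := by
  obtain ⟨h1, h2, h3, -⟩ := hw
  rw [hv.1] at h1 h2 h3
  obtain ⟨P, hP, eP⟩ := exists_eq_polarFun h1.1 h2 fun j => by
    obtain ⟨a, b, ha, -⟩ := hv.2 j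
    rw [← ha]
    exact a.2
  obtain ⟨Q, hQ, eQ⟩ := exists_eq_polarFun h1.2 h3 fun j => by
    obtain ⟨a, b, -, hb, -⟩ := hv.2 j
    rw [← hb]
    exact b.2
  exact ⟨((⟨P, hP⟩, ⟨Q, hQ⟩), v.2), Prod.ext (Prod.ext eP eQ) rfl⟩

theorem map_gaussSpan_le_cubicSpace :
    (gaussSpan C.p C.q h).map (polarMap C.p C.q) ≤ cubicSpace C.p C.q := by
  rw [gaussSpan, map_bilinSpan, bilinSpan, Submodule.span_le]
  rintro _ ⟨a, ha, b, hb, rfl⟩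
  exact (C.liesOver_gaussValue h ha hb).mem_cubicSpace (C.gaussValue_mem h _ _)

theorem exists_gaussianMap_liesOver {v : Tot × (Fin (g + 1) → ℂ)}
    (hv : v ∈ (gaussSpan C.p C.q h).map (polarMap C.p C.q)) :
    ∃ t, C.LiesOver (C.gaussianMap h t).1 v := by
  have hval : ∀ {a b : Fin (g + 1) → ℂ} (ha : a ∈ signKer (signVal h))
      (hb : b ∈ signKer (signVal h)), ∃ t, C.LiesOver (C.gaussianMap h t).1
        (∑ j, ∑ k, (a j * b k) • polarMap C.p C.q
          (pairGauss (diffInv C.p) (diffInv C.q) (signVal h) j k)) := by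
    intro a b ha hb
    refine ⟨exteriorPower.ιMulti ℂ 2
      ![⟨_, C.residueSection_mem h ha⟩, ⟨_, C.residueSection_mem h hb⟩], ?_⟩
    rw [gaussianMap, exteriorPower.alternatingMapLinearEquiv_apply_ιMulti]
    exact C.liesOver_gaussValue h ha hb
  rw [gaussSpan, map_bilinSpan, bilinSpan] at hv
  induction hv using Submodule.span_induction with
  | mem v hv =>
    obtain ⟨a, ha, b, hb, rfl⟩ := hv
    exact hval ha hb
  | zero =>
    obtain ⟨t, ht⟩ := hval (zero_mem _) (zero_mem _)
    exact ⟨t, by simpa using ht⟩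
  | add v v' _ _ hv hv' =>
    obtain ⟨t, ht⟩ := hv
    obtain ⟨t', ht'⟩ := hv'
    refine ⟨t + t', ?_⟩
    rw [map_add]
    exact ht.add ht'
  | smul z v _ hv =>
    obtain ⟨t, ht⟩ := hv
    refine ⟨z • t, ?_⟩
    rw [map_smul]
    exact ht.smul z

/-- The Gaussian map is surjective if its values in coordinates span a space of maximal
dimension. -/
theorem surjective_gaussianMap (hg : 2 ≤ g)
    (hr : 5 * (g + 1) ≤ Module.finrank ℂ (gaussSpan C.p C.q h) + 10) :
    Function.Surjective (C.gaussianMap h) := by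
  -- The injective map `polarMap` preserves the dimension, so the lower bound `hr` meets the upper
  -- bound for `cubicSpace`.
  have heq : (gaussSpan C.p C.q h).map (polarMap C.p C.q) = cubicSpace C.p C.q := by
    refine Submodule.eq_of_le_of_finrank_le map_gaussSpan_le_cubicSpace ?_
    have h1 := finrank_cubicSpace_le (n := g + 1) (by omega) C.p C.q
    rw [← ((gaussSpan C.p C.q h).equivMapOfInjective _
      (polarMap_injective C.p_injective C.q_injective)).finrank_eq]
    omega
  rintro ⟨w, hw⟩
  obtain ⟨z, hz⟩ := exists_liesOver hw
  have hv := hz.mem_cubicSpace hw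
  rw [← heq] at hv
  obtain ⟨t, ht⟩ := exists_gaussianMap_liesOver hv
  exact ⟨t, Subtype.ext (ht.unique hz)⟩

end BinaryCurve

/-! ### Semicontinuity of the rank -/

theorem rationalOn_diffInv {σ ι : Type*} {U : Set (σ → ℂ)} (e : ι → σ)
    (hU : ∀ u ∈ U, Function.Injective fun i => u (e i)) (j k : ι) :
    RationalOn U fun u => diffInv (fun i => u (e i)) j k := by
  by_cases hjk : j = k
  · simpa [diffInv, hjk] using RationalOn.const U 0
  · exact ((RationalOn.coord U (e j)).sub (RationalOn.coord U (e k))).inv fun u hu =>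
      sub_ne_zero.2 ((hU u hu).ne hjk)

theorem rationalOn_pairGauss {σ ι : Type*} [DecidableEq ι] {U : Set (σ → ℂ)}
    {x y : (σ → ℂ) → ι → ι → ℂ} (hx : ∀ j k, RationalOn U fun u => x u j k)
    (hy : ∀ j k, RationalOn U fun u => y u j k) (s : ι → ℂ) (j k : ι) (κ : Fin 5 × ι) :
    RationalOn U fun u => pairGauss (x u) (y u) s j k κ := by
  have hite : ∀ (P : Prop) [Decidable P] {f : (σ → ℂ) → ℂ}, RationalOn U f →
      RationalOn U fun u => if P then f u else 0 := by
    intro P _ f hf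
    split_ifs
    · exact hf
    · exact RationalOn.const U 0
  obtain ⟨t, r⟩ := κ
  fin_cases t
  · exact (hite _ (hx j k)).add (hite _ (hx j k))
  · exact (hite _ ((hx j k).pow 2)).sub (hite _ ((hx j k).pow 2))
  · exact (RationalOn.const U _).mul ((hite _ (hy j k)).add (hite _ (hy j k)))
  · exact (RationalOn.const U _).mul ((hite _ ((hy j k).pow 2)).sub (hite _ ((hy j k).pow 2)))
  · exact (RationalOn.const U _).mul
      (((RationalOn.const U _).mul ((hx r j).mul (hy r k))).sub
        ((RationalOn.const U _).mul ((hx r k).mul (hy r j))))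

/-- Linear independence of vectors with rational entries is an open condition. -/
theorem exists_polynomial_linearIndependent {σ κ : Type*} [Fintype κ] [DecidableEq κ]
    {U : Set (σ → ℂ)} {r : ℕ} {v : (σ → ℂ) → Fin r → κ → ℂ}
    (hv : ∀ l i, RationalOn U fun u => v u l i) {u₀ : σ → ℂ} (hu₀ : u₀ ∈ U)
    (hli : LinearIndependent ℂ (v u₀)) : ∃ F : MvPolynomial σ ℂ, F ≠ 0 ∧
      ∀ u ∈ U, MvPolynomial.eval u F ≠ 0 → LinearIndependent ℂ (v u) := by
  -- A left inverse `N` for the vectors at `u₀` is kept fixed while `u` moves. Applied to `v u` it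
  -- gives a square matrix with rational entries that is the identity at `u₀`.
  obtain ⟨N, hN⟩ := LinearMap.exists_leftInverse_of_injective
    (Fintype.linearCombination ℂ (v u₀)) (by
      rw [LinearMap.ker_eq_bot']
      intro c hc
      exact funext (Fintype.linearIndependent_iff.1 hli c hc))
  let M : (σ → ℂ) → Matrix (Fin r) (Fin r) ℂ := fun u i l => N (v u l) i
  have hM : RationalOn U fun u => (M u).det := by
    refine RationalOn.det fun i l => ?_
    have e : ∀ w : κ → ℂ, N w i = ∑ a, w a * N (fun b => if a = b then 1 else 0) i := by
      intro w
      rw [LinearMap.pi_apply_eq_sum_univ N w, Finset.sum_apply]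
      rfl
    rw [show (fun u => M u i l) = _ from funext fun u => e (v u l)]
    exact RationalOn.sum _ fun a _ => (hv l a).mul (RationalOn.const U _)
  have hM₀ : M u₀ = 1 := by
    ext i l
    have := congrFun (LinearMap.congr_fun hN (Pi.single l 1)) i
    rw [LinearMap.comp_apply, Fintype.linearCombination_apply_single, one_smul] at this
    exact this.trans (by rw [Matrix.one_apply, LinearMap.id_apply, Pi.single_apply])
  obtain ⟨F, hF, h⟩ := hM.exists_polynomial hu₀ (by rw [hM₀, Matrix.det_one]; exact one_ne_zero)
  refine ⟨F, hF, fun u hu hFu => Fintype.linearIndependent_iff.2 fun c hc => congrFun ?_⟩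
  refine Matrix.eq_zero_of_mulVec_eq_zero (h u hu hFu) (funext fun i => ?_)
  have := congrFun (congrArg N hc) i
  rw [map_sum, map_zero, Finset.sum_apply] at this
  rw [Matrix.mulVec, dotProduct]
  refine Eq.trans (Finset.sum_congr rfl fun l _ => ?_) this
  rw [map_smul, Pi.smul_apply, smul_eq_mul, mul_comm]

/-- The space `signKer` does not depend on the nodes. So the coefficient vectors that give a basis
at the special configuration can be used at every other one, where their values stay independent on
an open set. -/
theorem exists_polynomial_finrank_gaussSpan {ι : Type*} [Fintype ι] [DecidableEq ι] (h : ι → ℤˣ)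
    {p₀ q₀ : ι → ℂ} (hp₀ : Function.Injective p₀) (hq₀ : Function.Injective q₀) :
    ∃ F : MvPolynomial (ι ⊕ ι) ℂ, F ≠ 0 ∧ ∀ p q, Function.Injective p → Function.Injective q →
      MvPolynomial.eval (Sum.elim p q) F ≠ 0 →
        Module.finrank ℂ (gaussSpan p₀ q₀ h) ≤ Module.finrank ℂ (gaussSpan p q h) := by
  obtain ⟨f, hf, -, hli⟩ := Submodule.exists_fun_fin_finrank_span_eq ℂ
    {w | ∃ a ∈ signKer (signVal h), ∃ b ∈ signKer (signVal h), w = ∑ j, ∑ k, (a j * b k) •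
      pairGauss (diffInv p₀) (diffInv q₀) (signVal h) j k}
  choose a ha b hb hab using hf
  let U : Set (ι ⊕ ι → ℂ) := {u | Function.Injective (fun i => u (Sum.inl i)) ∧
    Function.Injective fun i => u (Sum.inr i)}
  let v : (ι ⊕ ι → ℂ) → Fin (Module.finrank ℂ (gaussSpan p₀ q₀ h)) → Fin 5 × ι → ℂ := fun u l =>
    ∑ j, ∑ k, (a l j * b l k) • pairGauss (diffInv fun i => u (Sum.inl i))
      (diffInv fun i => u (Sum.inr i)) (signVal h) j k
  have hv : ∀ l κ, RationalOn U fun u => v u l κ := by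
    intro l κ
    simp only [v, Finset.sum_apply, Pi.smul_apply, smul_eq_mul]
    exact RationalOn.sum _ fun j _ => RationalOn.sum _ fun k _ => (RationalOn.const U _).mul
      (rationalOn_pairGauss (rationalOn_diffInv _ fun u hu => hu.1)
        (rationalOn_diffInv _ fun u hu => hu.2) _ _ _ _)
  obtain ⟨F, hF, hFv⟩ := exists_polynomial_linearIndependent hv (u₀ := Sum.elim p₀ q₀)
    ⟨hp₀, hq₀⟩ (by
      have e : v (Sum.elim p₀ q₀) = f := funext fun l => (hab l).symm
      rw [e]
      exact hli)
  refine ⟨F, hF, fun p q hp hq hpq => ?_⟩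
  have h1 := finrank_span_eq_card (hFv (Sum.elim p q) ⟨hp, hq⟩ hpq)
  rw [Fintype.card_fin] at h1
  rw [← h1]
  refine Submodule.finrank_mono (Submodule.span_le.2 ?_)
  rintro _ ⟨l, rfl⟩
  exact mem_bilinSpan _ (ha l) (hb l)

end PrymGauss

end

theorem theorem4p1 (g : ℕ) (hg : 12 ≤ g) (h : Fin (g + 1) → ℤˣ)
    (hbal : |∑ i, (h i : ℤ)| ≤ 1) :
    PrymGauss.ForGeneralBinaryCurve g (fun C => Function.Surjective (C.gaussianMap h)) := by
  obtain ⟨p₀, q₀, hp₀, hq₀, -, -, hr, -⟩ := PrymGauss.admissible_of_balanced (by omega) h hbal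
  obtain ⟨F, hF, hFr⟩ := PrymGauss.exists_polynomial_finrank_gaussSpan h hp₀ hq₀
  refine ⟨F, hF, fun C hC => PrymGauss.BinaryCurve.surjective_gaussianMap (by omega) ?_⟩
  have h1 := hFr C.p C.q C.p_injective C.q_injective hC
  rw [Fintype.card_fin] at hr
  omega
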